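/- **Setting.** Let $\varphi=\varphi(E,L)$ be one of the following functions, where $E_0<0$ and where $t_+^k:=t^k$ for $t>0$, $t_+^k:=0$ for $t\le 0$: - $\varphi(E,L)=(E_0-E)_+^k(L-L_0)_+^l$ with $L_0>0$, $k>0$, $l>-1$, $k<l+\frac72$, $k+l+\frac12\ge 0$; - $\varphi(E,L)=(E_0-E)_+^k$ with $0<k<\frac72$; - $\varphi(E,L)=(e^{E_0-E}-1)_+$. For $(x,v)\in\mathbb R^3\times\mathbb R^3$ put $E(x,v)=\frac12|v|^2+U_0(x)$ and $L(x,v)=|x\times v|^2$. Let $U_0\in C^2(\mathbb R^3)$ be spherically symmetric with $$\Delta U_0(x)=4\pi\int_{\mathbb R^3}\varphi(E(x,v),L(x,v))\,dv \quad (x\in\mathbb R^3),\qquad \lim_{|x|\to\infty}U_0(x)=0,$$ so that $f_0(x,v):=\varphi(E(x,v),L(x,v))$ is a steady state of the Vlasov-Poisson system, and assume that $f_0\not\equiv0$. Let $\Omega_0:=\{f_0>0\}\subset\mathbb R^3\times\mathbb R^3$, let $\Omega_0^{EL}:=\{(E(x,v),L(x,v)) : (x,v)\in\Omega_0\}$ with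 interior $\mathring\Omega_0^{EL}$, and let $\varphi':=\partial_E\varphi$. Let $H$ be the real Hilbert space of all spherically symmetric (i.e. a.e. equal to a function invariant under $(x,v)\mapsto(Ax,Av)$, $A\in SO(3)$) measurable functions $g\colon\Omega_0\to\mathbb R$ with $$\|g\|_H^2:=\int_{\Omega_0}\frac{|g(x,v)|^2}{|\varphi'(E,L)|}\,d(x,v)<\infty .$$ For $\xi\in C^1(\Omega_0)$ let $\mathcal D\xi:=v\cdot\nabla_x\xi-\nabla U_0\cdot\nabla_v\xi$. Let $\mathrm D(\mathcal D)$ be the set of all $g\in H$ for which there is $\mu\in H$ with $$\int_{\Omega_0}\frac{g\,\mathcal D\xi}{|\varphi'(E,L)|}\,d(x,v)=-\int_{\Omega_0}\frac{\mu\,\xi}{|\varphi'(E,L)|}\,d(x,v)$$ for all spherically symmetric $\xi\in C^1_c(\Omega_0)$; then $\mathcal Dg:=\mu$. Let $\mathrm D(\mathcal D^2):=\{g\in \mathrm D(\mathcal D) : \mathcal Dg\in \mathrm D(\mathcal D)\}$. For $L>0$ let $\Psi_L(r):=U_0(r)+\frac{L}{2r^2}$, $r>0$. For $(E,L)\in\mathring\Omega_0^{EL}$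 let $r_-(E,L)<r_+(E,L)$ be the two radii $r>0$ with $\Psi_L(r)=E$, and let $$T(E,L):=2\int_{r_-(E,L)}^{r_+(E,L)}\frac{dr}{\sqrt{2E-2\Psi_L(r)}} .$$ The spectrum of an operator on $H$ is the set of $\lambda\in\mathbb R$ for which it minus $\lambda$ has no bounded everywhere defined inverse. Its essential spectrum consists of those points of the spectrum which are not isolated points of the spectrum that are eigenvalues of finite multiplicity. **Theorem.** The function $\mu$ above is unique, so $\mathcal D$ is well defined, and $-\mathcal D^2\colon\mathrm D(\mathcal D^2)\to H$ is a (densely defined) self-adjoint operator. Its spectrum is $$\sigma(-\mathcal D^2)=\overline{\left\{\left(\frac{2\pi k}{T(E,L)}\right)^2 : k\in\mathbb N_0,\ (E,L)\in\mathring\Omega_0^{EL}\right\}},$$ and it is purely essential: $\sigma_{ess}(-\mathcal D^2)=\sigma(-\mathcal D^2)$. -/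

import Mathlib

open MeasureTheory Filter Topology Laplacian Matrix
open scoped ENNReal

noncomputable section

namespace VlasovPoisson

/-! ### Spectral notions for (unbounded) operators on a real Hilbert space -/

section Spectral

variable {H : Type*} [NormedAddCommGroup H] [NormedSpace ℝ H]

/-- `lam` belongs to the resolvent set of `A`: the map `A - lam : D(A) → H` is bijective and its
inverse is a bounded operator `R` on `H`. -/
def InResolventSet (A : H →ₗ.[ℝ] H) (lam : ℝ) : Prop :=
  ∃ R : H →L[ℝ] H,
    (∀ h : H, ∃ hR : R h ∈ A.domain, A ⟨R h, hR⟩ - lam • R h = h) ∧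
    (∀ g : A.domain, R (A g - lam • (g : H)) = g)

/-- The spectrum of an operator on a real Hilbert space. -/
def spectrumSet (A : H →ₗ.[ℝ] H) : Set ℝ := {lam | ¬ InResolventSet A lam}

/-- The eigenspace `ker (A - lam)`. -/
def eigenspace (A : H →ₗ.[ℝ] H) (lam : ℝ) : Submodule ℝ A.domain :=
  LinearMap.ker (A.toFun - lam • A.domain.subtype)

/-- The discrete spectrum: isolated points of the spectrum that are eigenvalues of finite
multiplicity. -/
def discreteSpectrum (A : H →ₗ.[ℝ] H) : Set ℝ :=
  {lam | lam ∈ spectrumSet A ∧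
    (∃ ε > 0, ∀ mu ∈ spectrumSet A, |mu - lam| < ε → mu = lam) ∧
    eigenspace A lam ≠ ⊥ ∧ FiniteDimensional ℝ (eigenspace A lam)}

/-- The essential spectrum: the part of the spectrum that is not discrete. -/
def essentialSpectrum (A : H →ₗ.[ℝ] H) : Set ℝ := spectrumSet A \ discreteSpectrum A

/-- The operator `-D²` with domain `{g ∈ D(D) | D g ∈ D(D)}`. -/
def negSq (D : H →ₗ.[ℝ] H) : H →ₗ.[ℝ] H where
  domain :=
    { carrier := {g | ∃ hg : g ∈ D.domain, D ⟨g, hg⟩ ∈ D.domain}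
      zero_mem' := ⟨D.domain.zero_mem, by
        have h : (⟨0, D.domain.zero_mem⟩ : D.domain) = 0 := rfl
        rw [h, D.map_zero]; exact D.domain.zero_mem⟩
      add_mem' := by
        rintro a b ⟨ha, ha'⟩ ⟨hb, hb'⟩
        refine ⟨D.domain.add_mem ha hb, ?_⟩
        have h : (⟨a + b, D.domain.add_mem ha hb⟩ : D.domain) = ⟨a, ha⟩ + ⟨b, hb⟩ := rfl
        rw [h, D.map_add]; exact D.domain.add_mem ha' hb'
      smul_mem' := by
        rintro c a ⟨ha, ha'⟩
        refine ⟨D.domain.smul_mem c ha, ?_⟩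
        have h : (⟨c • a, D.domain.smul_mem c ha⟩ : D.domain) = c • ⟨a, ha⟩ := rfl
        rw [h, D.map_smul]; exact D.domain.smul_mem c ha' }
  toFun :=
    { toFun := fun g => - D ⟨D ⟨g.1, g.2.1⟩, g.2.2⟩
      map_add' := by
        rintro ⟨a, ha, ha'⟩ ⟨b, hb, hb'⟩
        rw [← neg_add, ← D.map_add]
        congr 2
        exact Subtype.ext (D.map_add ⟨a, ha⟩ ⟨b, hb⟩)
      map_smul' := by
        rintro c ⟨a, ha, ha'⟩
        rw [RingHom.id_apply, smul_neg, ← D.map_smul]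
        congr 2
        exact Subtype.ext (D.map_smul c ⟨a, ha⟩) }

end Spectral

/-! ### Phase space and steady states -/

/-- Physical space `ℝ³`. -/
abbrev Space : Type := EuclideanSpace ℝ (Fin 3)

/-- Phase space, points `(x, v)`. -/
abbrev Phase : Type := Space × Space

/-- `L(x, v) = |x × v|²`. -/
def angMom (p : Phase) : ℝ := (p.1.ofLp ⨯₃ p.2.ofLp) ⬝ᵥ (p.1.ofLp ⨯₃ p.2.ofLp)

/-- `E(x, v) = |v|² / 2 + U(x)`. -/
def energy (U : Space → ℝ) (p : Phase) : ℝ := ‖p.2‖ ^ 2 / 2 + U p.1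

/-- The convention `t₊ᵏ = tᵏ` for `t > 0` and `t₊ᵏ = 0` for `t ≤ 0`. -/
def posPow (t k : ℝ) : ℝ := if 0 < t then t ^ k else 0

/-- The admissible microscopic equations of state `φ(E, L)`: polytropes with a vacuum region
(`L₀ > 0`), isotropic polytropes (`L₀ = l = 0`, where `(L - L₀)₊ˡ` is read as `1`), and King
models. -/
inductive IsAnsatz : (ℝ → ℝ → ℝ) → Prop
  | polytropeShell (E₀ L₀ k l : ℝ) (hE₀ : E₀ < 0) (hL₀ : 0 < L₀) (hk : 0 < k) (hl : -1 < l)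
      (hkl : k < l + 7 / 2) (hkl' : 0 ≤ k + l + 1 / 2) :
      IsAnsatz fun E L => posPow (E₀ - E) k * posPow (L - L₀) l
  | polytropeIsotropic (E₀ k : ℝ) (hE₀ : E₀ < 0) (hk : 0 < k) (hk' : k < 7 / 2) :
      IsAnsatz fun E _ => posPow (E₀ - E) k
  | king (E₀ : ℝ) (hE₀ : E₀ < 0) :
      IsAnsatz fun E _ => max (Real.exp (E₀ - E) - 1) 0

/-- A (non-vacuum) spherically symmetric steady state of the Vlasov-Poisson system: the phase-space
density is `φ(E, L)`, and `U` is its gravitational potential. -/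
structure RadialSteadyState where
  /-- the microscopic equation of state -/
  φ : ℝ → ℝ → ℝ
  /-- the stationary potential -/
  U : Space → ℝ
  ansatz : IsAnsatz φ
  contDiff_U : ContDiff ℝ 2 U
  radial_U : ∀ x y : Space, ‖x‖ = ‖y‖ → U x = U y
  poisson : ∀ x : Space, Δ U x = 4 * Real.pi * ∫ v : Space, φ (energy U (x, v)) (angMom (x, v))
  tendsto_U : Tendsto U (cocompact Space) (𝓝 0)
  nonvacuum : ∃ p : Phase, 0 < φ (energy U p) (angMom p)

/-- Spherical symmetry of a function on phase space: invariance under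
`(x, v) ↦ (A x, A v)` for all `A ∈ SO(3)`. -/
def SphericallySymmetric (f : Phase → ℝ) : Prop :=
  ∀ A : Space ≃ₗᵢ[ℝ] Space, LinearMap.det (A.toLinearEquiv : Space →ₗ[ℝ] Space) = 1 →
    ∀ x v : Space, f (A x, A v) = f (x, v)

/-- The transport operator `𝓓 ξ = v · ∇ₓ ξ - ∇U · ∇ᵥ ξ` on smooth functions. -/
def smoothTransport (U : Space → ℝ) (ξ : Phase → ℝ) (p : Phase) : ℝ :=
  fderiv ℝ (fun x => ξ (x, p.2)) p.1 p.2 - fderiv ℝ (fun v => ξ (p.1, v)) p.2 (gradient U p.1)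

/-- The elements of `L²(ν)` which agree almost everywhere with a spherically symmetric function. -/
def radialLp (ν : Measure Phase) : Submodule ℝ (Lp ℝ 2 ν) where
  carrier := {g | ∃ g' : Phase → ℝ, Measurable g' ∧ SphericallySymmetric g' ∧ g =ᵐ[ν] g'}
  zero_mem' := ⟨0, measurable_zero, fun _ _ _ _ => rfl, Lp.coeFn_zero ℝ 2 ν⟩
  add_mem' := by
    rintro f g ⟨f', hf, hfs, hff⟩ ⟨g', hg, hgs, hgg⟩
    refine ⟨f' + g', hf.add hg, fun A hA x v => ?_, (Lp.coeFn_add f g).trans (hff.add hgg)⟩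
    simp only [Pi.add_apply, hfs A hA x v, hgs A hA x v]
  smul_mem' := by
    rintro c f ⟨f', hf, hfs, hff⟩
    refine ⟨c • f', hf.const_smul c, fun A hA x v => ?_,
      (Lp.coeFn_smul c f).trans (hff.const_smul c)⟩
    simp only [Pi.smul_apply, hfs A hA x v]

/-- The σ-algebra of rotation invariant Borel sets (used only to show that `radialLp` is closed). -/
@[reducible] def invariantSigma : MeasurableSpace Phase where
  MeasurableSet' s := MeasurableSet s ∧
    ∀ A : Space ≃ₗᵢ[ℝ] Space, LinearMap.det (A.toLinearEquiv : Space →ₗ[ℝ] Space) = 1 →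
      ∀ x v : Space, (A x, A v) ∈ s ↔ (x, v) ∈ s
  measurableSet_empty := ⟨MeasurableSet.empty, fun _ _ _ _ => Iff.rfl⟩
  measurableSet_compl s hs := ⟨hs.1.compl, fun A hA x v => not_congr (hs.2 A hA x v)⟩
  measurableSet_iUnion f hf := ⟨MeasurableSet.iUnion fun i => (hf i).1, fun A hA x v => by
    simp only [Set.mem_iUnion]
    exact exists_congr fun i => (hf i).2 A hA x v⟩

theorem isClosed_radialLp (ν : Measure Phase) : IsClosed (radialLp ν : Set (Lp ℝ 2 ν)) := by
  have hm : invariantSigma ≤ (inferInstance : MeasurableSpace Phase) := fun s hs => hs.1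
  have key : (radialLp ν : Set (Lp ℝ 2 ν)) =
      {f : Lp ℝ 2 ν | AEStronglyMeasurable[invariantSigma] f ν} := by
    ext f
    constructor
    · rintro ⟨f', hf, hfs, hff⟩
      refine ⟨f', ?_, hff⟩
      have : Measurable[invariantSigma] f' := fun s hs =>
        ⟨hf hs, fun A hA x v => by simp only [Set.mem_preimage, hfs A hA x v]⟩
      exact this.stronglyMeasurable
    · rintro ⟨f', hf, hff⟩
      refine ⟨f', hf.measurable.mono hm le_rfl, fun A hA x v => ?_, hff⟩
      have h := (hf.measurable (measurableSet_singleton (f' (x, v)))).2 A hA x v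
      simpa using h
  rw [key]
  exact isClosed_aestronglyMeasurable hm

instance (ν : Measure Phase) : CompleteSpace (radialLp ν) :=
  (isClosed_radialLp ν).completeSpace_coe

namespace RadialSteadyState

variable (S : RadialSteadyState)

/-- The stationary phase-space density `f₀`. -/
def f₀ (p : Phase) : ℝ := S.φ (energy S.U p) (angMom p)

/-- `Ω₀ = {f₀ > 0}`. -/
def Ω₀ : Set Phase := {p | 0 < S.f₀ p}

/-- The set `Ω₀` in `(E, L)`-coordinates. -/
def ΩEL : Set (ℝ × ℝ) := (fun p => (energy S.U p, angMom p)) '' S.Ω₀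

/-- `φ'(E, L) = ∂_E φ(E, L)`. -/
def φ' (E L : ℝ) : ℝ := deriv (fun e => S.φ e L) E

/-- The weighted measure `|φ'(E, L)|⁻¹ d(x, v)` on `Ω₀`. -/
def ν : Measure Phase :=
  (volume.restrict S.Ω₀).withDensity
    fun p => ENNReal.ofReal (1 / |S.φ' (energy S.U p) (angMom p)|)

/-- The Hilbert space of spherically symmetric functions in the weighted `L²`-space on `Ω₀`. -/
abbrev H : Type := radialLp S.ν

/-- Test functions: spherically symmetric `C¹` functions with compact support in `Ω₀`. -/
def IsTest (ξ : Phase → ℝ) : Prop :=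
  ContDiff ℝ 1 ξ ∧ HasCompactSupport ξ ∧ tsupport ξ ⊆ S.Ω₀ ∧ SphericallySymmetric ξ

/-- The graph of the weakly defined transport operator: all pairs `(g, μ)` in `H × H` such that
`𝓓 g = μ` weakly. -/
def weakTransportGraph : Submodule ℝ (S.H × S.H) where
  carrier := {q | ∀ ξ : Phase → ℝ, S.IsTest ξ →
    Integrable (fun p => (q.1 : Lp ℝ 2 S.ν) p * smoothTransport S.U ξ p) S.ν ∧
    Integrable (fun p => (q.2 : Lp ℝ 2 S.ν) p * ξ p) S.ν ∧
    ∫ p, (q.1 : Lp ℝ 2 S.ν) p * smoothTransport S.U ξ p ∂S.ν =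
      -∫ p, (q.2 : Lp ℝ 2 S.ν) p * ξ p ∂S.ν}
  zero_mem' := by
    intro ξ _
    have h0 : ∀ η : Phase → ℝ, (fun p => ((0 : S.H) : Lp ℝ 2 S.ν) p * η p) =ᵐ[S.ν] 0 := by
      intro η
      filter_upwards [Lp.coeFn_zero ℝ 2 S.ν] with p hp
      rw [ZeroMemClass.coe_zero, hp]; simp
    refine ⟨(integrable_zero _ _ _).congr (h0 _).symm, (integrable_zero _ _ _).congr (h0 _).symm, ?_⟩
    rw [Prod.fst_zero, Prod.snd_zero, integral_congr_ae (h0 _), integral_congr_ae (h0 _)]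
    simp
  add_mem' := by
    rintro ⟨a, b⟩ ⟨c, d⟩ h₁ h₂ ξ hξ
    have hadd : ∀ (f g : S.H) (η : Phase → ℝ),
        (fun p => ((f + g : S.H) : Lp ℝ 2 S.ν) p * η p) =ᵐ[S.ν]
          fun p => (f : Lp ℝ 2 S.ν) p * η p + (g : Lp ℝ 2 S.ν) p * η p := by
      intro f g η
      filter_upwards [Lp.coeFn_add (f : Lp ℝ 2 S.ν) (g : Lp ℝ 2 S.ν)] with p hp
      rw [Submodule.coe_add, hp, Pi.add_apply, add_mul]
    obtain ⟨i₁, j₁, e₁⟩ := h₁ ξ hξ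
    obtain ⟨i₂, j₂, e₂⟩ := h₂ ξ hξ
    refine ⟨(i₁.add i₂).congr (hadd _ _ _).symm, (j₁.add j₂).congr (hadd _ _ _).symm, ?_⟩
    rw [Prod.fst_add, Prod.snd_add, integral_congr_ae (hadd _ _ _),
      integral_congr_ae (hadd _ _ _), integral_add i₁ i₂, integral_add j₁ j₂, e₁, e₂]
    ring
  smul_mem' := by
    rintro c ⟨a, b⟩ h ξ hξ
    have hsmul : ∀ (f : S.H) (η : Phase → ℝ),
        (fun p => ((c • f : S.H) : Lp ℝ 2 S.ν) p * η p) =ᵐ[S.ν]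
          fun p => c * ((f : Lp ℝ 2 S.ν) p * η p) := by
      intro f η
      filter_upwards [Lp.coeFn_smul c (f : Lp ℝ 2 S.ν)] with p hp
      rw [Submodule.coe_smul, hp, Pi.smul_apply, smul_eq_mul, mul_assoc]
    obtain ⟨i, j, e⟩ := h ξ hξ
    refine ⟨(i.const_mul c).congr (hsmul _ _).symm, (j.const_mul c).congr (hsmul _ _).symm, ?_⟩
    rw [Prod.smul_fst, Prod.smul_snd, integral_congr_ae (hsmul _ _),
      integral_congr_ae (hsmul _ _), integral_const_mul, integral_const_mul, e]
    ring

/-- The transport operator `𝓓 : D(𝓓) → H`, where `D(𝓓)` consists of all `g ∈ H` for which `𝓓 g`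
exists weakly and belongs to `H`. -/
def transport : S.H →ₗ.[ℝ] S.H := S.weakTransportGraph.toLinearPMap

/-- The operator `-𝓓²` with domain `{g ∈ D(𝓓) | 𝓓 g ∈ D(𝓓)}`. -/
def negTransportSq : S.H →ₗ.[ℝ] S.H := negSq S.transport

/-- The effective potential `Ψ_L(r) = U(r) + L / (2 r²)`, `r > 0`. -/
def Ψ (L r : ℝ) : ℝ := S.U (EuclideanSpace.single 0 r) + L / (2 * r ^ 2)

/-- The smaller one of the two radii `r > 0` with `Ψ_L(r) = E`. -/
def rMinus (E L : ℝ) : ℝ := sInf {r | 0 < r ∧ S.Ψ L r = E}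

/-- The larger one of the two radii `r > 0` with `Ψ_L(r) = E`. -/
def rPlus (E L : ℝ) : ℝ := sSup {r | 0 < r ∧ S.Ψ L r = E}

/-- The period function `T(E, L)` of the radial motion. -/
def T (E L : ℝ) : ℝ :=
  2 * ∫ r in S.rMinus E L..S.rPlus E L, 1 / Real.sqrt (2 * E - 2 * S.Ψ L r)

end RadialSteadyState

end VlasovPoisson

end

open MeasureTheory Filter Topology Laplacian Matrix
open scoped ENNReal

noncomputable section

namespace VlasovPoisson

/-! ### Unbounded operators -/

section Operators

variable {H : Type*} [NormedAddCommGroup H] [InnerProductSpace ℝ H]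

/-! The flow behind `𝓓` preserves E and L, and modulo rotations a phase-space point is given by (E,
L), its radius and the sign of its radial velocity. So, up to null sets, `H` consists of functions
on a family of closed curves: over each (E, L) in the open set `orbitSet`, which equals the interior
of `ΩEL`, lies one radial orbit of period T(E, L), traversed once outwards and once inwards. In the
time variable along the orbit `𝓓` is d/dt. Expanding in the real Fourier basis `trigBasis` (cosines
for k > 0, sines for k < 0) gives a unitary map `fourier` from `H` onto a direct sum over k ∈ ℤ of
copies of L²(`energyMeasure`). There `𝓓` becomes g ↦ (ω_k g_{-k})_k with ω_k = 2πk/T, because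
differentiation exchanges sines and cosines, and -𝓓² becomes multiplication by ω_k² in slot k
(`IsSkewShift`).

Everything claimed can be read off from this form. Multiplication by 1/(1 + ω_k²) inverts -𝓓² + 1,
which gives self-adjointness. T is continuous and `energyMeasure` charges every nonempty open subset
of `orbitSet`, so the spectrum is the closure of the set of values ω_k². Multiplication by arctan E
commutes with -𝓓² and has null level sets, so no nonzero eigenspace is finite dimensional and the
discrete spectrum is empty.

Three things need work. The orbits: `monotoneOn_mass` makes the effective potential a single well,
and the nondegeneracy estimate `exists_lower_bound` at the turning points gives finiteness and
continuity of T. The measure: `lintegral_ν` turns the weighted phase-space measure into weight · dE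
dL dr / w, with w the radial speed, on the two branches. The operator: the weak definition of `𝓓`
must agree with the Fourier description (`isSkewShift_weakTransportGraph`). One inclusion is
integration by parts along orbits for test functions (`fourierGraph_le`). For the other
(`weakTransportGraph_le`) the weak equation is tested with χ(E, L) times |x|ⁿ or (x·v/|x|)|x|ⁿ; this
localizes it to almost every orbit, where Weierstrass approximation and limits at the turning points
recover the sines and cosines (`orbitCoeff_of_tests`). -/

theorem mem_negSq_graph {D : H →ₗ.[ℝ] H} {g h : H} :
    (g, h) ∈ (negSq D).graph ↔ ∃ m, (g, m) ∈ D.graph ∧ (m, -h) ∈ D.graph := by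
  constructor
  · intro hg
    obtain ⟨x, hx, hx'⟩ := (LinearPMap.mem_graph_iff _).1 hg
    obtain ⟨x, hx₁, hx₂⟩ := x
    simp only at hx hx'
    subst hx
    refine ⟨D ⟨x, hx₁⟩, D.mem_graph ⟨x, hx₁⟩, ?_⟩
    have : -h = D ⟨D ⟨x, hx₁⟩, hx₂⟩ := by
      rw [← hx']
      exact neg_neg _
    rw [this]
    exact D.mem_graph ⟨_, hx₂⟩
  · rintro ⟨m, hm, hh⟩
    obtain ⟨x, hx, hx'⟩ := (LinearPMap.mem_graph_iff _).1 hm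
    obtain ⟨y, hy, hy'⟩ := (LinearPMap.mem_graph_iff _).1 hh
    obtain ⟨x, hxD⟩ := x
    obtain ⟨y, hyD⟩ := y
    simp only at hx hx' hy hy'
    subst hx hy
    subst hx'
    have hmem : x ∈ (negSq D).domain := ⟨hxD, hyD⟩
    refine (LinearPMap.mem_graph_iff _).2 ⟨⟨x, hmem⟩, rfl, ?_⟩
    change -(D ⟨D ⟨x, hxD⟩, hyD⟩) = h
    rw [hy', neg_neg]

theorem inResolventSet_of_graph {A : H →ₗ.[ℝ] H} {lam : ℝ} (R : H →L[ℝ] H)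
    (h₁ : ∀ h, (R h, h + lam • R h) ∈ A.graph)
    (h₂ : ∀ g h, (g, h) ∈ A.graph → R (h - lam • g) = g) : InResolventSet A lam := by
  refine ⟨R, fun h => ?_, fun g => h₂ _ _ (A.mem_graph g)⟩
  obtain ⟨x, hx, hx'⟩ := (LinearPMap.mem_graph_iff _).1 (h₁ h)
  simp only at hx hx'
  have hR : R h ∈ A.domain := hx ▸ x.2
  have : (⟨R h, hR⟩ : A.domain) = x := Subtype.ext hx.symm
  refine ⟨hR, ?_⟩
  rw [this, hx']
  abel

/-- Approximate eigenvectors exclude a bounded inverse: R(A - lam)g = g would force ‖g‖ ≤ ‖R‖ ε ‖g‖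
for every ε. -/
theorem not_inResolventSet_of_graph {A : H →ₗ.[ℝ] H} {lam : ℝ}
    (hA : ∀ ε > 0, ∃ g h, (g, h) ∈ A.graph ∧ g ≠ 0 ∧ ‖h - lam • g‖ ≤ ε * ‖g‖) :
    ¬ InResolventSet A lam := by
  rintro ⟨R, -, hR⟩
  have hpos : 0 < ‖R‖ + 1 := by positivity
  -- The added 1 covers the case ‖R‖ = 0 and makes the final inequality strict.
  obtain ⟨g, h, hgh, hg, hle⟩ := hA (1 / (‖R‖ + 1)) (by positivity)
  obtain ⟨x, hx, hx'⟩ := (LinearPMap.mem_graph_iff _).1 hgh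
  simp only at hx hx'
  have hRg := hR x
  rw [hx, hx'] at hRg
  have hgpos : 0 < ‖g‖ := norm_pos_iff.2 hg
  have h1 : ‖g‖ ≤ ‖R‖ * (1 / (‖R‖ + 1) * ‖g‖) := by
    calc ‖g‖ = ‖R (h - lam • g)‖ := by rw [hRg]
      _ ≤ ‖R‖ * ‖h - lam • g‖ := R.le_opNorm _
      _ ≤ _ := by gcongr
  have h2 : ‖R‖ * (1 / (‖R‖ + 1) * ‖g‖) < ‖g‖ := by
    have : ‖R‖ * (1 / (‖R‖ + 1) * ‖g‖) = ‖R‖ / (‖R‖ + 1) * ‖g‖ := by ring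
    rw [this]
    have : ‖R‖ / (‖R‖ + 1) < 1 := by
      rw [div_lt_one hpos]
      linarith
    nlinarith
  linarith

open scoped InnerProductSpace in
-- The range criterion at the real point -1: for a symmetric operator, surjectivity of A + 1 already
-- yields both density of the domain and the absence of any proper adjoint extension.
theorem isSelfAdjoint_of_symmetric_of_surjective [CompleteSpace H] {A : H →ₗ.[ℝ] H}
    (hsymm : ∀ g h g' h', (g, h) ∈ A.graph → (g', h') ∈ A.graph → ⟪h, g'⟫_ℝ = ⟪g, h'⟫_ℝ)
    (hsurj : ∀ f, ∃ g h, (g, h) ∈ A.graph ∧ h + g = f) : IsSelfAdjoint A := by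
  have hs : ∀ x y : A.domain, ⟪A x, (y : H)⟫_ℝ = ⟪(x : H), A y⟫_ℝ := fun x y =>
    hsymm _ _ _ _ (A.mem_graph x) (A.mem_graph y)
  have hsurj' : ∀ f, ∃ x : A.domain, A x + x = f := by
    intro f
    obtain ⟨g, h, hgh, hf⟩ := hsurj f
    obtain ⟨x, hx, hx'⟩ := (LinearPMap.mem_graph_iff _).1 hgh
    simp only at hx hx'
    exact ⟨x, by rw [hx, hx', hf]⟩
  have key : ∀ x y : A.domain, ⟪A x + x, (y : H)⟫_ℝ = ⟪(x : H), A y + y⟫_ℝ := fun x y => by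
    rw [inner_add_left, inner_add_right, hs]
  have hdense : Dense (A.domain : Set H) := by
    rw [Submodule.dense_iff_topologicalClosure_eq_top, Submodule.topologicalClosure_eq_top_iff,
      Submodule.eq_bot_iff]
    intro z hz
    -- For z orthogonal to the domain write z = (A + 1)x and x = (A + 1)y; then ‖x‖² = ⟪z, y⟫ = 0.
    obtain ⟨x, rfl⟩ := hsurj' z
    obtain ⟨y, hy⟩ := hsurj' (x : H)
    have h0 := (Submodule.mem_orthogonal' _ _).1 hz y y.2
    rw [key, hy, inner_self_eq_zero] at h0
    have : x = 0 := Subtype.ext h0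
    rw [this, A.map_zero]
    simp
  rw [LinearPMap.isSelfAdjoint_def]
  have hle : A ≤ A.adjoint := LinearPMap.IsFormalAdjoint.le_adjoint hdense hs
  refine le_antisymm ?_ hle
  refine LinearPMap.le_of_le_graph ?_
  rintro ⟨y, w⟩ hyw
  obtain ⟨y', hy', hw'⟩ := (LinearPMap.mem_graph_iff _).1 hyw
  simp only at hy' hw'
  -- For y in the domain of the adjoint, with A* y = w, solve (A + 1)x = A* y + y inside the domain
  -- of A. Then y - x is orthogonal to the range of A + 1, which is everything, so y = x.
  obtain ⟨x, hx⟩ := hsurj' (w + y)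
  have hadj := LinearPMap.adjoint_isFormalAdjoint hdense y'
  have hxy : y = x := by
    obtain ⟨z, hz⟩ := hsurj' (y - x)
    have h1 : ⟪w + y, (z : H)⟫_ℝ = ⟪y, A z + z⟫_ℝ := by
      rw [inner_add_left, inner_add_right, ← hw', ← hy', hadj z]
    rw [← hx, key, hz] at h1
    have : ⟪y - x, y - x⟫_ℝ = 0 := by rw [inner_sub_left, h1, sub_self]
    exact sub_eq_zero.1 (inner_self_eq_zero.1 this)
  subst hxy
  have : A x = w := by
    have := hx
    simpa using this
  rw [← this]
  exact A.mem_graph x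

end Operators

/-! ### Weighted shifts on a direct sum of `L²`-spaces -/

section DirectSum

variable {Y : Type*} [MeasurableSpace Y] {κ : Measure Y}

theorem memLp_mul_of_bounded {b : Y → ℝ} (hb : Measurable b) {B : ℝ} (hB : ∀ y, |b y| ≤ B)
    (f : Lp ℝ 2 κ) : MemLp (fun y => b y * f y) 2 κ :=
  (Lp.memLp f).of_le_mul (c := B) (hb.aestronglyMeasurable.mul (Lp.aestronglyMeasurable f))
    (Eventually.of_forall fun y => (norm_mul (b y) (f y)).trans_le
      (mul_le_mul_of_nonneg_right (hB y) (norm_nonneg _)))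

/-- Multiplication of an `L²`-function by a bounded measurable function. -/
def mulLp (κ : Measure Y) (b : Y → ℝ) (hb : Measurable b) (B : ℝ) (hB : ∀ y, |b y| ≤ B) :
    Lp ℝ 2 κ →ₗ[ℝ] Lp ℝ 2 κ where
  toFun f := (memLp_mul_of_bounded hb hB f).toLp _
  map_add' f g := by
    rw [← MemLp.toLp_add]
    refine MemLp.toLp_congr _ _ ?_
    filter_upwards [Lp.coeFn_add f g] with y h
    rw [h, Pi.add_apply, Pi.add_apply, mul_add]
  map_smul' c f := by
    rw [RingHom.id_apply, ← MemLp.toLp_const_smul]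
    refine MemLp.toLp_congr _ _ ?_
    filter_upwards [Lp.coeFn_smul c f] with y h
    rw [h, Pi.smul_apply, Pi.smul_apply, smul_eq_mul, smul_eq_mul]
    ring

theorem mulLp_apply (b : Y → ℝ) (hb : Measurable b) (B : ℝ) (hB : ∀ y, |b y| ≤ B)
    (f : Lp ℝ 2 κ) : mulLp κ b hb B hB f =ᵐ[κ] fun y => b y * f y :=
  MemLp.coeFn_toLp (memLp_mul_of_bounded hb hB f)

theorem norm_mulLp_le (b : Y → ℝ) (hb : Measurable b) (B : ℝ) (hB : ∀ y, |b y| ≤ B)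
    (f : Lp ℝ 2 κ) : ‖mulLp κ b hb B hB f‖ ≤ B * ‖f‖ := by
  refine Lp.norm_le_mul_norm_of_ae_le_mul ?_
  filter_upwards [mulLp_apply b hb B hB f] with y hy
  rw [hy, norm_mul]
  exact mul_le_mul_of_nonneg_right (hB y) (norm_nonneg _)

/-- The direct sum of copies of `L²(κ)` indexed by the integers. -/
abbrev FourierSpace (κ : Measure Y) : Type _ := lp (fun _ : ℤ => Lp ℝ 2 κ) 2

theorem memℓp_weightedShift (σ : Equiv.Perm ℤ) (b : ℤ → Y → ℝ) (hb : ∀ k, Measurable (b k)) (B : ℝ)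
    (hB : ∀ k y, |b k y| ≤ B) (f : FourierSpace κ) :
    Memℓp (fun k => mulLp κ (b k) (hb k) B (hB k) (f (σ k))) 2 := by
  have h2 : 0 < (2 : ℝ≥0∞).toReal := by norm_num
  refine memℓp_gen ?_
  have hs : Summable fun k => (B * ‖f (σ k)‖) ^ (2 : ℝ≥0∞).toReal := by
    have := ((lp.memℓp f).summable h2)
    have := ((σ.summable_iff).2 this).mul_left (B ^ 2)
    refine this.congr fun k => ?_
    simp [mul_pow]
  refine hs.of_nonneg_of_le (fun k => by positivity) fun k => ?_
  gcongr
  exact norm_mulLp_le _ _ _ _ _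

/-- The operator `f ↦ (b k * f (σ k))ₖ`. -/
def weightedShift (σ : Equiv.Perm ℤ) (b : ℤ → Y → ℝ) (hb : ∀ k, Measurable (b k)) (B : ℝ)
    (hB : ∀ k y, |b k y| ≤ B) : FourierSpace κ →L[ℝ] FourierSpace κ :=
  LinearMap.mkContinuous
    { toFun := fun f => ⟨_, memℓp_weightedShift σ b hb B hB f⟩
      map_add' := fun f g => by
        ext1
        funext k
        change mulLp κ (b k) (hb k) B (hB k) ((f + g) (σ k)) = mulLp κ (b k) (hb k) B (hB k) (f (σ k)) + mulLp κ (b k) (hb k) B (hB k) (g (σ k))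
        rw [lp.coeFn_add, Pi.add_apply, map_add]
      map_smul' := fun c f => by
        ext1
        funext k
        change mulLp κ (b k) (hb k) B (hB k) ((c • f) (σ k)) = c • mulLp κ (b k) (hb k) B (hB k) (f (σ k))
        rw [lp.coeFn_smul, Pi.smul_apply, map_smul] }
    |B| (fun f => by
      have h2 : 0 < (2 : ℝ≥0∞).toReal := by norm_num
      refine lp.norm_le_of_tsum_le h2 (by positivity) ?_
      have hs : Summable fun k => ‖f k‖ ^ (2 : ℝ≥0∞).toReal := (lp.memℓp f).summable h2
      have hs' := ((σ.summable_iff).2 hs)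
      calc ∑' k, ‖mulLp κ (b k) (hb k) B (hB k) (f (σ k))‖ ^ (2 : ℝ≥0∞).toReal
          ≤ ∑' k, |B| ^ (2 : ℝ≥0∞).toReal * ‖f (σ k)‖ ^ (2 : ℝ≥0∞).toReal := by
            refine Summable.tsum_le_tsum (fun k => ?_)
              ((memℓp_weightedShift σ b hb B hB f).summable h2) (hs'.mul_left _)
            rw [← Real.mul_rpow (by positivity) (by positivity)]
            gcongr
            exact (norm_mulLp_le _ _ _ _ _).trans (by gcongr; exact le_abs_self B)
        _ = (|B| * ‖f‖) ^ (2 : ℝ≥0∞).toReal := by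
            rw [tsum_mul_left, σ.tsum_eq (fun k => ‖f k‖ ^ (2 : ℝ≥0∞).toReal),
              ← lp.norm_rpow_eq_tsum h2, Real.mul_rpow (by positivity) (by positivity)])

theorem weightedShift_apply (σ : Equiv.Perm ℤ) (b : ℤ → Y → ℝ) (hb : ∀ k, Measurable (b k)) (B : ℝ)
    (hB : ∀ k y, |b k y| ≤ B) (f : FourierSpace κ) (k : ℤ) :
    weightedShift σ b hb B hB f k =ᵐ[κ] fun y => b k y * f (σ k) y :=
  mulLp_apply _ _ _ _ _

end DirectSum

/-! ### Operators that are weighted shifts in suitable coordinates -/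

section WeightedShiftOperator

variable {Y : Type*} [MeasurableSpace Y] {κ : Measure Y}
variable {H : Type*} [NormedAddCommGroup H] [InnerProductSpace ℝ H]

/-- In the coordinates `V`, the relation `Γ` is the graph of the antisymmetric operator
`f ↦ (ω k * f (-k))ₖ`. -/
structure IsSkewShift (Γ : Submodule ℝ (H × H)) (V : H ≃ₗᵢ[ℝ] FourierSpace κ) (ω : ℤ → Y → ℝ) :
    Prop where
  measurable : ∀ k, Measurable (ω k)
  odd : ∀ k y, ω (-k) y = -ω k y
  mem_iff : ∀ g m, (g, m) ∈ Γ ↔ ∀ k, V m k =ᵐ[κ] fun y => ω k y * V g (-k) y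

namespace IsSkewShift

variable {Γ : Submodule ℝ (H × H)} {V : H ≃ₗᵢ[ℝ] FourierSpace κ} {ω : ℤ → Y → ℝ}

theorem eq_of_coe {f g : H} (h : ∀ k, V f k =ᵐ[κ] V g k) : f = g := by
  apply V.injective
  ext1
  funext k
  exact Lp.ext (h k)

theorem graph_eq (h : IsSkewShift Γ V ω) : Γ.toLinearPMap.graph = Γ := by
  refine Submodule.toLinearPMap_graph_eq _ ?_
  rintro ⟨g, m⟩ hgm (rfl : g = 0)
  refine eq_of_coe (V := V) fun k => ?_
  filter_upwards [(h.mem_iff _ _).1 hgm k, Lp.coeFn_zero ℝ 2 κ] with y hy h0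
  rw [hy]
  simp only [map_zero, lp.coeFn_zero, Pi.zero_apply, h0, mul_zero]

theorem sq_neg (h : IsSkewShift Γ V ω) (k : ℤ) (y : Y) : ω (-k) y ^ 2 = ω k y ^ 2 := by
  rw [h.odd, _root_.neg_sq]

/-- The two reflections k ↦ -k cancel, and oddness of ω gives ω_k ω_{-k} = -ω_k². -/
theorem negSq_mem_iff (h : IsSkewShift Γ V ω) (g f : H) :
    (g, f) ∈ (negSq Γ.toLinearPMap).graph ↔
      ∀ k, V f k =ᵐ[κ] fun y => ω k y ^ 2 * V g k y := by
  rw [mem_negSq_graph, h.graph_eq]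
  constructor
  · rintro ⟨m, h₁, h₂⟩ k
    have hk := (h.mem_iff _ _).1 h₁ (-k)
    have hk' := (h.mem_iff _ _).1 h₂ k
    rw [neg_neg] at hk
    filter_upwards [hk, hk', Lp.coeFn_neg (V f k)] with y e₁ e₂ e₃
    rw [map_neg, lp.coeFn_neg, Pi.neg_apply, e₃, Pi.neg_apply, e₁, h.odd] at e₂
    linarith
  · intro hf
    -- The intermediate element must have components ω_k g_{-k}, which are not obviously square
    -- summable. Since f = ω² g, they equal ω/(1 + ω²) times the components of f + g, and this
    -- multiplier is bounded.
    have hb : ∀ k, Measurable fun y => ω k y / (1 + ω k y ^ 2) := fun k =>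
      (h.measurable k).div (measurable_const.add ((h.measurable k).pow_const 2))
    have hB : ∀ k y, |ω k y / (1 + ω k y ^ 2)| ≤ 1 := fun k y => by
      rw [abs_div, abs_of_pos (show 0 < 1 + ω k y ^ 2 by positivity), div_le_one (by positivity)]
      nlinarith [sq_abs (ω k y), sq_nonneg (|ω k y| - 1), abs_nonneg (ω k y)]
    have hVm : ∀ k, weightedShift (Equiv.neg ℤ) _ hb 1 hB (V (f + g)) k
        =ᵐ[κ] fun y => ω k y * V g (-k) y := by
      intro k
      filter_upwards [weightedShift_apply (Equiv.neg ℤ) _ hb 1 hB (V (f + g)) k,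
        Lp.coeFn_add (V f (-k)) (V g (-k)), hf (-k)] with y e₁ e₂ e₃
      rw [e₁, Equiv.neg_apply, map_add, lp.coeFn_add, Pi.add_apply, e₂, Pi.add_apply, e₃, h.sq_neg]
      have : 1 + ω k y ^ 2 ≠ 0 := by positivity
      field_simp
      ring
    refine ⟨V.symm (weightedShift (Equiv.neg ℤ) _ hb 1 hB (V (f + g))), ?_, ?_⟩
    · rw [h.mem_iff]
      intro k
      rw [V.apply_symm_apply]
      exact hVm k
    · rw [h.mem_iff]
      intro k
      rw [V.apply_symm_apply]
      have := hVm (-k)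
      rw [neg_neg] at this
      filter_upwards [this, hf k, Lp.coeFn_neg (V f k)] with y e₁ e₂ e₃
      rw [map_neg, lp.coeFn_neg, Pi.neg_apply, e₃, Pi.neg_apply, e₁, e₂, h.odd]
      ring

open scoped InnerProductSpace in
theorem inner_negSq_comm (h : IsSkewShift Γ V ω) {g f g' f' : H}
    (h₁ : (g, f) ∈ (negSq Γ.toLinearPMap).graph) (h₂ : (g', f') ∈ (negSq Γ.toLinearPMap).graph) :
    ⟪f, g'⟫_ℝ = ⟪g, f'⟫_ℝ := by
  rw [h.negSq_mem_iff] at h₁ h₂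
  rw [← V.inner_map_map, ← V.inner_map_map g, lp.inner_eq_tsum, lp.inner_eq_tsum]
  refine tsum_congr fun k => ?_
  rw [L2.inner_def, L2.inner_def]
  refine integral_congr_ae ?_
  filter_upwards [h₁ k, h₂ k] with y e₁ e₂
  simp only [e₁, e₂, RCLike.inner_apply, conj_trivial]
  ring

open scoped InnerProductSpace in
/-- The operator associated with `Γ` is antisymmetric. -/
theorem inner_comm_neg (h : IsSkewShift Γ V ω) {g m g' m' : H} (h₁ : (g, m) ∈ Γ)
    (h₂ : (g', m') ∈ Γ) : ⟪m, g'⟫_ℝ = -⟪g, m'⟫_ℝ := by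
  rw [h.mem_iff] at h₁ h₂
  rw [← V.inner_map_map, ← V.inner_map_map g, lp.inner_eq_tsum, lp.inner_eq_tsum, ← tsum_neg,
    ← (Equiv.neg ℤ).tsum_eq]
  refine tsum_congr fun k => ?_
  have := h₁ (-k)
  rw [neg_neg] at this
  rw [Equiv.neg_apply, L2.inner_def, L2.inner_def, ← integral_neg]
  refine integral_congr_ae ?_
  filter_upwards [this, h₂ k] with y e₁ e₂
  simp only [e₁, e₂, RCLike.inner_apply, conj_trivial, h.odd]
  ring

theorem isSelfAdjoint_negSq [CompleteSpace H] (h : IsSkewShift Γ V ω) :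
    IsSelfAdjoint (negSq Γ.toLinearPMap) := by
  refine isSelfAdjoint_of_symmetric_of_surjective (fun g f g' f' => h.inner_negSq_comm) fun f => ?_
  have hb : ∀ k, Measurable fun y => 1 / (1 + ω k y ^ 2) := fun k =>
    measurable_const.div (measurable_const.add ((h.measurable k).pow_const 2))
  have hB : ∀ k y, |1 / (1 + ω k y ^ 2)| ≤ 1 := fun k y => by
    rw [abs_of_pos (by positivity), div_le_one (by positivity)]
    nlinarith [sq_nonneg (ω k y)]
  set g := V.symm (weightedShift (Equiv.refl ℤ) _ hb 1 hB (V f)) with hg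
  refine ⟨g, f - g, ?_, by abel⟩
  rw [h.negSq_mem_iff]
  intro k
  filter_upwards [weightedShift_apply (Equiv.refl ℤ) _ hb 1 hB (V f) k,
    Lp.coeFn_sub (V f k) (V g k)] with y e₁ e₂
  rw [map_sub, lp.coeFn_sub, Pi.sub_apply, e₂, Pi.sub_apply, hg, V.apply_symm_apply, e₁,
    Equiv.refl_apply]
  have : 1 + ω k y ^ 2 ≠ 0 := by positivity
  field_simp
  ring

theorem inResolventSet (h : IsSkewShift Γ V ω) {lam d : ℝ} (hd : 0 < d)
    (hlam : ∀ k, ∀ᵐ y ∂κ, d ≤ |ω k y ^ 2 - lam|) :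
    InResolventSet (negSq Γ.toLinearPMap) lam := by
  classical
  -- The gap is only known almost everywhere, while `weightedShift` asks for a bound at every point;
  -- hence the value 0 on the exceptional set.
  have hb : ∀ k, Measurable fun y => if d ≤ |ω k y ^ 2 - lam| then 1 / (ω k y ^ 2 - lam) else 0 := by
    intro k
    have hm : Measurable fun y => ω k y ^ 2 - lam := ((h.measurable k).pow_const 2).sub_const lam
    exact Measurable.ite (measurableSet_le measurable_const hm.abs) (measurable_const.div hm)
      measurable_const
  have hB : ∀ k y, |if d ≤ |ω k y ^ 2 - lam| then 1 / (ω k y ^ 2 - lam) else 0| ≤ 1 / d := by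
    intro k y
    split_ifs with hy
    · rw [abs_div, abs_one]
      gcongr
    · rw [abs_zero]
      positivity
  have key : ∀ (f : H) (k : ℤ), V (V.symm (weightedShift (Equiv.refl ℤ) _ hb _ hB (V f))) k
      =ᵐ[κ] fun y => 1 / (ω k y ^ 2 - lam) * V f k y := by
    intro f k
    filter_upwards [weightedShift_apply (Equiv.refl ℤ) _ hb _ hB (V f) k, hlam k] with y e₁ e₂
    rw [V.apply_symm_apply, e₁, if_pos e₂, Equiv.refl_apply]
  have hne : ∀ {x : ℝ}, d ≤ |x| → x ≠ 0 := fun hx => abs_pos.1 (hd.trans_le hx)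
  refine inResolventSet_of_graph ((V.symm.toContinuousLinearEquiv : FourierSpace κ →L[ℝ] H).comp
    ((weightedShift (Equiv.refl ℤ) _ hb _ hB).comp
      (V.toContinuousLinearEquiv : H →L[ℝ] FourierSpace κ))) (fun f => ?_) fun g f hgf => ?_
  · change (V.symm (weightedShift (Equiv.refl ℤ) _ hb _ hB (V f)), f + lam •
      V.symm (weightedShift (Equiv.refl ℤ) _ hb _ hB (V f))) ∈ _
    set g := V.symm (weightedShift (Equiv.refl ℤ) _ hb _ hB (V f)) with hg
    rw [h.negSq_mem_iff]
    intro k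
    filter_upwards [key f k, hlam k, Lp.coeFn_add (V f k) ((lam • V g) k),
      Lp.coeFn_smul lam (V g k)] with y e₁ e₂ e₃ e₄
    have e₅ : (lam • V g) k = lam • V g k := by rw [lp.coeFn_smul, Pi.smul_apply]
    rw [map_add, map_smul, lp.coeFn_add, Pi.add_apply, e₃, Pi.add_apply, e₅, e₄, Pi.smul_apply, e₁,
      smul_eq_mul]
    have := hne e₂
    field_simp
    ring
  · change V.symm (weightedShift (Equiv.refl ℤ) _ hb _ hB (V (f - lam • g))) = g
    refine eq_of_coe (V := V) fun k => ?_
    rw [h.negSq_mem_iff] at hgf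
    filter_upwards [key (f - lam • g) k, hlam k, Lp.coeFn_sub (V f k) ((lam • V g) k),
      Lp.coeFn_smul lam (V g k), hgf k] with y e₁ e₂ e₃ e₄ e₆
    have e₅ : (lam • V g) k = lam • V g k := by rw [lp.coeFn_smul, Pi.smul_apply]
    rw [e₁, map_sub, map_smul, lp.coeFn_sub, Pi.sub_apply, e₃, Pi.sub_apply, e₅, e₄, Pi.smul_apply,
      e₆, smul_eq_mul]
    have := hne e₂
    field_simp

theorem not_inResolventSet [SigmaFinite κ] (h : IsSkewShift Γ V ω) {lam : ℝ}
    (hlam : ∀ ε > 0, ∃ k, 0 < κ {y | |ω k y ^ 2 - lam| < ε}) :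
    ¬ InResolventSet (negSq Γ.toLinearPMap) lam := by
  classical
  refine not_inResolventSet_of_graph fun ε hε => ?_
  obtain ⟨k, hk⟩ := hlam ε hε
  have hm : Measurable fun y => ω k y ^ 2 - lam := ((h.measurable k).pow_const 2).sub_const lam
  have hms : MeasurableSet {y | |ω k y ^ 2 - lam| < ε} := measurableSet_lt hm.abs measurable_const
  -- σ-finiteness provides a piece of finite positive measure, whose indicator placed in slot k is
  -- the approximate eigenvector.
  obtain ⟨t, ht, hts, ht0, htop⟩ := Measure.exists_subset_measure_lt_top hms hk
  -- ω_k² cut off outside the set where it is close to lam: a bounded multiplier with the same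
  -- effect on the indicator of t.
  set b : Y → ℝ := fun y => if |ω k y ^ 2 - lam| < ε then ω k y ^ 2 else 0 with hbdef
  have hb : Measurable b := Measurable.ite hms ((h.measurable k).pow_const 2) measurable_const
  have hB : ∀ y, |b y| ≤ |lam| + ε := by
    intro y
    simp only [hbdef]
    split_ifs with hy
    · have := abs_sub_abs_le_abs_sub (ω k y ^ 2) lam
      linarith
    · rw [abs_zero]
      positivity
  set c : Lp ℝ 2 κ := indicatorConstLp 2 ht htop.ne (1 : ℝ) with hc
  have hcy : ∀ᵐ y ∂κ, y ∉ t → c y = 0 := indicatorConstLp_coeFn_notMem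
  have hVs : ∀ a : Lp ℝ 2 κ, V (V.symm (lp.single 2 k a)) = lp.single 2 k a :=
    fun a => V.apply_symm_apply _
  refine ⟨V.symm (lp.single 2 k c), V.symm (lp.single 2 k (mulLp κ b hb _ hB c)), ?_, ?_, ?_⟩
  · rw [h.negSq_mem_iff]
    intro j
    rw [hVs, hVs]
    by_cases hj : j = k
    · subst hj
      rw [lp.single_apply_self, lp.single_apply_self]
      filter_upwards [mulLp_apply b hb _ hB c, hcy] with y e₁ e₂
      rw [e₁]
      by_cases hy : y ∈ t
      · have : |ω j y ^ 2 - lam| < ε := hts hy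
        simp only [hbdef, if_pos this]
      · rw [e₂ hy, mul_zero, mul_zero]
    · rw [lp.single_apply_ne _ _ _ hj, lp.single_apply_ne _ _ _ hj]
      filter_upwards [Lp.coeFn_zero ℝ 2 κ] with y e
      rw [e, Pi.zero_apply, mul_zero]
  · rw [Ne, ← norm_eq_zero, V.symm.norm_map, lp.norm_single (by norm_num), hc, norm_indicatorConstLp (by norm_num)
        (by norm_num)]
    have : 0 < κ.real t := ENNReal.toReal_pos ht0.ne' htop.ne
    exact (mul_pos (by norm_num) (Real.rpow_pos_of_pos this _)).ne'
  · rw [← map_smul, ← map_sub, V.symm.norm_map, V.symm.norm_map, ← lp.single_smul, ← lp.single_sub,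
      lp.norm_single (by norm_num), lp.norm_single (by norm_num)]
    refine Lp.norm_le_mul_norm_of_ae_le_mul ?_
    filter_upwards [mulLp_apply b hb _ hB c, hcy, Lp.coeFn_sub (mulLp κ b hb _ hB c) (lam • c),
      Lp.coeFn_smul lam c] with y e₁ e₂ e₃ e₄
    rw [e₃, Pi.sub_apply, e₁, e₄, Pi.smul_apply, smul_eq_mul, ← sub_mul, norm_mul]
    by_cases hy : y ∈ t
    · have : |ω k y ^ 2 - lam| < ε := hts hy
      simp only [hbdef, if_pos this]
      gcongr
      exact this.le
    · rw [e₂ hy]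
      simp

open scoped InnerProductSpace in
/-- If some bounded function has only null level sets, then all nontrivial eigenspaces are infinite
dimensional. -/
theorem eigenspace_eq_bot (h : IsSkewShift Γ V ω) {b : Y → ℝ} (hb : Measurable b) {B : ℝ}
    (hB : ∀ y, |b y| ≤ B) (hlevel : ∀ c, ∀ᵐ y ∂κ, b y ≠ c) (lam : ℝ)
    [FiniteDimensional ℝ (eigenspace (negSq Γ.toLinearPMap) lam)] :
    eigenspace (negSq Γ.toLinearPMap) lam = ⊥ := by
  set A := negSq Γ.toLinearPMap with hA
  set X : Submodule ℝ H := (eigenspace A lam).map A.domain.subtype with hX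
  have hmem : ∀ g, g ∈ X ↔ (g, lam • g) ∈ A.graph := by
    intro g
    rw [hX, Submodule.mem_map, LinearPMap.mem_graph_iff]
    refine exists_congr fun x => ?_
    rw [eigenspace, LinearMap.mem_ker, LinearMap.sub_apply, sub_eq_zero]
    constructor
    · rintro ⟨h₁, h₂⟩
      refine ⟨h₂, ?_⟩
      rw [← h₂]
      exact h₁
    · rintro ⟨h₁, h₂⟩
      refine ⟨?_, h₁⟩
      simp only at h₁ h₂
      rw [← h₁] at h₂
      exact h₂
  let M : H →ₗ[ℝ] H := V.symm.toLinearEquiv.toLinearMap ∘ₗ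
    (weightedShift (κ := κ) (Equiv.refl ℤ) (fun _ => b) (fun _ => hb) B (fun _ => hB)).toLinearMap ∘ₗ
      V.toLinearEquiv.toLinearMap
  have hM : ∀ g k, V (M g) k =ᵐ[κ] fun y => b y * V g k y := by
    intro g k
    have : V (M g) = weightedShift (Equiv.refl ℤ) (fun _ => b) (fun _ => hb) B (fun _ => hB) (V g) :=
      V.apply_symm_apply _
    rw [this]
    exact weightedShift_apply _ _ _ _ _ _ _
  -- Multiplication by b acts in the same way in each slot, so it commutes with the multiplications
  -- by ω_k² and preserves the eigenspace.
  have hMX : ∀ g ∈ X, M g ∈ X := by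
    intro g hg
    rw [hmem, h.negSq_mem_iff] at hg ⊢
    intro k
    filter_upwards [hM g k, hg k, Lp.coeFn_smul lam (V g k), Lp.coeFn_smul lam (V (M g) k)]
      with y e₁ e₂ e₃ e₄
    have e₅ : V (lam • M g) k = lam • V (M g) k := by rw [map_smul, lp.coeFn_smul, Pi.smul_apply]
    have e₆ : V (lam • g) k = lam • V g k := by rw [map_smul, lp.coeFn_smul, Pi.smul_apply]
    rw [e₆, e₃, Pi.smul_apply, smul_eq_mul] at e₂
    rw [e₅, e₄, Pi.smul_apply, smul_eq_mul, e₁]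
    linear_combination b y * e₂
  have hsymm : (M.restrict hMX).IsSymmetric := by
    rintro ⟨f, hf⟩ ⟨g, hg⟩
    change ⟪M f, g⟫_ℝ = ⟪f, M g⟫_ℝ
    rw [← V.inner_map_map, ← V.inner_map_map f, lp.inner_eq_tsum, lp.inner_eq_tsum]
    refine tsum_congr fun k => ?_
    rw [L2.inner_def, L2.inner_def]
    refine integral_congr_ae ?_
    filter_upwards [hM f k, hM g k] with y e₁ e₂
    simp only [e₁, e₂, RCLike.inner_apply, conj_trivial]
    ring
  -- A symmetric operator on a nonzero finite-dimensional space has an eigenvalue c. Here an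
  -- eigenvector would have to live on the level set {b = c}, which is null.
  have hXbot : X = ⊥ := by
    by_contra hne
    have : Nontrivial X := Submodule.nontrivial_iff_ne_bot.2 hne
    have : FiniteDimensional ℝ X := by rw [hX]; infer_instance
    obtain ⟨c, hc⟩ : ∃ c : ℝ, Module.End.HasEigenvalue (M.restrict hMX) c :=
      ⟨_, hsymm.hasEigenvalue_iSup_of_finiteDimensional⟩
    obtain ⟨⟨f, hf⟩, hfe, hf0⟩ := hc.exists_hasEigenvector
    refine hf0 (Subtype.ext ?_)
    have hMf : M f = c • f := congrArg Subtype.val (Module.End.mem_eigenspace_iff.1 hfe)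
    refine eq_of_coe (V := V) fun k => ?_
    have e₀ := hM f k
    rw [hMf, map_smul, lp.coeFn_smul, Pi.smul_apply] at e₀
    filter_upwards [e₀, Lp.coeFn_smul c (V f k), hlevel c, Lp.coeFn_zero ℝ 2 κ] with y e₁ e₂ e₃ e₄
    rw [e₂, Pi.smul_apply, smul_eq_mul] at e₁
    have : V f k y = 0 := by
      by_contra hne
      exact e₃ (mul_right_cancel₀ hne e₁).symm
    rw [this, ZeroMemClass.coe_zero, map_zero, lp.coeFn_zero, Pi.zero_apply, e₄, Pi.zero_apply]
  rw [hX] at hXbot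
  exact Submodule.map_injective_of_injective A.domain.injective_subtype
    (hXbot.trans (Submodule.map_bot _).symm)

end IsSkewShift

end WeightedShiftOperator

/-! ### Analysis on a single radial orbit -/

section Orbit

open Set

/-- The real Fourier basis of `L²(ℝ / ℤ)`. -/
def trigBasis : ℤ → ℝ → ℝ
  | Int.ofNat 0, _ => 1
  | Int.ofNat (n + 1), θ => √2 * Real.cos (2 * Real.pi * (n + 1) * θ)
  | Int.negSucc n, θ => √2 * Real.sin (2 * Real.pi * (n + 1) * θ)

theorem continuous_trigBasis (k : ℤ) : Continuous (trigBasis k) := by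
  match k with
  | Int.ofNat 0 => exact continuous_const
  | Int.ofNat (n + 1) =>
    exact (by fun_prop : Continuous fun θ : ℝ => √2 * Real.cos (2 * Real.pi * (n + 1) * θ))
  | Int.negSucc n =>
    exact (by fun_prop : Continuous fun θ : ℝ => √2 * Real.sin (2 * Real.pi * (n + 1) * θ))

theorem abs_trigBasis_le (k : ℤ) (θ : ℝ) : |trigBasis k θ| ≤ √2 := by
  have h2 : (1 : ℝ) ≤ √2 := Real.one_le_sqrt.2 (by norm_num)
  match k with
  | Int.ofNat 0 => simp [trigBasis]
  | Int.ofNat (n + 1) =>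
    simp only [trigBasis, abs_mul, abs_of_nonneg (Real.sqrt_nonneg 2)]
    exact mul_le_of_le_one_right (Real.sqrt_nonneg 2) (Real.abs_cos_le_one _)
  | Int.negSucc n =>
    simp only [trigBasis, abs_mul, abs_of_nonneg (Real.sqrt_nonneg 2)]
    exact mul_le_of_le_one_right (Real.sqrt_nonneg 2) (Real.abs_sin_le_one _)

theorem integral_cos_two_pi_int (n : ℤ) :
    ∫ θ in (-(1 / 2) : ℝ)..(1 / 2), Real.cos (2 * Real.pi * n * θ) = if n = 0 then 1 else 0 := by
  split_ifs with h
  · subst h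
    norm_num
  · have hn : (n : ℝ) ≠ 0 := Int.cast_ne_zero.2 h
    have hc : 2 * Real.pi * n ≠ 0 := by positivity
    rw [intervalIntegral.integral_comp_mul_left (fun x => Real.cos x) hc, integral_cos]
    have h1 : 2 * Real.pi * n * (1 / 2) = n * Real.pi := by ring
    have h2 : 2 * Real.pi * n * (-(1 / 2)) = -(n * Real.pi) := by ring
    rw [h1, h2, Real.sin_neg, Real.sin_int_mul_pi]
    simp

theorem integral_eq_zero_of_odd {f : ℝ → ℝ} (hf : ∀ x, f (-x) = -f x) (c : ℝ) :
    ∫ x in (-c)..c, f x = 0 := by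
  have h := intervalIntegral.integral_comp_neg (a := -c) (b := c) f
  simp only [hf, intervalIntegral.integral_neg, neg_neg] at h
  linarith

theorem integral_trigBasis_mul (j k : ℤ) :
    ∫ θ in (-(1 / 2) : ℝ)..(1 / 2), trigBasis j θ * trigBasis k θ = if j = k then 1 else 0 := by
  have h2 : √2 * √2 = 2 := Real.mul_self_sqrt (by norm_num)
  have hci : ∀ n : ℤ, IntervalIntegrable (fun θ : ℝ => Real.cos (2 * Real.pi * n * θ)) volume
      (-(1 / 2)) (1 / 2) := fun n => Continuous.intervalIntegrable (by fun_prop) _ _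
  have hcc : ∀ m n : ℕ, ∫ θ in (-(1 / 2) : ℝ)..(1 / 2), (√2 * Real.cos (2 * Real.pi * (m + 1) * θ)) *
      (√2 * Real.cos (2 * Real.pi * (n + 1) * θ)) = if m = n then 1 else 0 := by
    intro m n
    have : ∀ θ : ℝ, (√2 * Real.cos (2 * Real.pi * (m + 1) * θ)) *
        (√2 * Real.cos (2 * Real.pi * (n + 1) * θ)) =
        Real.cos (2 * Real.pi * ((m - n : ℤ) : ℝ) * θ) +
          Real.cos (2 * Real.pi * ((m + n + 2 : ℤ) : ℝ) * θ) := by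
      intro θ
      have e1 : 2 * Real.pi * ((m - n : ℤ) : ℝ) * θ =
        2 * Real.pi * (m + 1) * θ - 2 * Real.pi * (n + 1) * θ := by push_cast; ring
      have e2 : 2 * Real.pi * ((m + n + 2 : ℤ) : ℝ) * θ =
        2 * Real.pi * (m + 1) * θ + 2 * Real.pi * (n + 1) * θ := by push_cast; ring
      rw [e1, e2, Real.cos_sub, Real.cos_add]
      linear_combination Real.cos (2 * Real.pi * (m + 1) * θ) *
        Real.cos (2 * Real.pi * (n + 1) * θ) * h2
    simp_rw [this]
    rw [intervalIntegral.integral_add (hci _) (hci _), integral_cos_two_pi_int,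
      integral_cos_two_pi_int, if_neg (show ¬ ((m : ℤ) + n + 2 = 0) by omega), add_zero]
    simp only [sub_eq_zero, Nat.cast_inj]
  have hss : ∀ m n : ℕ, ∫ θ in (-(1 / 2) : ℝ)..(1 / 2), (√2 * Real.sin (2 * Real.pi * (m + 1) * θ)) *
      (√2 * Real.sin (2 * Real.pi * (n + 1) * θ)) = if m = n then 1 else 0 := by
    intro m n
    have : ∀ θ : ℝ, (√2 * Real.sin (2 * Real.pi * (m + 1) * θ)) *
        (√2 * Real.sin (2 * Real.pi * (n + 1) * θ)) =
        Real.cos (2 * Real.pi * ((m - n : ℤ) : ℝ) * θ) -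
          Real.cos (2 * Real.pi * ((m + n + 2 : ℤ) : ℝ) * θ) := by
      intro θ
      have e1 : 2 * Real.pi * ((m - n : ℤ) : ℝ) * θ =
        2 * Real.pi * (m + 1) * θ - 2 * Real.pi * (n + 1) * θ := by push_cast; ring
      have e2 : 2 * Real.pi * ((m + n + 2 : ℤ) : ℝ) * θ =
        2 * Real.pi * (m + 1) * θ + 2 * Real.pi * (n + 1) * θ := by push_cast; ring
      rw [e1, e2, Real.cos_sub, Real.cos_add]
      linear_combination Real.sin (2 * Real.pi * (m + 1) * θ) *
        Real.sin (2 * Real.pi * (n + 1) * θ) * h2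
    simp_rw [this]
    rw [intervalIntegral.integral_sub (hci _) (hci _), integral_cos_two_pi_int,
      integral_cos_two_pi_int, if_neg (show ¬ ((m : ℤ) + n + 2 = 0) by omega), sub_zero]
    simp only [sub_eq_zero, Nat.cast_inj]
  have hc1 : ∀ n : ℕ, ∫ θ in (-(1 / 2) : ℝ)..(1 / 2), √2 * Real.cos (2 * Real.pi * (n + 1) * θ) = 0 := by
    intro n
    rw [intervalIntegral.integral_const_mul]
    have := integral_cos_two_pi_int (n + 1)
    rw [if_neg (show ¬ ((n : ℤ) + 1 = 0) by omega)] at this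
    push_cast at this
    rw [this, mul_zero]
  match j, k with
  | Int.ofNat 0, Int.ofNat 0 => norm_num [trigBasis]
  | Int.ofNat 0, Int.ofNat (n + 1) =>
    rw [if_neg (fun hh => by cases hh)]
    simpa only [trigBasis, one_mul] using hc1 n
  | Int.ofNat (n + 1), Int.ofNat 0 =>
    rw [if_neg (fun hh => by cases hh)]
    simpa only [trigBasis, mul_one] using hc1 n
  | Int.ofNat (m + 1), Int.ofNat (n + 1) =>
    rw [show (∫ θ in (-(1 / 2) : ℝ)..(1 / 2), trigBasis (Int.ofNat (m + 1)) θ *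
      trigBasis (Int.ofNat (n + 1)) θ) = if m = n then 1 else 0 from hcc m n]
    simp
  | Int.negSucc m, Int.negSucc n =>
    rw [show (∫ θ in (-(1 / 2) : ℝ)..(1 / 2), trigBasis (Int.negSucc m) θ *
      trigBasis (Int.negSucc n) θ) = if m = n then 1 else 0 from hss m n]
    simp
  | Int.ofNat 0, Int.negSucc n =>
    rw [if_neg (fun hh => by cases hh)]
    refine integral_eq_zero_of_odd (fun x => ?_) _
    simp only [trigBasis, mul_neg, Real.sin_neg]
  | Int.negSucc n, Int.ofNat 0 =>
    rw [if_neg (fun hh => by cases hh)]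
    refine integral_eq_zero_of_odd (fun x => ?_) _
    simp only [trigBasis, mul_neg, Real.sin_neg]
    ring
  | Int.ofNat (m + 1), Int.negSucc n =>
    rw [if_neg (fun hh => by cases hh)]
    refine integral_eq_zero_of_odd (fun x => ?_) _
    simp only [trigBasis, mul_neg, Real.sin_neg, Real.cos_neg]
  | Int.negSucc n, Int.ofNat (m + 1) =>
    rw [if_neg (fun hh => by cases hh)]
    refine integral_eq_zero_of_odd (fun x => ?_) _
    simp only [trigBasis, mul_neg, Real.sin_neg, Real.cos_neg]
    ring

/-- The speed `w` along a radial orbit with turning points `a < b`; `-F` is the acceleration. -/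
structure IsOrbit (a b : ℝ) (w F : ℝ → ℝ) : Prop where
  lt : a < b
  continuousOn : ContinuousOn w (Icc a b)
  left : w a = 0
  right : w b = 0
  pos : ∀ r ∈ Ioo a b, 0 < w r
  integrable : IntervalIntegrable (fun r => 1 / w r) volume a b
  continuousOn_force : ContinuousOn F (Icc a b)
  hasDerivAt : ∀ r ∈ Ioo a b, HasDerivAt w (-F r / w r) r

/-- The travel time from `a` to `r`. -/
def travelTime (a : ℝ) (w : ℝ → ℝ) (r : ℝ) : ℝ := ∫ s in a..r, 1 / w s

/-! ### Travel time as a coordinate on an orbit. -/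

namespace IsOrbit

variable {a b : ℝ} {w F : ℝ → ℝ} (h : IsOrbit a b w F)
include h

theorem nonneg {r : ℝ} (hr : r ∈ Icc a b) : 0 ≤ w r := by
  rcases eq_or_lt_of_le hr.1 with e | e
  · rw [← e, h.left]
  · rcases eq_or_lt_of_le hr.2 with e' | e'
    · rw [e', h.right]
    · exact (h.pos r ⟨e, e'⟩).le

theorem integrableOn_inv : IntegrableOn (fun r => 1 / w r) (Ioo a b) :=
  ((intervalIntegrable_iff_integrableOn_Ioo_of_le h.lt.le).1 h.integrable)

theorem continuousOn_travelTime : ContinuousOn (travelTime a w) (Icc a b) := by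
  have := intervalIntegral.continuousOn_primitive_interval
    (μ := volume) (f := fun r => 1 / w r) (a := a) (b := b)
    ((intervalIntegrable_iff_integrableOn_Icc_of_le h.lt.le).1 h.integrable |> fun hh => by
      rwa [uIcc_of_le h.lt.le])
  rwa [uIcc_of_le h.lt.le] at this

theorem continuousAt {r : ℝ} (hr : r ∈ Ioo a b) : ContinuousAt w r := (h.hasDerivAt r hr).continuousAt

theorem hasDerivAt_travelTime {r : ℝ} (hr : r ∈ Ioo a b) :
    HasDerivAt (travelTime a w) (1 / w r) r := by
  have hc : ContinuousOn (fun r => 1 / w r) (Ioo a b) := fun s hs =>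
    (continuousAt_const.div (h.continuousAt hs) (h.pos s hs).ne').continuousWithinAt
  refine intervalIntegral.integral_hasDerivAt_right ?_ ?_ (hc.continuousAt (Ioo_mem_nhds hr.1 hr.2))
  · exact h.integrable.mono_set (by
      rw [uIcc_of_le hr.1.le, uIcc_of_le h.lt.le]; exact Icc_subset_Icc_right hr.2.le)
  · exact hc.stronglyMeasurableAtFilter isOpen_Ioo r hr

omit h in
theorem travelTime_left : travelTime a w a = 0 := intervalIntegral.integral_same

theorem strictMonoOn_travelTime : StrictMonoOn (travelTime a w) (Icc a b) := by
  refine strictMonoOn_of_deriv_pos (convex_Icc a b) h.continuousOn_travelTime fun r hr => ?_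
  rw [interior_Icc] at hr
  rw [(h.hasDerivAt_travelTime hr).deriv]
  exact one_div_pos.2 (h.pos r hr)

theorem halfPeriod_pos : 0 < travelTime a w b := by
  have := h.strictMonoOn_travelTime (left_mem_Icc.2 h.lt.le) (right_mem_Icc.2 h.lt.le) h.lt
  rwa [travelTime_left] at this

theorem travelTime_mem_Icc {r : ℝ} (hr : r ∈ Icc a b) :
    travelTime a w r ∈ Icc 0 (travelTime a w b) := by
  have hm := h.strictMonoOn_travelTime.monotoneOn
  refine ⟨?_, hm hr (right_mem_Icc.2 h.lt.le) hr.2⟩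
  rw [← travelTime_left (a := a) (w := w)]
  exact hm (left_mem_Icc.2 h.lt.le) hr hr.1

theorem travelTime_mem_Ioo {r : ℝ} (hr : r ∈ Ioo a b) :
    travelTime a w r ∈ Ioo 0 (travelTime a w b) := by
  have hm := h.strictMonoOn_travelTime
  refine ⟨?_, hm ⟨hr.1.le, hr.2.le⟩ (right_mem_Icc.2 h.lt.le) hr.2⟩
  rw [← travelTime_left (a := a) (w := w)]
  exact hm (left_mem_Icc.2 h.lt.le) ⟨hr.1.le, hr.2.le⟩ hr.1

omit h in
/-- Products of integrable functions with functions continuous on `[a, b]` are integrable. -/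
theorem integrableOn_mul {f g : ℝ → ℝ} (hf : IntegrableOn f (Ioo a b))
    (hg : ContinuousOn g (Icc a b)) : IntegrableOn (fun r => f r * g r) (Ioo a b) := by
  have hf' : IntegrableOn f (Icc a b) := (integrableOn_Icc_iff_integrableOn_Ioo).2 hf
  exact (hf'.mul_continuousOn hg isCompact_Icc).mono_set Ioo_subset_Icc_self

theorem continuousOn_comp_travelTime {f : ℝ → ℝ} (hf : Continuous f) :
    ContinuousOn (fun r => f (travelTime a w r)) (Icc a b) :=
  hf.comp_continuousOn h.continuousOn_travelTime

/-- The substitution x = travel time has derivative 1/w, which blows up at the turning points. The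
fundamental theorem of calculus copes with this: the primitive is continuous on [a, b] and its
derivative in the interior is integrable. -/
theorem integral_comp_travelTime {f : ℝ → ℝ} (hf : Continuous f) :
    ∫ r in a..b, f (travelTime a w r) / w r = ∫ x in (0 : ℝ)..(travelTime a w b), f x := by
  have key := intervalIntegral.integral_eq_sub_of_hasDerivAt_of_le h.lt.le
    (f := fun r => ∫ x in (0 : ℝ)..(travelTime a w r), f x)
    (f' := fun r => f (travelTime a w r) / w r) ?_ ?_ ?_
  · rw [key, travelTime_left, intervalIntegral.integral_same, sub_zero]
  · exact h.continuousOn_comp_travelTime (f := fun y => ∫ x in (0 : ℝ)..y, f x)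
      (intervalIntegral.continuous_primitive (fun _ _ => hf.intervalIntegrable _ _) 0)
  · intro r hr
    have h1 : HasDerivAt (fun y => ∫ x in (0 : ℝ)..y, f x) (f (travelTime a w r)) (travelTime a w r) :=
      (hf.integral_hasStrictDerivAt 0 _).hasDerivAt
    have := h1.comp r (h.hasDerivAt_travelTime hr)
    rw [mul_one_div] at this
    exact this
  · rw [intervalIntegrable_iff_integrableOn_Ioo_of_le h.lt.le]
    refine (integrableOn_mul h.integrableOn_inv (h.continuousOn_comp_travelTime hf)).congr_fun
      (fun r _ => ?_) measurableSet_Ioo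
    ring

/-- The outgoing branch runs through times in [0, P] and the ingoing branch through [-P, 0], P being
the half period; together they make up a full period. -/
theorem integral_comp_travelTime_add_neg {f : ℝ → ℝ} (hf : Continuous f) :
    ∫ r in Ioo a b, (f (travelTime a w r) + f (-travelTime a w r)) / w r =
      ∫ x in (-travelTime a w b)..(travelTime a w b), f x := by
  rw [← integral_Ioc_eq_integral_Ioo, ← intervalIntegral.integral_of_le h.lt.le,
    h.integral_comp_travelTime (f := fun x => f x + f (-x)) (by fun_prop),
    intervalIntegral.integral_add (hf.intervalIntegrable _ _)
      (Continuous.intervalIntegrable (by fun_prop) _ _),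
    intervalIntegral.integral_comp_neg (fun x => f x), neg_zero, add_comm,
    intervalIntegral.integral_add_adjacent_intervals (hf.intervalIntegrable _ _)
      (hf.intervalIntegrable _ _)]

theorem integral_trigBasis_mul_orbit (j k : ℤ) :
    ∫ r in Ioo a b, (trigBasis j (travelTime a w r / (2 * travelTime a w b)) *
        trigBasis k (travelTime a w r / (2 * travelTime a w b)) +
      trigBasis j (-travelTime a w r / (2 * travelTime a w b)) *
        trigBasis k (-travelTime a w r / (2 * travelTime a w b))) / w r =
      if j = k then 2 * travelTime a w b else 0 := by
  have hP := h.halfPeriod_pos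
  set P := travelTime a w b with hPdef
  have hc : Continuous fun x : ℝ => trigBasis j (x / (2 * P)) * trigBasis k (x / (2 * P)) :=
    ((continuous_trigBasis j).comp (continuous_id.div_const _)).mul
      ((continuous_trigBasis k).comp (continuous_id.div_const _))
  rw [h.integral_comp_travelTime_add_neg hc, ← hPdef]
  have hne : 2 * P ≠ 0 := by positivity
  rw [intervalIntegral.integral_comp_div (fun x => trigBasis j x * trigBasis k x) hne]
  have e1 : P / (2 * P) = 1 / 2 := by field_simp
  have e2 : -P / (2 * P) = -(1 / 2) := by field_simp
  rw [e1, e2, integral_trigBasis_mul, smul_eq_mul]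
  split_ifs <;> simp

omit h in
-- An injective continuous u separates the points of [a, b], so by Stone–Weierstrass the polynomials
-- in u are uniformly dense. Hence f annihilates every continuous function.
theorem ae_eq_zero_of_moments {u f : ℝ → ℝ} (hu : ContinuousOn u (Icc a b))
    (hinj : InjOn u (Icc a b)) (hf : IntegrableOn f (Ioo a b))
    (hm : ∀ n : ℕ, ∫ r in Ioo a b, f r * u r ^ n = 0) : ∀ᵐ r, r ∈ Ioo a b → f r = 0 := by
  have hpoly : ∀ q : Polynomial ℝ, ∫ r in Ioo a b, f r * q.eval (u r) = 0 := by
    intro q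
    have hint : ∀ i : ℕ, IntegrableOn (fun r => f r * u r ^ i) (Ioo a b) := fun i =>
      (((integrableOn_Icc_iff_integrableOn_Ioo).2 hf).mul_continuousOn (hu.pow i)
        isCompact_Icc).mono_set Ioo_subset_Icc_self
    have : ∀ r, f r * q.eval (u r) = ∑ i ∈ q.support, q.coeff i * (f r * u r ^ i) := by
      intro r
      rw [Polynomial.eval_eq_sum, Polynomial.sum, Finset.mul_sum]
      exact Finset.sum_congr rfl fun i _ => by ring
    simp_rw [this]
    rw [integral_finsetSum _ fun i _ => (hint i).const_mul _]
    exact Finset.sum_eq_zero fun i _ => by rw [integral_const_mul, hm, mul_zero]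
  have hcont : ∀ φ : ℝ → ℝ, ContinuousOn φ (Icc a b) → ∫ r in Ioo a b, f r * φ r = 0 := by
    intro φ hφ
    have hfφ : IntegrableOn (fun r => f r * φ r) (Ioo a b) :=
      (((integrableOn_Icc_iff_integrableOn_Ioo).2 hf).mul_continuousOn hφ
        isCompact_Icc).mono_set Ioo_subset_Icc_self
    let uC : C(Icc a b, ℝ) := ⟨fun x => u x, hu.domRestrict⟩
    let φC : C(Icc a b, ℝ) := ⟨fun x => φ x, hφ.domRestrict⟩
    have hsep : (Algebra.adjoin ℝ {uC}).SeparatesPoints := by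
      intro x y hxy
      refine ⟨u ∘ Subtype.val, ⟨uC, Algebra.self_mem_adjoin_singleton ℝ uC, rfl⟩, fun he => hxy ?_⟩
      exact Subtype.ext (hinj x.2 y.2 he)
    have hdense := ContinuousMap.subalgebra_topologicalClosure_eq_top_of_separatesPoints _ hsep
    have hφmem : φC ∈ closure (Algebra.adjoin ℝ {uC} : Set C(Icc a b, ℝ)) := by
      have : φC ∈ (Algebra.adjoin ℝ {uC}).topologicalClosure := by rw [hdense]; trivial
      exact this
    rw [← norm_le_zero_iff]
    refine le_of_forall_pos_le_add fun ε hε => ?_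
    set N := ∫ r in Ioo a b, ‖f r‖ with hN
    have hN0 : 0 ≤ N := integral_nonneg fun _ => norm_nonneg _
    obtain ⟨ψ, hψ, hdist⟩ := Metric.mem_closure_iff.1 hφmem (ε / (N + 1)) (by positivity)
    rw [SetLike.mem_coe, Algebra.adjoin_singleton_eq_range_aeval] at hψ
    obtain ⟨q, rfl⟩ := hψ
    have hq : ∀ r ∈ Icc a b, |φ r - q.eval (u r)| ≤ ε / (N + 1) := by
      intro r hr
      have := (ContinuousMap.dist_apply_le_dist (f := φC) (g := Polynomial.aeval uC q) ⟨r, hr⟩).trans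
        hdist.le
      rwa [Real.dist_eq, Polynomial.aeval_continuousMap_apply] at this
    have hfq : IntegrableOn (fun r => f r * q.eval (u r)) (Ioo a b) :=
      (((integrableOn_Icc_iff_integrableOn_Ioo).2 hf).mul_continuousOn
        (q.continuous.comp_continuousOn hu) isCompact_Icc).mono_set Ioo_subset_Icc_self
    have heq : ∫ r in Ioo a b, f r * φ r = ∫ r in Ioo a b, f r * (φ r - q.eval (u r)) := by
      simp_rw [mul_sub]
      rw [integral_sub hfφ hfq, hpoly, sub_zero]
    rw [heq, zero_add]
    calc ‖∫ r in Ioo a b, f r * (φ r - q.eval (u r))‖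
        ≤ ∫ r in Ioo a b, ‖f r‖ * (ε / (N + 1)) := by
          refine norm_integral_le_of_norm_le (hf.norm.mul_const _) ?_
          refine (ae_restrict_iff' measurableSet_Ioo).2 (Eventually.of_forall fun r hr => ?_)
          rw [norm_mul]
          exact mul_le_mul_of_nonneg_left (hq r (Ioo_subset_Icc_self hr)) (norm_nonneg _)
      _ = N * (ε / (N + 1)) := by rw [integral_mul_const]
      _ ≤ ε := by
          rw [mul_div_assoc', div_le_iff₀ (by positivity)]
          nlinarith
  refine isOpen_Ioo.ae_eq_zero_of_integral_contDiff_smul_eq_zero hf.locallyIntegrableOn ?_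
  intro g hg _ hsupp
  have h1 := hcont g hg.continuous.continuousOn
  rw [← integral_indicator measurableSet_Ioo] at h1
  rw [← h1]
  refine integral_congr_ae (Eventually.of_forall fun r => ?_)
  by_cases hr : r ∈ Ioo a b
  · simp only [indicator_of_mem hr, smul_eq_mul, mul_comm]
  · simp only [indicator_of_notMem hr, smul_eq_mul]
    rw [image_eq_zero_of_notMem_tsupport fun hh => hr (hsupp hh), zero_mul]

end IsOrbit

end Orbit

/-! ### Fourier coefficients on an orbit and the approximation of test functions. -/

section Orbit

open Set

/-- The coefficients (up to normalisation) of a function on an orbit with respect to the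
trigonometric basis; `gp` and `gm` are its values on the outgoing and on the ingoing branch. -/
def orbitCoeff (a b : ℝ) (w : ℝ → ℝ) (k : ℤ) (gp gm : ℝ → ℝ) : ℝ :=
  ∫ r in Ioo a b, (gp r * trigBasis k (travelTime a w r / (2 * travelTime a w b)) +
    gm r * trigBasis k (-travelTime a w r / (2 * travelTime a w b))) / w r

/-- `hrec` is the Chebyshev recurrence, satisfied by c n = cos nθ and by c n = sin nθ with u = cos
θ. It converts orthogonality to all c n into orthogonality to all uᵐ c n, the form needed for
`ae_eq_zero_of_moments`. -/
theorem integral_mul_pow_mul_eq_zero {a b : ℝ} {f u : ℝ → ℝ} {c : ℤ → ℝ → ℝ}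
    (hf : IntegrableOn f (Ioo a b)) (hu : ContinuousOn u (Icc a b))
    (hc : ∀ n, ContinuousOn (c n) (Icc a b))
    (hrec : ∀ n r, c (n + 1) r + c (n - 1) r = 2 * u r * c n r)
    (h0 : ∀ n, ∫ r in Ioo a b, f r * c n r = 0) (m : ℕ) :
    ∀ n, ∫ r in Ioo a b, f r * (u r ^ m * c n r) = 0 := by
  induction m with
  | zero => simpa using h0
  | succ m ih =>
    intro n
    have hi : ∀ n, IntegrableOn (fun r => f r * (u r ^ m * c n r)) (Ioo a b) := fun n =>
      IsOrbit.integrableOn_mul hf ((hu.pow m).mul (hc n))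
    have : ∀ r, f r * (u r ^ (m + 1) * c n r) =
        1 / 2 * (f r * (u r ^ m * c (n + 1) r) + f r * (u r ^ m * c (n - 1) r)) := by
      intro r
      linear_combination (-(1 / 2) * f r * u r ^ m) * hrec n r
    simp_rw [this]
    rw [integral_const_mul, integral_add (hi _) (hi _), ih, ih]
    simp

/-- `ht` is the relation ∫ (A p' + B p) = 0 for monomials p. Approximating the derivative f, rather
than its primitive, uniformly by polynomials makes the primitives converge uniformly as well, so the
relation extends to every continuously differentiable p that vanishes at a. -/
theorem integral_mul_add_mul_primitive_eq_zero {a b : ℝ} (hab : a < b) {A B : ℝ → ℝ}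
    (hA : IntegrableOn A (Ioo a b)) (hB : IntegrableOn B (Ioo a b))
    (ht : ∀ n : ℕ, ∫ r in Ioo a b, (A r * (n * r ^ (n - 1)) + B r * r ^ n) = 0)
    {f : ℝ → ℝ} (hf : ContinuousOn f (Icc a b)) :
    ∫ r in Ioo a b, (A r * f r + B r * ∫ s in a..r, f s) = 0 := by
  have hprim : ∀ {g : ℝ → ℝ}, ContinuousOn g (Icc a b) →
      ContinuousOn (fun r => ∫ s in a..r, g s) (Icc a b) := by
    intro g hg
    have := intervalIntegral.continuousOn_primitive_interval (μ := volume) (f := g) (a := a) (b := b)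
      (by rw [uIcc_of_le hab.le]; exact hg.integrableOn_Icc)
    rwa [uIcc_of_le hab.le] at this
  have hint : ∀ {g : ℝ → ℝ}, ContinuousOn g (Icc a b) →
      IntegrableOn (fun r => A r * g r + B r * ∫ s in a..r, g s) (Ioo a b) := fun hg =>
    (IsOrbit.integrableOn_mul hA hg).add (IsOrbit.integrableOn_mul hB (hprim hg))
  have hsub : ∀ {g : ℝ → ℝ}, ContinuousOn g (Icc a b) → ∀ {r}, r ∈ Icc a b →
      IntervalIntegrable g volume a r := by
    intro g hg r hr
    refine ContinuousOn.intervalIntegrable ?_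
    rw [uIcc_of_le hr.1]
    exact hg.mono (Icc_subset_Icc_right hr.2)
  -- For n = 0 the first term is 0 · r ^ (0 - 1) = 0. Constants are thus admissible, which absorbs
  -- the difference between a monomial and the primitive that starts at a.
  have hB0 : ∫ r in Ioo a b, B r = 0 := by simpa using ht 0
  have hpoly : ∀ q : Polynomial ℝ,
      ∫ r in Ioo a b, (A r * q.eval r + B r * ∫ s in a..r, q.eval s) = 0 := by
    intro q
    induction q using Polynomial.induction_on' with
    | add p q hp hq =>
      have hcongr : ∀ r, A r * (p + q).eval r + B r * (∫ s in a..r, (p + q).eval s) =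
          (A r * p.eval r + B r * ∫ s in a..r, p.eval s) +
            (A r * q.eval r + B r * ∫ s in a..r, q.eval s) := by
        intro r
        simp only [Polynomial.eval_add]
        rw [intervalIntegral.integral_add (p.continuous.intervalIntegrable _ _)
          (q.continuous.intervalIntegrable _ _)]
        ring
      simp_rw [hcongr]
      rw [integral_add (hint p.continuous.continuousOn) (hint q.continuous.continuousOn), hp, hq,
        add_zero]
    | monomial n c =>
      have hcongr : ∀ r, A r * (Polynomial.monomial n c).eval r +
          B r * (∫ s in a..r, (Polynomial.monomial n c).eval s) =
          c / (n + 1) * (A r * ((n + 1 : ℕ) * r ^ (n + 1 - 1)) + B r * r ^ (n + 1)) -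
            c / (n + 1) * a ^ (n + 1) * B r := by
        intro r
        simp only [Polynomial.eval_monomial]
        rw [intervalIntegral.integral_const_mul, integral_pow]
        have : (n : ℝ) + 1 ≠ 0 := by positivity
        push_cast
        field_simp
        ring
      simp_rw [hcongr]
      have hi : IntegrableOn (fun r => A r * ((n + 1 : ℕ) * r ^ (n + 1 - 1)) + B r * r ^ (n + 1))
          (Ioo a b) :=
        (IsOrbit.integrableOn_mul hA (g := fun r => ((n + 1 : ℕ) : ℝ) * r ^ (n + 1 - 1))
          (by fun_prop)).add
          (IsOrbit.integrableOn_mul hB (by fun_prop))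
      rw [integral_sub (hi.const_mul _) (hB.const_mul _), integral_const_mul, integral_const_mul, ht,
        hB0, mul_zero, mul_zero, sub_zero]
  rw [← norm_le_zero_iff]
  refine le_of_forall_pos_le_add fun ε hε => ?_
  set N := ∫ r in Ioo a b, (‖A r‖ + ‖B r‖ * (b - a)) with hN
  have hba : 0 < b - a := sub_pos.2 hab
  have hN0 : 0 ≤ N := integral_nonneg fun _ => by positivity
  obtain ⟨q, hq⟩ := exists_polynomial_near_of_continuousOn a b f hf (ε / (N + 1)) (by positivity)
  have hq' : ContinuousOn (fun r => q.eval r) (Icc a b) := q.continuous.continuousOn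
  have heq : ∫ r in Ioo a b, (A r * f r + B r * ∫ s in a..r, f s) =
      ∫ r in Ioo a b, ((A r * f r + B r * ∫ s in a..r, f s) -
        (A r * q.eval r + B r * ∫ s in a..r, q.eval s)) := by
    rw [integral_sub (hint hf) (hint hq'), hpoly, sub_zero]
  rw [heq, zero_add]
  calc _ ≤ ∫ r in Ioo a b, (‖A r‖ + ‖B r‖ * (b - a)) * (ε / (N + 1)) := by
        refine norm_integral_le_of_norm_le ((hA.norm.add (hB.norm.mul_const _)).mul_const _) ?_
        refine (ae_restrict_iff' measurableSet_Ioo).2 (Eventually.of_forall fun r hr => ?_)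
        have hr' := Ioo_subset_Icc_self hr
        have e : (A r * f r + B r * ∫ s in a..r, f s) -
            (A r * q.eval r + B r * ∫ s in a..r, q.eval s) =
            A r * (f r - q.eval r) + B r * ∫ s in a..r, (f s - q.eval s) := by
          rw [intervalIntegral.integral_sub (hsub hf hr') (hsub hq' hr')]
          ring
        have h1 : ‖f r - q.eval r‖ ≤ ε / (N + 1) := by
          rw [norm_sub_rev]
          exact (hq r hr').le
        have h2 : ‖∫ s in a..r, (f s - q.eval s)‖ ≤ ε / (N + 1) * (b - a) := by
          refine (intervalIntegral.norm_integral_le_of_norm_le_const (C := ε / (N + 1))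
            fun s hs => ?_).trans ?_
          · rw [uIoc_of_le hr'.1] at hs
            rw [norm_sub_rev]
            exact (hq s ⟨hs.1.le, hs.2.trans hr'.2⟩).le
          · rw [abs_of_nonneg (sub_nonneg.2 hr'.1)]
            gcongr
            exact hr'.2
        rw [e]
        calc _ ≤ ‖A r‖ * (ε / (N + 1)) + ‖B r‖ * (ε / (N + 1) * (b - a)) := by
              refine (norm_add_le _ _).trans ?_
              rw [norm_mul, norm_mul]
              gcongr
          _ = _ := by ring
    _ = N * (ε / (N + 1)) := by rw [integral_mul_const]
    _ ≤ ε := by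
        rw [mul_div_assoc', div_le_iff₀ (by positivity)]
        nlinarith

/-- The derivative of a smooth cutoff of the identity near `0`. -/
def cutDeriv (ε t : ℝ) : ℝ := min 1 (max 0 (|t| / ε - 1))

/-- A `C¹` approximation of the identity which vanishes near `0`. -/
def cutIdentity (ε y : ℝ) : ℝ := ∫ t in (0 : ℝ)..y, cutDeriv ε t

theorem continuous_cutDeriv (ε : ℝ) : Continuous (cutDeriv ε) := by
  unfold cutDeriv
  fun_prop

theorem cutDeriv_nonneg (ε t : ℝ) : 0 ≤ cutDeriv ε t := le_min zero_le_one (le_max_left _ _)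

theorem cutDeriv_le_one (ε t : ℝ) : cutDeriv ε t ≤ 1 := min_le_left _ _

theorem cutDeriv_eq_zero {ε t : ℝ} (hε : 0 < ε) (ht : |t| ≤ ε) : cutDeriv ε t = 0 := by
  have : |t| / ε - 1 ≤ 0 := sub_nonpos.2 ((div_le_one hε).2 ht)
  rw [cutDeriv, max_eq_left this, min_eq_right zero_le_one]

theorem cutDeriv_eq_one {ε t : ℝ} (hε : 0 < ε) (ht : 2 * ε ≤ |t|) : cutDeriv ε t = 1 := by
  have : 1 ≤ |t| / ε - 1 := by
    rw [le_sub_iff_add_le, le_div_iff₀ hε]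
    linarith
  rw [cutDeriv, max_eq_right (zero_le_one.trans this), min_eq_left this]

theorem hasDerivAt_cutIdentity (ε y : ℝ) : HasDerivAt (cutIdentity ε) (cutDeriv ε y) y :=
  ((continuous_cutDeriv ε).integral_hasStrictDerivAt 0 y).hasDerivAt

theorem cutIdentity_eq_zero {ε y : ℝ} (hε : 0 < ε) (hy : |y| ≤ ε) : cutIdentity ε y = 0 := by
  refine intervalIntegral.integral_zero_ae (Eventually.of_forall fun t ht => ?_)
  refine cutDeriv_eq_zero hε (le_trans ?_ hy)
  rcases le_total 0 y with h | h
  · rw [uIoc_of_le h] at ht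
    rw [abs_of_pos ht.1, abs_of_nonneg h]
    exact ht.2
  · rw [uIoc_of_ge h] at ht
    rw [abs_of_nonpos ht.2, abs_of_nonpos h]
    linarith [ht.1]

theorem abs_cutIdentity_le (ε y : ℝ) : |cutIdentity ε y| ≤ |y| := by
  have := intervalIntegral.norm_integral_le_of_norm_le_const (a := 0) (b := y) (f := cutDeriv ε)
    (C := 1) fun t _ => by
      rw [Real.norm_eq_abs, abs_of_nonneg (cutDeriv_nonneg ε t)]
      exact cutDeriv_le_one ε t
  simpa [cutIdentity] using this

theorem tendsto_cutDeriv {t : ℝ} (ht : t ≠ 0) :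
    Tendsto (fun n : ℕ => cutDeriv (1 / ((n : ℝ) + 1)) t) atTop (𝓝 1) := by
  have h1 : ∀ᶠ n : ℕ in atTop, 1 / ((n : ℝ) + 1) < |t| / 2 :=
    tendsto_one_div_add_atTop_nhds_zero_nat.eventually_lt_const (by positivity)
  refine tendsto_const_nhds.congr' ?_
  filter_upwards [h1] with n hn
  rw [cutDeriv_eq_one (by positivity)]
  linarith

theorem tendsto_cutIdentity (y : ℝ) :
    Tendsto (fun n : ℕ => cutIdentity (1 / ((n : ℝ) + 1)) y) atTop (𝓝 y) := by
  have := intervalIntegral.tendsto_integral_filter_of_dominated_convergence (μ := volume)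
    (a := 0) (b := y) (l := atTop) (F := fun (n : ℕ) t => cutDeriv (1 / ((n : ℝ) + 1)) t)
    (f := fun _ => (1 : ℝ)) (fun _ => 1)
    (Eventually.of_forall fun n => (continuous_cutDeriv _).aestronglyMeasurable)
    (Eventually.of_forall fun n => Eventually.of_forall fun t _ => by
      rw [Real.norm_eq_abs, abs_of_nonneg (cutDeriv_nonneg _ t)]
      exact cutDeriv_le_one _ t)
    intervalIntegrable_const (by
      have : ∀ᵐ t : ℝ, t ≠ 0 := by
        simp [ae_iff]
      filter_upwards [this] with t ht _ using tendsto_cutDeriv ht)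
  simpa [cutIdentity] using this

/-! ### Completeness of the trigonometric system and the transport equation on one orbit. -/

namespace IsOrbit

variable {a b : ℝ} {w F : ℝ → ℝ} (h : IsOrbit a b w F)
include h

theorem hasDerivAt_cos {r : ℝ} (hr : r ∈ Ioo a b) (ω : ℝ) :
    HasDerivAt (fun r => Real.cos (ω * travelTime a w r)) (-ω * Real.sin (ω * travelTime a w r) / w r)
      r := by
  have := ((h.hasDerivAt_travelTime hr).const_mul ω).cos
  convert this using 1
  ring

theorem hasDerivAt_sin {r : ℝ} (hr : r ∈ Ioo a b) (ω : ℝ) :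
    HasDerivAt (fun r => Real.sin (ω * travelTime a w r)) (ω * Real.cos (ω * travelTime a w r) / w r)
      r := by
  have := ((h.hasDerivAt_travelTime hr).const_mul ω).sin
  convert this using 1
  ring

theorem continuousOn_cos (ω : ℝ) :
    ContinuousOn (fun r => Real.cos (ω * travelTime a w r)) (Icc a b) :=
  h.continuousOn_comp_travelTime (f := fun x => Real.cos (ω * x)) (by fun_prop)

theorem continuousOn_sin (ω : ℝ) :
    ContinuousOn (fun r => Real.sin (ω * travelTime a w r)) (Icc a b) :=
  h.continuousOn_comp_travelTime (f := fun x => Real.sin (ω * x)) (by fun_prop)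

theorem integrableOn_of_div {g : ℝ → ℝ} (hg : IntegrableOn (fun r => g r / w r) (Ioo a b)) :
    IntegrableOn g (Ioo a b) := by
  refine (integrableOn_mul hg h.continuousOn).congr_fun (fun r hr => ?_) measurableSet_Ioo
  exact div_mul_cancel₀ _ (h.pos r hr).ne'

/-- Completeness of the trigonometric system on one orbit. The cosines see only gp + gm and the
sines only gp - gm; via the Chebyshev recurrence both cases become moment problems in u = cos(ωt).
In the second case a factor sin(ωt) is left over, which has no zero between the turning points. -/
theorem ae_eq_zero_of_orbitCoeff {gp gm : ℝ → ℝ} (hp : IntegrableOn (fun r => gp r / w r) (Ioo a b))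
    (hm : IntegrableOn (fun r => gm r / w r) (Ioo a b)) (H : ∀ k, orbitCoeff a b w k gp gm = 0) :
    ∀ᵐ r, r ∈ Ioo a b → gp r = 0 ∧ gm r = 0 := by
  have hP := h.halfPeriod_pos
  set P := travelTime a w b with hPdef
  set ω : ℝ := Real.pi / P with hω
  have hωpos : 0 < ω := div_pos Real.pi_pos hP
  have he : IntegrableOn (fun r => gp r / w r + gm r / w r) (Ioo a b) := hp.add hm
  have ho : IntegrableOn (fun r => gp r / w r - gm r / w r) (Ioo a b) := hp.sub hm
  have harg : ∀ (n : ℕ) r, 2 * Real.pi * (n + 1) * (travelTime a w r / (2 * P)) =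
      ((n : ℝ) + 1) * (ω * travelTime a w r) := by
    intro n r
    rw [hω]
    field_simp
  have harg' : ∀ (n : ℕ) r, 2 * Real.pi * (n + 1) * (-travelTime a w r / (2 * P)) =
      -(((n : ℝ) + 1) * (ω * travelTime a w r)) := by
    intro n r
    rw [hω]
    field_simp
  have h2 : √2 ≠ 0 := by positivity
  have hcos : ∀ n : ℕ, ∫ r in Ioo a b, (gp r / w r + gm r / w r) *
      Real.cos ((n : ℝ) * (ω * travelTime a w r)) = 0 := by
    intro n
    have Hn := H (Int.ofNat n)
    rw [orbitCoeff] at Hn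
    match n with
    | 0 =>
      rw [← Hn]
      refine integral_congr_ae (Eventually.of_forall fun r => ?_)
      simp only [trigBasis, Nat.cast_zero, zero_mul, Real.cos_zero]
      ring
    | n + 1 =>
      refine (mul_eq_zero.1 ?_ : √2 = 0 ∨ _).resolve_left h2
      rw [← integral_const_mul, ← Hn]
      refine integral_congr_ae (Eventually.of_forall fun r => ?_)
      simp only [trigBasis, ← hPdef]
      rw [harg, harg', Real.cos_neg]
      push_cast
      ring
  have hsin : ∀ n : ℕ, ∫ r in Ioo a b, (gp r / w r - gm r / w r) *
      Real.sin ((n : ℝ) * (ω * travelTime a w r)) = 0 := by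
    intro n
    match n with
    | 0 => simp
    | n + 1 =>
      have Hn := H (Int.negSucc n)
      rw [orbitCoeff] at Hn
      refine (mul_eq_zero.1 ?_ : √2 = 0 ∨ _).resolve_left h2
      rw [← integral_const_mul, ← Hn]
      refine integral_congr_ae (Eventually.of_forall fun r => ?_)
      simp only [trigBasis, ← hPdef]
      rw [harg, harg', Real.sin_neg]
      push_cast
      ring
  have hu := h.continuousOn_cos ω
  -- With ω = π/P the half period is mapped onto [0, π], where the cosine is injective.
  have hinj : InjOn (fun r => Real.cos (ω * travelTime a w r)) (Icc a b) := by
    intro r hr s hs hrs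
    refine h.strictMonoOn_travelTime.injOn hr hs ?_
    have hmem : ∀ {r}, r ∈ Icc a b → ω * travelTime a w r ∈ Icc 0 Real.pi := by
      intro r hr
      obtain ⟨h1, h2⟩ := h.travelTime_mem_Icc hr
      refine ⟨mul_nonneg hωpos.le h1, ?_⟩
      calc ω * travelTime a w r ≤ ω * P := by gcongr
        _ = Real.pi := by rw [hω]; field_simp
    exact mul_left_cancel₀ hωpos.ne' (Real.injOn_cos (hmem hr) (hmem hs) hrs)
  have hce := integral_mul_pow_mul_eq_zero he hu
    (c := fun n r => Real.cos ((n : ℝ) * (ω * travelTime a w r)))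
    (fun n => h.continuousOn_comp_travelTime (f := fun x => Real.cos ((n : ℝ) * (ω * x)))
      (by fun_prop))
    (fun n r => by
      push_cast
      rw [add_mul, sub_mul, one_mul, Real.cos_add, Real.cos_sub]
      ring)
    (fun n => by
      obtain ⟨m, rfl | rfl⟩ := n.eq_nat_or_neg
      · simpa using hcos m
      · simpa using hcos m)
  have hco := integral_mul_pow_mul_eq_zero ho hu
    (c := fun n r => Real.sin ((n : ℝ) * (ω * travelTime a w r)))
    (fun n => h.continuousOn_comp_travelTime (f := fun x => Real.sin ((n : ℝ) * (ω * x)))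
      (by fun_prop))
    (fun n r => by
      push_cast
      rw [add_mul, sub_mul, one_mul, Real.sin_add, Real.sin_sub]
      ring)
    (fun n => by
      obtain ⟨m, rfl | rfl⟩ := n.eq_nat_or_neg
      · simpa using hsin m
      · simpa [integral_neg] using hsin m)
  have h₁ := ae_eq_zero_of_moments hu hinj he (fun m => by simpa using hce m 0)
  have h₂ := ae_eq_zero_of_moments hu hinj
    (f := fun r => (gp r / w r - gm r / w r) * Real.sin (ω * travelTime a w r))
    (integrableOn_mul ho (h.continuousOn_sin ω)) (fun m => by
      rw [← hco m 1]
      refine integral_congr_ae (Eventually.of_forall fun r => ?_)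
      simp only [Int.cast_one, one_mul]
      ring)
  filter_upwards [h₁, h₂] with r e₁ e₂ hr
  have hw := (h.pos r hr).ne'
  have hs : Real.sin (ω * travelTime a w r) ≠ 0 := by
    obtain ⟨h1, h2⟩ := h.travelTime_mem_Ioo hr
    refine (Real.sin_pos_of_pos_of_lt_pi (mul_pos hωpos h1) ?_).ne'
    calc ω * travelTime a w r < ω * P := by gcongr
      _ = Real.pi := by rw [hω]; field_simp
  have e₁ := e₁ hr
  have e₂ := (mul_eq_zero.1 (e₂ hr)).resolve_right hs
  rw [← add_div, div_eq_zero_iff] at e₁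
  rw [← sub_div, div_eq_zero_iff] at e₂
  have e₁ := e₁.resolve_right hw
  have e₂ := e₂.resolve_right hw
  exact ⟨by linarith, by linarith⟩

/-- Time reversal swaps the two branches. Cosine coefficients depend on the even part (the sum of
the branches), sine coefficients on the odd part (the difference), and 𝓓 exchanges parities; so the
relation between slots k and -k splits into one family of identities for each parity. -/
theorem orbitCoeff_eq {gp gm mp mm : ℝ → ℝ}
    (he : ∀ n : ℕ, ∫ r in Ioo a b, (mp r + mm r) / w r *
      Real.cos (Real.pi * n / travelTime a w b * travelTime a w r) =
        Real.pi * n / travelTime a w b * ∫ r in Ioo a b, (gp r - gm r) / w r *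
          Real.sin (Real.pi * n / travelTime a w b * travelTime a w r))
    (ho : ∀ n : ℕ, ∫ r in Ioo a b, (mp r - mm r) / w r *
      Real.sin (Real.pi * n / travelTime a w b * travelTime a w r) =
        -(Real.pi * n / travelTime a w b * ∫ r in Ioo a b, (gp r + gm r) / w r *
          Real.cos (Real.pi * n / travelTime a w b * travelTime a w r))) (k : ℤ) :
    orbitCoeff a b w k mp mm =
      2 * Real.pi * k / (2 * travelTime a w b) * orbitCoeff a b w (-k) gp gm := by
  have hP := h.halfPeriod_pos
  set P := travelTime a w b with hPdef
  have harg : ∀ (n : ℕ) r, 2 * Real.pi * (n + 1) * (travelTime a w r / (2 * P)) =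
      Real.pi * (n + 1 : ℕ) / P * travelTime a w r := by
    intro n r
    push_cast
    field_simp
  have harg' : ∀ (n : ℕ) r, 2 * Real.pi * (n + 1) * (-travelTime a w r / (2 * P)) =
      -(Real.pi * (n + 1 : ℕ) / P * travelTime a w r) := by
    intro n r
    push_cast
    field_simp
  have hC : ∀ (n : ℕ) (fp fm : ℝ → ℝ), orbitCoeff a b w (Int.ofNat (n + 1)) fp fm =
      √2 * ∫ r in Ioo a b, (fp r + fm r) / w r *
        Real.cos (Real.pi * (n + 1 : ℕ) / P * travelTime a w r) := by
    intro n fp fm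
    rw [orbitCoeff, ← integral_const_mul]
    refine integral_congr_ae (Eventually.of_forall fun r => ?_)
    simp only [trigBasis, ← hPdef]
    rw [harg, harg', Real.cos_neg]
    ring
  have hS : ∀ (n : ℕ) (fp fm : ℝ → ℝ), orbitCoeff a b w (Int.negSucc n) fp fm =
      √2 * ∫ r in Ioo a b, (fp r - fm r) / w r *
        Real.sin (Real.pi * (n + 1 : ℕ) / P * travelTime a w r) := by
    intro n fp fm
    rw [orbitCoeff, ← integral_const_mul]
    refine integral_congr_ae (Eventually.of_forall fun r => ?_)
    simp only [trigBasis, ← hPdef]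
    rw [harg, harg', Real.sin_neg]
    ring
  match k with
  | Int.ofNat 0 =>
    have := he 0
    simp only [Nat.cast_zero, mul_zero, zero_div, zero_mul, Real.cos_zero, mul_one] at this
    rw [orbitCoeff]
    simpa [trigBasis] using this
  | Int.ofNat (n + 1) =>
    rw [show -Int.ofNat (n + 1) = Int.negSucc n from rfl, hC, hS, he]
    simp only [Int.ofNat_eq_natCast, Int.cast_natCast]
    field_simp
  | Int.negSucc n =>
    rw [show -Int.negSucc n = Int.ofNat (n + 1) from rfl, hC, hS, ho]
    simp only [Int.cast_negSucc]
    push_cast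
    field_simp

/-- The desired test function cos(ωt(r)) has r-derivative -ω sin(ωt)/w, singular at the turning
points. Replacing w by max(w, 1/(n+1)) in the denominator gives continuous derivatives, and 1/w,
being integrable, dominates the limit. The primitive of the limit is cos(ωt) - 1; the constant drops
out because the test n = 0 gives ∫ m/w = 0. -/
theorem integral_cos_of_tests {g m : ℝ → ℝ} (hg : IntegrableOn (fun r => g r / w r) (Ioo a b))
    (hm : IntegrableOn (fun r => m r / w r) (Ioo a b))
    (ht : ∀ n : ℕ, ∫ r in Ioo a b, (g r * (n * r ^ (n - 1)) + m r / w r * r ^ n) = 0) (ω : ℝ) :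
    ∫ r in Ioo a b, m r / w r * Real.cos (ω * travelTime a w r) =
      ω * ∫ r in Ioo a b, g r / w r * Real.sin (ω * travelTime a w r) := by
  have hgi := h.integrableOn_of_div hg
  have hm0 : ∫ r in Ioo a b, m r / w r = 0 := by simpa using ht 0
  set f : ℕ → ℝ → ℝ := fun n r => -ω * Real.sin (ω * travelTime a w r) / max (w r) (1 / (n + 1))
    with hf
  have hfc : ∀ n, ContinuousOn (f n) (Icc a b) := fun n =>
    (continuousOn_const.mul (h.continuousOn_sin ω)).div
      (h.continuousOn.sup continuousOn_const) fun r _ =>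
        (lt_max_of_lt_right (by positivity)).ne'
  have h0 := fun n => integral_mul_add_mul_primitive_eq_zero h.lt hgi hm ht (hfc n)
  have hbound : ∀ n, ∀ r ∈ Icc a b, ‖f n r‖ ≤ |ω| * (1 / w r) ∨ w r = 0 := by
    intro n r hr
    rcases eq_or_ne (w r) 0 with h0 | h0
    · exact Or.inr h0
    · left
      have hw : 0 < w r := lt_of_le_of_ne (h.nonneg hr) h0.symm
      rw [hf, norm_div, norm_mul, norm_neg, Real.norm_eq_abs, Real.norm_eq_abs, Real.norm_eq_abs,
        abs_of_pos (hw.trans_le (le_max_left _ _)), mul_one_div]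
      refine div_le_div₀ (abs_nonneg _) (mul_le_of_le_one_right (abs_nonneg _)
        (Real.abs_sin_le_one _)) hw (le_max_left _ _)
  have hbound' : ∀ n, ∀ r ∈ Ioo a b, ‖f n r‖ ≤ |ω| * (1 / w r) := fun n r hr =>
    (hbound n r (Ioo_subset_Icc_self hr)).resolve_right (h.pos r hr).ne'
  have hlim : ∀ r ∈ Ioo a b,
      Tendsto (fun n => f n r) atTop (𝓝 (-ω * Real.sin (ω * travelTime a w r) / w r)) := by
    intro r hr
    have h1 : ∀ᶠ n : ℕ in atTop, 1 / ((n : ℝ) + 1) < w r :=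
      tendsto_one_div_add_atTop_nhds_zero_nat.eventually_lt_const (h.pos r hr)
    refine tendsto_const_nhds.congr' ?_
    filter_upwards [h1] with n hn
    simp only [hf]
    rw [max_eq_left hn.le]
  have hprim : ∀ r ∈ Ioo a b, Tendsto (fun n => ∫ s in a..r, f n s) atTop
      (𝓝 (Real.cos (ω * travelTime a w r) - 1)) := by
    intro r hr
    have hI : IntervalIntegrable (fun s => |ω| * (1 / w s)) volume a r :=
      (h.integrable.mono_set (by
        rw [uIcc_of_le hr.1.le, uIcc_of_le h.lt.le]; exact Icc_subset_Icc_right hr.2.le)).const_mul _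
    have hFTC : ∫ s in a..r, -ω * Real.sin (ω * travelTime a w s) / w s =
        Real.cos (ω * travelTime a w r) - 1 := by
      rw [intervalIntegral.integral_eq_sub_of_hasDerivAt_of_le hr.1.le
        ((h.continuousOn_cos ω).mono (Icc_subset_Icc_right hr.2.le))
        (fun s hs => h.hasDerivAt_cos ⟨hs.1, hs.2.trans hr.2⟩ ω), travelTime_left, mul_zero,
        Real.cos_zero]
      have := (h.integrable.mono_set (show uIcc a r ⊆ uIcc a b by
        rw [uIcc_of_le hr.1.le, uIcc_of_le h.lt.le]; exact Icc_subset_Icc_right hr.2.le)).mul_continuousOn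
        (g := fun s => -ω * Real.sin (ω * travelTime a w s)) (by
          rw [uIcc_of_le hr.1.le]
          exact (continuousOn_const.mul (h.continuousOn_sin ω)).mono (Icc_subset_Icc_right hr.2.le))
      refine this.congr (fun s _ => ?_)
      ring
    rw [← hFTC]
    refine intervalIntegral.tendsto_integral_filter_of_dominated_convergence
      (fun s => |ω| * (1 / w s)) (Eventually.of_forall fun n => ?_)
      (Eventually.of_forall fun n => Eventually.of_forall fun s hs => ?_) hI
      (Eventually.of_forall fun s hs => ?_)
    · rw [uIoc_of_le hr.1.le]
      exact ((hfc n).mono (Ioc_subset_Icc_self.trans (Icc_subset_Icc_right hr.2.le))).aestronglyMeasurable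
        measurableSet_Ioc
    · rw [uIoc_of_le hr.1.le] at hs
      exact hbound' n s ⟨hs.1, hs.2.trans_lt hr.2⟩
    · rw [uIoc_of_le hr.1.le] at hs
      exact hlim s ⟨hs.1, hs.2.trans_lt hr.2⟩
  have hprimb : ∀ n, ∀ r ∈ Ioo a b, ‖∫ s in a..r, f n s‖ ≤ |ω| * travelTime a w b := by
    intro n r hr
    have hI : IntervalIntegrable (fun s => |ω| * (1 / w s)) volume a r :=
      (h.integrable.mono_set (by
        rw [uIcc_of_le hr.1.le, uIcc_of_le h.lt.le]; exact Icc_subset_Icc_right hr.2.le)).const_mul _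
    refine (intervalIntegral.norm_integral_le_of_norm_le hr.1.le
      (Eventually.of_forall fun s hs => hbound' n s ⟨hs.1, hs.2.trans_lt hr.2⟩) hI).trans ?_
    rw [intervalIntegral.integral_const_mul]
    gcongr
    exact (h.travelTime_mem_Icc (Ioo_subset_Icc_self hr)).2
  have hconv : Tendsto (fun n => ∫ r in Ioo a b, (g r * f n r + m r / w r * ∫ s in a..r, f n s)) atTop
      (𝓝 (∫ r in Ioo a b, (g r * (-ω * Real.sin (ω * travelTime a w r) / w r) +
        m r / w r * (Real.cos (ω * travelTime a w r) - 1)))) := by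
    refine tendsto_integral_of_dominated_convergence
      (fun r => |ω| * ‖g r / w r‖ + ‖m r / w r‖ * (|ω| * travelTime a w b)) (fun n => ?_) ?_
      (fun n => ?_) ?_
    · have hp : ContinuousOn (fun r => ∫ s in a..r, f n s) (Icc a b) := by
        have := intervalIntegral.continuousOn_primitive_interval (μ := volume) (f := f n) (a := a)
          (b := b) (by rw [uIcc_of_le h.lt.le]; exact (hfc n).integrableOn_Icc)
        rwa [uIcc_of_le h.lt.le] at this
      exact ((integrableOn_mul hgi (hfc n)).add (integrableOn_mul hm hp)).aestronglyMeasurable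
    · exact (hg.norm.const_mul _).add (hm.norm.mul_const _)
    · refine (ae_restrict_iff' measurableSet_Ioo).2 (Eventually.of_forall fun r hr => ?_)
      refine (norm_add_le _ _).trans (add_le_add ?_ ?_)
      · rw [norm_mul, norm_div (g r), Real.norm_of_nonneg (h.pos r hr).le]
        calc ‖g r‖ * ‖f n r‖ ≤ ‖g r‖ * (|ω| * (1 / w r)) := by
              gcongr
              exact hbound' n r hr
          _ = _ := by ring
      · rw [norm_mul]
        gcongr
        exact hprimb n r hr
    · refine (ae_restrict_iff' measurableSet_Ioo).2 (Eventually.of_forall fun r hr => ?_)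
      exact ((hlim r hr).const_mul _).add ((hprim r hr).const_mul _)
  simp_rw [h0] at hconv
  have key := tendsto_nhds_unique hconv tendsto_const_nhds
  have i1 : IntegrableOn (fun r => g r / w r * Real.sin (ω * travelTime a w r)) (Ioo a b) :=
    integrableOn_mul hg (h.continuousOn_sin ω)
  have i2 : IntegrableOn (fun r => m r / w r * Real.cos (ω * travelTime a w r)) (Ioo a b) :=
    integrableOn_mul hm (h.continuousOn_cos ω)
  have e : ∀ r, g r * (-ω * Real.sin (ω * travelTime a w r) / w r) +
      m r / w r * (Real.cos (ω * travelTime a w r) - 1) =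
      m r / w r * Real.cos (ω * travelTime a w r) -
        ω * (g r / w r * Real.sin (ω * travelTime a w r)) - m r / w r := by
    intro r
    ring
  simp_rw [e] at key
  have i3 : IntegrableOn (fun r => m r / w r * Real.cos (ω * travelTime a w r) -
      ω * (g r / w r * Real.sin (ω * travelTime a w r))) (Ioo a b) := i2.sub (i1.const_mul _)
  rw [integral_sub i3 hm, integral_sub i2 (i1.const_mul _),
    integral_const_mul, hm0] at key
  linarith

/-- Now the tests have the form w(r)p(r), so sin(ωt) calls for p = sin(ωt)/w, whose derivative is
singular where w = 0. Composing the sine with `cutIdentity ε` makes it vanish near its zeros, which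
by `hsin` include both turning points; then p is C¹ and ε → 0 finishes the argument. -/
theorem integral_sin_of_tests {g m : ℝ → ℝ} (hg : IntegrableOn (fun r => g r / w r) (Ioo a b))
    (hm : IntegrableOn (fun r => m r / w r) (Ioo a b))
    (ht : ∀ n : ℕ, ∫ r in Ioo a b, (g r * w r * (n * r ^ (n - 1)) +
      (g r * (-F r / w r) + m r) * r ^ n) = 0) {ω : ℝ} (hω : 0 ≤ ω)
    (hsin : Real.sin (ω * travelTime a w b) = 0) :
    ∫ r in Ioo a b, m r / w r * Real.sin (ω * travelTime a w r) =
      -(ω * ∫ r in Ioo a b, g r / w r * Real.cos (ω * travelTime a w r)) := by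
  -- For ω = 0 the sine vanishes identically and the cut-off derivatives would not converge to 1.
  rcases hω.eq_or_lt with rfl | hω
  · simp
  have hgi := h.integrableOn_of_div hg
  have hmi := h.integrableOn_of_div hm
  have hA : IntegrableOn (fun r => g r * w r) (Ioo a b) := integrableOn_mul hgi h.continuousOn
  have hB : IntegrableOn (fun r => g r * (-F r / w r) + m r) (Ioo a b) := by
    refine Integrable.add ?_ hmi
    refine (integrableOn_mul hg h.continuousOn_force.neg).congr_fun (fun r _ => ?_) measurableSet_Ioo
    change g r / w r * (-F r) = _
    ring
  set s : ℝ → ℝ := fun r => Real.sin (ω * travelTime a w r) with hs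
  have hsc : ContinuousOn s (Icc a b) := h.continuousOn_sin ω
  have hcc := h.continuousOn_cos ω
  have hcut : ∀ ε : ℝ, 0 < ε → ∫ r in Ioo a b, (ω * (g r / w r * Real.cos (ω * travelTime a w r) *
      cutDeriv ε (s r)) + m r / w r * cutIdentity ε (s r)) = 0 := by
    intro ε hε
    set f : ℝ → ℝ := fun r => cutDeriv ε (s r) * (ω * Real.cos (ω * travelTime a w r) / w r) / w r -
      cutIdentity ε (s r) * (-F r / w r) / w r ^ 2 with hf
    have hder : ∀ r ∈ Ioo a b, HasDerivAt (fun r => cutIdentity ε (s r) / w r) (f r) r := by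
      intro r hr
      have h1 := (hasDerivAt_cutIdentity ε (s r)).comp r (h.hasDerivAt_sin hr ω)
      refine (h1.div (h.hasDerivAt r hr) (h.pos r hr).ne').congr_deriv ?_
      change (cutDeriv ε (s r) * (ω * Real.cos (ω * travelTime a w r) / w r) * w r -
        cutIdentity ε (s r) * (-F r / w r)) / w r ^ 2 = _
      have := (h.pos r hr).ne'
      simp only [hf]
      field_simp
    -- Where the cut-off is active, r is not a turning point: s vanishes at a because the travel
    -- time starts at 0, and at b by `hsin`.
    have hfar : ∀ r ∈ Icc a b, ε ≤ |s r| → r ∈ Ioo a b := by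
      intro r hr hrs
      refine ⟨lt_of_le_of_ne hr.1 ?_, lt_of_le_of_ne hr.2 ?_⟩
      · rintro rfl
        simp only [hs, travelTime_left, mul_zero, Real.sin_zero, abs_zero] at hrs
        linarith
      · rintro rfl
        simp only [hs, hsin, abs_zero] at hrs
        linarith
    have hnear : ∀ r ∈ Icc a b, |s r| < ε → ∀ᶠ x in 𝓝[Icc a b] r, |s x| < ε := by
      intro r hr hrs
      exact ((hsc r hr).abs).eventually_lt_const hrs
    have hfc : ContinuousOn f (Icc a b) := by
      intro r hr
      rcases lt_or_ge |s r| ε with hlt | hge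
      · have hz : ∀ x, |s x| < ε → f x = 0 := by
          intro x hx
          simp only [hf]
          rw [cutDeriv_eq_zero hε hx.le, cutIdentity_eq_zero hε hx.le]
          simp
        refine (continuousWithinAt_const (b := (0 : ℝ))).congr_of_eventuallyEq ?_ (hz r hlt)
        filter_upwards [hnear r hr hlt] with x hx using hz x hx
      · have hr' := hfar r hr hge
        have hw := (h.pos r hr').ne'
        have c1 : ContinuousWithinAt w (Icc a b) r := h.continuousOn r hr
        have c2 : ContinuousWithinAt (fun r => cutDeriv ε (s r)) (Icc a b) r :=
          (continuous_cutDeriv ε).continuousAt.comp_continuousWithinAt (hsc r hr)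
        have c3 : ContinuousWithinAt (fun r => cutIdentity ε (s r)) (Icc a b) r :=
          (hasDerivAt_cutIdentity ε (s r)).continuousAt.comp_continuousWithinAt (hsc r hr)
        exact ((c2.mul ((continuousWithinAt_const.mul (hcc r hr)).div c1 hw)).div c1 hw).sub
          ((c3.mul (((h.continuousOn_force r hr).neg).div c1 hw)).div (c1.pow 2) (pow_ne_zero 2 hw))
    have hpc : ContinuousOn (fun r => cutIdentity ε (s r) / w r) (Icc a b) := by
      intro r hr
      rcases lt_or_ge |s r| ε with hlt | hge
      · have hz : ∀ x, |s x| < ε → cutIdentity ε (s x) / w x = 0 := by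
          intro x hx
          rw [cutIdentity_eq_zero hε hx.le, zero_div]
        refine (continuousWithinAt_const (b := (0 : ℝ))).congr_of_eventuallyEq ?_ (hz r hlt)
        filter_upwards [hnear r hr hlt] with x hx using hz x hx
      · exact (hder r (hfar r hr hge)).continuousAt.continuousWithinAt
    have key := integral_mul_add_mul_primitive_eq_zero h.lt hA hB ht hfc
    rw [← key]
    refine setIntegral_congr_fun measurableSet_Ioo fun r hr => ?_
    have hprim : ∫ x in a..r, f x = cutIdentity ε (s r) / w r := by
      rw [intervalIntegral.integral_eq_sub_of_hasDerivAt_of_le hr.1.le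
        (hpc.mono (Icc_subset_Icc_right hr.2.le)) (fun x hx => hder x ⟨hx.1, hx.2.trans hr.2⟩)]
      -- The value at a is a quotient by w a = 0, hence 0 by convention; this agrees with the
      -- vanishing of the cut-off near a.
      · rw [h.left, div_zero, sub_zero]
      · refine ContinuousOn.intervalIntegrable ?_
        rw [uIcc_of_le hr.1.le]
        exact hfc.mono (Icc_subset_Icc_right hr.2.le)
    rw [hprim]
    simp only [hf]
    have hw := (h.pos r hr).ne'
    field_simp
    ring
  have i1 : IntegrableOn (fun r => g r / w r * Real.cos (ω * travelTime a w r)) (Ioo a b) :=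
    integrableOn_mul hg hcc
  have i2 : IntegrableOn (fun r => m r / w r * s r) (Ioo a b) := integrableOn_mul hm hsc
  -- The zeros of s are the points where the injective function ωt takes a value in πℤ, so they are
  -- countable; elsewhere the cut-off derivatives tend to 1.
  have hs0 : ∀ᵐ r, r ∈ Ioo a b → s r ≠ 0 := by
    have hcount : {r | r ∈ Ioo a b ∧ s r = 0}.Countable := by
      have hr : (range fun n : ℤ => (n : ℝ) * Real.pi).Countable := countable_range _
      refine MapsTo.countable_of_injOn (f := fun r => ω * travelTime a w r) ?_ ?_ hr
      · rintro r ⟨_, h0⟩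
        obtain ⟨n, hn⟩ := Real.sin_eq_zero_iff.1 h0
        exact ⟨n, hn⟩
      · rintro r ⟨hr, _⟩ r' ⟨hr', _⟩ he
        exact h.strictMonoOn_travelTime.injOn (Ioo_subset_Icc_self hr) (Ioo_subset_Icc_self hr')
          (mul_left_cancel₀ hω.ne' he)
    have := hcount.measure_zero volume
    rw [measure_eq_zero_iff_ae_notMem] at this
    filter_upwards [this] with r hr hr' h0 using hr ⟨hr', h0⟩
  have hconv : Tendsto (fun n : ℕ => ∫ r in Ioo a b, (ω * (g r / w r *
      Real.cos (ω * travelTime a w r) * cutDeriv (1 / ((n : ℝ) + 1)) (s r)) +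
        m r / w r * cutIdentity (1 / ((n : ℝ) + 1)) (s r))) atTop
      (𝓝 (∫ r in Ioo a b, (ω * (g r / w r * Real.cos (ω * travelTime a w r) * 1) +
        m r / w r * s r))) := by
    refine tendsto_integral_of_dominated_convergence
      (fun r => ω * ‖g r / w r * Real.cos (ω * travelTime a w r)‖ + ‖m r / w r * s r‖)
      (fun n => ?_) ?_ (fun n => ?_) ?_
    · have c2 : ContinuousOn (fun r => cutDeriv (1 / ((n : ℝ) + 1)) (s r)) (Icc a b) :=
        (continuous_cutDeriv _).comp_continuousOn hsc
      have c3 : ContinuousOn (fun r => cutIdentity (1 / ((n : ℝ) + 1)) (s r)) (Icc a b) :=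
        (continuous_iff_continuousAt.2 fun y =>
          (hasDerivAt_cutIdentity (1 / ((n : ℝ) + 1)) y).continuousAt).comp_continuousOn hsc
      exact (((integrableOn_mul i1 c2).const_mul ω).add
        (integrableOn_mul hm c3)).aestronglyMeasurable
    · exact (i1.norm.const_mul _).add i2.norm
    · refine Eventually.of_forall fun r => (norm_add_le _ _).trans (add_le_add ?_ ?_)
      · rw [norm_mul, norm_mul _ (cutDeriv _ _), Real.norm_of_nonneg hω.le,
          Real.norm_of_nonneg (cutDeriv_nonneg _ _)]
        gcongr
        exact mul_le_of_le_one_right (norm_nonneg _) (cutDeriv_le_one _ _)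
      · rw [norm_mul, norm_mul]
        gcongr
        exact abs_cutIdentity_le _ _
    · refine (ae_restrict_iff' measurableSet_Ioo).2 ?_
      filter_upwards [hs0] with r hr hr'
      exact (((tendsto_cutDeriv (hr hr')).const_mul _).const_mul _).add
        ((tendsto_cutIdentity (s r)).const_mul _)
  have hz : ∀ n : ℕ, ∫ r in Ioo a b, (ω * (g r / w r *
      Real.cos (ω * travelTime a w r) * cutDeriv (1 / ((n : ℝ) + 1)) (s r)) +
        m r / w r * cutIdentity (1 / ((n : ℝ) + 1)) (s r)) = 0 := fun n => hcut _ (by positivity)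
  simp_rw [hz] at hconv
  have key := tendsto_nhds_unique hconv tendsto_const_nhds
  simp_rw [mul_one] at key
  rw [integral_add (i1.const_mul _) i2, integral_const_mul] at key
  linarith

/-- Functions which satisfy the transport equation weakly against monomials satisfy it in terms of
Fourier coefficients. -/
theorem orbitCoeff_of_tests {gp gm mp mm : ℝ → ℝ}
    (hgp : IntegrableOn (fun r => gp r / w r) (Ioo a b))
    (hgm : IntegrableOn (fun r => gm r / w r) (Ioo a b))
    (hmp : IntegrableOn (fun r => mp r / w r) (Ioo a b))
    (hmm : IntegrableOn (fun r => mm r / w r) (Ioo a b))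
    (he : ∀ n : ℕ, ∫ r in Ioo a b, ((gp r - gm r) * (n * r ^ (n - 1)) +
      (mp r + mm r) / w r * r ^ n) = 0)
    (ho : ∀ n : ℕ, ∫ r in Ioo a b, ((gp r + gm r) * w r * (n * r ^ (n - 1)) +
      ((gp r + gm r) * (-F r / w r) + (mp r - mm r)) * r ^ n) = 0) (k : ℤ) :
    orbitCoeff a b w k mp mm =
      2 * Real.pi * k / (2 * travelTime a w b) * orbitCoeff a b w (-k) gp gm := by
  have hP := h.halfPeriod_pos
  have hadd : ∀ {f g : ℝ → ℝ}, IntegrableOn (fun r => f r / w r) (Ioo a b) →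
      IntegrableOn (fun r => g r / w r) (Ioo a b) →
      IntegrableOn (fun r => (f r + g r) / w r) (Ioo a b) := by
    intro f g hf hg
    simp_rw [add_div]
    exact hf.add hg
  have hsub : ∀ {f g : ℝ → ℝ}, IntegrableOn (fun r => f r / w r) (Ioo a b) →
      IntegrableOn (fun r => g r / w r) (Ioo a b) →
      IntegrableOn (fun r => (f r - g r) / w r) (Ioo a b) := by
    intro f g hf hg
    simp_rw [sub_div]
    exact hf.sub hg
  refine h.orbitCoeff_eq (fun n => ?_) (fun n => ?_) k
  · exact h.integral_cos_of_tests (hsub hgp hgm) (hadd hmp hmm) he _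
  · refine h.integral_sin_of_tests (hadd hgp hgm) (hsub hmp hmm) ho (by positivity) ?_
    rw [div_mul_cancel₀ _ hP.ne', mul_comm, Real.sin_nat_mul_pi]

/-- Continuously differentiable functions on an orbit: Fourier coefficients of the derivative. -/
theorem orbitCoeff_of_hasDerivAt {xp xm dp dm : ℝ → ℝ}
    (hxp : ContinuousOn xp (Icc a b)) (hxm : ContinuousOn xm (Icc a b))
    (hdp : ContinuousOn dp (Icc a b)) (hdm : ContinuousOn dm (Icc a b))
    (hp : ∀ r ∈ Ioo a b, HasDerivAt xp (dp r / w r) r)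
    (hm : ∀ r ∈ Ioo a b, HasDerivAt xm (-dm r / w r) r) (ha : xp a = xm a) (hb : xp b = xm b)
    (k : ℤ) : orbitCoeff a b w k dp dm =
      2 * Real.pi * k / (2 * travelTime a w b) * orbitCoeff a b w (-k) xp xm := by
  have hP := h.halfPeriod_pos
  have hint : ∀ {f g : ℝ → ℝ}, ContinuousOn f (Icc a b) → ContinuousOn g (Icc a b) →
      IntegrableOn (fun r => f r / w r * g r) (Ioo a b) := by
    intro f g hf hg
    refine integrableOn_mul ?_ hg
    refine (integrableOn_mul h.integrableOn_inv hf).congr_fun (fun r _ => ?_) measurableSet_Ioo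
    ring
  have hFTC : ∀ {G G' : ℝ → ℝ}, ContinuousOn G (Icc a b) → (∀ r ∈ Ioo a b, HasDerivAt G (G' r) r) →
      IntegrableOn G' (Ioo a b) → G a = 0 → G b = 0 → ∫ r in Ioo a b, G' r = 0 := by
    intro G G' hG hG' hi h0 h1
    rw [← integral_Ioc_eq_integral_Ioo, ← intervalIntegral.integral_of_le h.lt.le,
      intervalIntegral.integral_eq_sub_of_hasDerivAt_of_le h.lt.le hG hG'
        ((intervalIntegrable_iff_integrableOn_Ioo_of_le h.lt.le).2 hi), h0, h1, sub_zero]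
  refine h.orbitCoeff_eq (fun n => ?_) (fun n => ?_) k
  -- Boundary terms: for the cosine family xp - xm vanishes at both turning points because the
  -- branches meet there; for the sine family below, the sine itself vanishes.
  · set ω := Real.pi * n / travelTime a w b
    have i1 := hint (f := fun r => dp r + dm r) (hdp.add hdm) (h.continuousOn_cos ω)
    have i2 := hint (f := fun r => xp r - xm r) (hxp.sub hxm) (h.continuousOn_sin ω)
    have := hFTC (G := fun r => (xp r - xm r) * Real.cos (ω * travelTime a w r))
      (G' := fun r => (dp r + dm r) / w r * Real.cos (ω * travelTime a w r) -
        ω * ((xp r - xm r) / w r * Real.sin (ω * travelTime a w r)))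
      ((hxp.sub hxm).mul (h.continuousOn_cos ω)) (fun r hr => by
        refine (((hp r hr).sub (hm r hr)).mul (h.hasDerivAt_cos hr ω)).congr_deriv ?_
        change (dp r / w r - -dm r / w r) * _ + (xp r - xm r) * _ = _
        ring) (i1.sub (i2.const_mul ω)) (by simp [ha]) (by simp [hb])
    rw [integral_sub i1 (i2.const_mul ω), integral_const_mul] at this
    linarith
  · set ω := Real.pi * n / travelTime a w b with hω
    have i1 := hint (f := fun r => dp r - dm r) (hdp.sub hdm) (h.continuousOn_sin ω)
    have i2 := hint (f := fun r => xp r + xm r) (hxp.add hxm) (h.continuousOn_cos ω)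
    have := hFTC (G := fun r => (xp r + xm r) * Real.sin (ω * travelTime a w r))
      (G' := fun r => (dp r - dm r) / w r * Real.sin (ω * travelTime a w r) +
        ω * ((xp r + xm r) / w r * Real.cos (ω * travelTime a w r)))
      ((hxp.add hxm).mul (h.continuousOn_sin ω)) (fun r hr => by
        refine (((hp r hr).add (hm r hr)).mul (h.hasDerivAt_sin hr ω)).congr_deriv ?_
        change (dp r / w r + -dm r / w r) * _ + (xp r + xm r) * _ = _
        ring) (i1.add (i2.const_mul ω)) (by simp [travelTime_left]) (by
          rw [hω, div_mul_cancel₀ _ hP.ne', mul_comm Real.pi, Real.sin_nat_mul_pi, mul_zero])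
    rw [integral_add i1 (i2.const_mul ω), integral_const_mul] at this
    linarith

end IsOrbit

end Orbit

namespace RadialSteadyState

open Set

variable (S : RadialSteadyState)

/-! ### The equation of state -/

/-- The set of energy-angular momentum pairs with positive phase-space density. -/
def posSet : Set (ℝ × ℝ) := {y | 0 < S.φ y.1 y.2}

theorem posPow_nonneg (t k : ℝ) : 0 ≤ posPow t k := by
  unfold posPow
  split_ifs with h
  · exact Real.rpow_nonneg h.le _
  · exact le_rfl

theorem posPow_pos_iff {t k : ℝ} : 0 < posPow t k ↔ 0 < t := by
  unfold posPow
  split_ifs with h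
  · exact ⟨fun _ => h, fun _ => Real.rpow_pos_of_pos h _⟩
  · simpa using h

theorem hasDerivAt_posPow_sub {E₀ E k : ℝ} (h : E < E₀) :
    HasDerivAt (fun e => posPow (E₀ - e) k) (-(k * (E₀ - E) ^ (k - 1))) E := by
  have h0 : 0 < E₀ - E := sub_pos.2 h
  have h1 := ((hasDerivAt_id E).const_sub E₀).rpow_const (p := k) (Or.inl h0.ne')
  have h2 : (fun e => posPow (E₀ - e) k) =ᶠ[𝓝 E] fun e => (E₀ - id e) ^ k := by
    filter_upwards [eventually_lt_nhds h] with e he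
    simp [posPow, sub_pos.2 he]
  refine (h1.congr_of_eventuallyEq h2).congr_deriv ?_
  simp

/-- The properties of the equation of state which are used in the spectral analysis. -/
structure IsAdmissible (φ : ℝ → ℝ → ℝ) : Prop where
  nonneg : ∀ E L, 0 ≤ φ E L
  isOpen : IsOpen {y : ℝ × ℝ | 0 < φ y.1 y.2}
  cutoff : ∃ E₀ < 0, ∀ E L, 0 < φ E L → E < E₀
  deriv_ne : ∀ E L, 0 < φ E L → deriv (fun e => φ e L) E ≠ 0
  continuousOn : ContinuousOn (fun y : ℝ × ℝ => deriv (fun e => φ e y.2) y.1) {y | 0 < φ y.1 y.2}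

theorem _root_.VlasovPoisson.IsAnsatz.isAdmissible {φ : ℝ → ℝ → ℝ} (h : IsAnsatz φ) :
    IsAdmissible φ := by
  cases h with
  | polytropeShell E₀ L₀ k l hE₀ hL₀ hk hl hkl hkl' =>
    have hpos : ∀ E L, 0 < posPow (E₀ - E) k * posPow (L - L₀) l ↔ E < E₀ ∧ L₀ < L := by
      intro E L
      constructor
      · intro h
        have h1 := pos_of_mul_pos_left h (posPow_nonneg _ _)
        have h2 := pos_of_mul_pos_right h (posPow_nonneg _ _)
        exact ⟨sub_pos.1 (posPow_pos_iff.1 h1), sub_pos.1 (posPow_pos_iff.1 h2)⟩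
      · rintro ⟨h1, h2⟩
        exact mul_pos (posPow_pos_iff.2 (sub_pos.2 h1)) (posPow_pos_iff.2 (sub_pos.2 h2))
    have hder : ∀ E L, E < E₀ → L₀ < L → deriv (fun e => posPow (E₀ - e) k * posPow (L - L₀) l) E =
        -(k * (E₀ - E) ^ (k - 1)) * (L - L₀) ^ l := by
      intro E L hE hL
      rw [((hasDerivAt_posPow_sub hE).mul_const _).deriv, posPow, if_pos (sub_pos.2 hL)]
    have hset : {y : ℝ × ℝ | 0 < posPow (E₀ - y.1) k * posPow (y.2 - L₀) l} =
        {y | y.1 < E₀} ∩ {y | L₀ < y.2} := by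
      ext y
      exact hpos y.1 y.2
    refine ⟨fun E L => mul_nonneg (posPow_nonneg _ _) (posPow_nonneg _ _), ?_,
      ⟨E₀, hE₀, fun E L h => ((hpos E L).1 h).1⟩, fun E L h => ?_, ?_⟩
    · rw [hset]
      exact (isOpen_lt continuous_fst continuous_const).inter
        (isOpen_lt continuous_const continuous_snd)
    · obtain ⟨h1, h2⟩ := (hpos E L).1 h
      rw [hder E L h1 h2]
      have e1 := Real.rpow_pos_of_pos (sub_pos.2 h1) (k - 1)
      have e2 := Real.rpow_pos_of_pos (sub_pos.2 h2) l
      exact mul_ne_zero (neg_ne_zero.2 (mul_pos hk e1).ne') e2.ne'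
    · rw [hset]
      have : ContinuousOn (fun y : ℝ × ℝ => -(k * (E₀ - y.1) ^ (k - 1)) * (y.2 - L₀) ^ l)
          ({y | y.1 < E₀} ∩ {y | L₀ < y.2}) := by
        refine ContinuousOn.mul (ContinuousOn.neg (continuousOn_const.mul ?_)) ?_
        · exact ContinuousOn.rpow_const (by fun_prop) fun y hy => Or.inl (sub_pos.2 hy.1).ne'
        · exact ContinuousOn.rpow_const (by fun_prop) fun y hy => Or.inl (sub_pos.2 hy.2).ne'
      exact this.congr fun y hy => hder y.1 y.2 hy.1 hy.2
  | polytropeIsotropic E₀ k hE₀ hk hk' =>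
    have hpos : ∀ E, 0 < posPow (E₀ - E) k ↔ E < E₀ := fun E => posPow_pos_iff.trans sub_pos
    have hset : {y : ℝ × ℝ | 0 < posPow (E₀ - y.1) k} = {y | y.1 < E₀} := by
      ext y
      exact hpos y.1
    refine ⟨fun E L => posPow_nonneg _ _, ?_, ⟨E₀, hE₀, fun E L h => (hpos E).1 h⟩,
      fun E L h => ?_, ?_⟩
    · rw [hset]
      exact isOpen_lt continuous_fst continuous_const
    · have h1 := (hpos E).1 h
      rw [(hasDerivAt_posPow_sub h1).deriv]
      exact neg_ne_zero.2 (mul_pos hk (Real.rpow_pos_of_pos (sub_pos.2 h1) _)).ne'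
    · rw [hset]
      have : ContinuousOn (fun y : ℝ × ℝ => -(k * (E₀ - y.1) ^ (k - 1))) {y | y.1 < E₀} := by
        refine ContinuousOn.neg (continuousOn_const.mul ?_)
        exact ContinuousOn.rpow_const (by fun_prop) fun y hy => Or.inl (sub_pos.2 hy).ne'
      exact this.congr fun y hy => (hasDerivAt_posPow_sub hy).deriv
  | king E₀ hE₀ =>
    have hpos : ∀ E, 0 < max (Real.exp (E₀ - E) - 1) 0 ↔ E < E₀ := by
      intro E
      rw [lt_max_iff, or_iff_left (lt_irrefl _), sub_pos, Real.one_lt_exp_iff, sub_pos]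
    have hder : ∀ E, E < E₀ → HasDerivAt (fun e => max (Real.exp (E₀ - e) - 1) 0)
        (-Real.exp (E₀ - E)) E := by
      intro E hE
      have h1 := (((hasDerivAt_id E).const_sub E₀).exp).sub_const 1
      have h2 : (fun e => max (Real.exp (E₀ - e) - 1) 0) =ᶠ[𝓝 E] fun e => Real.exp (E₀ - id e) - 1 := by
        filter_upwards [eventually_lt_nhds hE] with e he
        refine max_eq_left (sub_nonneg.2 (Real.one_le_exp ?_))
        exact (sub_pos.2 he).le
      refine (h1.congr_of_eventuallyEq h2).congr_deriv ?_
      simp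
    have hset : {y : ℝ × ℝ | 0 < max (Real.exp (E₀ - y.1) - 1) 0} = {y | y.1 < E₀} := by
      ext y
      exact hpos y.1
    refine ⟨fun E L => le_max_right _ _, ?_, ⟨E₀, hE₀, fun E L h => (hpos E).1 h⟩,
      fun E L h => ?_, ?_⟩
    · rw [hset]
      exact isOpen_lt continuous_fst continuous_const
    · rw [(hder E ((hpos E).1 h)).deriv]
      exact neg_ne_zero.2 (Real.exp_pos _).ne'
    · rw [hset]
      have : ContinuousOn (fun y : ℝ × ℝ => -Real.exp (E₀ - y.1)) {y | y.1 < E₀} := by fun_prop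
      exact this.congr fun y hy => (hder y.1 hy).deriv

theorem isAdmissible : IsAdmissible S.φ := S.ansatz.isAdmissible

theorem isOpen_posSet : IsOpen S.posSet := S.isAdmissible.isOpen

/-! ### The potential as a function of the radius -/

/-- The potential as a function of the radius. -/
def u (r : ℝ) : ℝ := S.U (EuclideanSpace.single 0 r)

theorem U_eq (x : Space) : S.U x = S.u ‖x‖ := S.radial_U _ _ (by simp)

theorem contDiff_u : ContDiff ℝ 2 S.u := by
  have : S.u = S.U ∘ fun r : ℝ => r • (EuclideanSpace.single (0 : Fin 3) (1 : ℝ)) := by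
    funext r
    refine congrArg S.U ?_
    ext i
    simp
  rw [this]
  exact S.contDiff_U.comp (contDiff_id.smul contDiff_const)

theorem differentiable_u : Differentiable ℝ S.u := S.contDiff_u.differentiable (by norm_num)

theorem contDiff_deriv_u : ContDiff ℝ 1 (deriv S.u) :=
  ((contDiff_succ_iff_deriv (n := 1)).1 S.contDiff_u).2.2

theorem differentiable_deriv_u : Differentiable ℝ (deriv S.u) :=
  S.contDiff_deriv_u.differentiable (by norm_num)

theorem hasDerivAt_u (r : ℝ) : HasDerivAt S.u (deriv S.u r) r := (S.differentiable_u r).hasDerivAt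

theorem continuous_u : Continuous S.u := S.differentiable_u.continuous

theorem continuous_deriv_u : Continuous (deriv S.u) := S.differentiable_deriv_u.continuous

theorem _root_.VlasovPoisson.hasFDerivAt_norm_of_ne {x : Space} (hx : x ≠ 0) :
    HasFDerivAt (fun y : Space => ‖y‖) (‖x‖⁻¹ • innerSL ℝ x) x := by
  have h1 := (hasStrictFDerivAt_norm_sq x).hasFDerivAt.sqrt (by positivity)
  have h2 : (fun y : Space => √(‖y‖ ^ 2)) = fun y => ‖y‖ := by
    funext y
    exact Real.sqrt_sq (norm_nonneg y)
  rw [h2, Real.sqrt_sq (norm_nonneg x)] at h1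
  refine h1.congr_fderiv ?_
  ext v
  have : ‖x‖ ≠ 0 := norm_ne_zero_iff.2 hx
  simp
  field_simp

theorem hasFDerivAt_U {x : Space} (hx : x ≠ 0) :
    HasFDerivAt S.U ((deriv S.u ‖x‖ / ‖x‖) • innerSL ℝ x) x := by
  have h := (S.hasDerivAt_u ‖x‖).comp_hasFDerivAt x (hasFDerivAt_norm_of_ne hx)
  have hU : S.U = S.u ∘ fun y : Space => ‖y‖ := funext S.U_eq
  rw [hU]
  refine h.congr_fderiv ?_
  rw [smul_smul, div_eq_mul_inv]

theorem gradient_U {x : Space} (hx : x ≠ 0) : gradient S.U x = (deriv S.u ‖x‖ / ‖x‖) • x := by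
  rw [gradient, (S.hasFDerivAt_U hx).fderiv, map_smul]
  congr 1
  exact (InnerProductSpace.toDual ℝ Space).symm_apply_apply x

theorem laplacian_U {x : Space} (hx : x ≠ 0) :
    Δ S.U x = deriv (deriv S.u) ‖x‖ + 2 * deriv S.u ‖x‖ / ‖x‖ := by
  have hn : ‖x‖ ≠ 0 := norm_ne_zero_iff.2 hx
  set q : ℝ → ℝ := fun r => deriv S.u r / r with hq
  have hq' : HasDerivAt q ((deriv (deriv S.u) ‖x‖ * ‖x‖ - deriv S.u ‖x‖ * 1) / ‖x‖ ^ 2) ‖x‖ :=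
    ((S.differentiable_deriv_u ‖x‖).hasDerivAt).div (hasDerivAt_id _) hn
  obtain ⟨J, hJ⟩ : ∃ J : Space →L[ℝ] Space →L[ℝ] ℝ, ∀ x, J x = innerSL ℝ x := ⟨innerSL ℝ, fun _ => rfl⟩
  have h1 : HasFDerivAt (fun y : Space => q ‖y‖ • J y) (q ‖x‖ • J +
      (((deriv (deriv S.u) ‖x‖ * ‖x‖ - deriv S.u ‖x‖ * 1) / ‖x‖ ^ 2) •
        (‖x‖⁻¹ • innerSL ℝ x)).smulRight (J x)) x :=
    (hq'.comp_hasFDerivAt x (hasFDerivAt_norm_of_ne hx)).smul J.hasFDerivAt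
  have h2 : fderiv ℝ S.U =ᶠ[𝓝 x] fun y : Space => q ‖y‖ • J y := by
    filter_upwards [isOpen_ne.mem_nhds hx] with y hy
    rw [hJ]
    exact (S.hasFDerivAt_U hy).fderiv
  have h3 := (h1.congr_of_eventuallyEq h2).fderiv
  set b := EuclideanSpace.basisFun (Fin 3) ℝ with hb
  rw [InnerProductSpace.laplacian_eq_iteratedFDeriv_orthonormalBasis S.U b]
  simp only [iteratedFDeriv_two_apply, h3]
  have hsum : ∑ i, inner ℝ x (b i) ^ 2 = ‖x‖ ^ 2 := by
    have := b.sum_sq_norm_inner_left x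
    simpa using this
  have hterm : ∀ i, ((q ‖x‖ • J + (((deriv (deriv S.u) ‖x‖ * ‖x‖ - deriv S.u ‖x‖ * 1) / ‖x‖ ^ 2) •
        (‖x‖⁻¹ • innerSL ℝ x)).smulRight (J x)) (b i)) (b i) =
      q ‖x‖ + (deriv (deriv S.u) ‖x‖ * ‖x‖ - deriv S.u ‖x‖) / ‖x‖ ^ 3 * inner ℝ x (b i) ^ 2 := by
    intro i
    have hbi : inner ℝ (b i) (b i) = (1 : ℝ) := by
      rw [real_inner_self_eq_norm_sq, b.norm_eq_one, one_pow]
    simp only [_root_.add_apply, _root_.smul_apply, hJ,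
      ContinuousLinearMap.smulRight_apply, innerSL_apply_apply, smul_eq_mul, hbi]
    field_simp
  have key : ∑ i, ((q ‖x‖ • J + (((deriv (deriv S.u) ‖x‖ * ‖x‖ - deriv S.u ‖x‖ * 1) / ‖x‖ ^ 2) •
        (‖x‖⁻¹ • innerSL ℝ x)).smulRight (J x)) (b i)) (b i) =
      deriv (deriv S.u) ‖x‖ + 2 * deriv S.u ‖x‖ / ‖x‖ := by
    simp_rw [hterm]
    rw [Finset.sum_add_distrib, ← Finset.mul_sum, hsum]
    simp [hq]
    field_simp
    ring
  exact key

/-! ### The mass function -/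

/-- `r² u'(r)`, the mass inside the ball of radius `r`. -/
def mass (r : ℝ) : ℝ := r ^ 2 * deriv S.u r

theorem mass_zero : S.mass 0 = 0 := by simp [mass]

/-- (r² u')' = r² ΔU, which is nonnegative by the Poisson equation because φ ≥ 0. -/
theorem monotoneOn_mass : MonotoneOn S.mass (Ici 0) := by
  have hd : ∀ r, HasDerivAt S.mass (2 * r * deriv S.u r + r ^ 2 * deriv (deriv S.u) r) r := by
    intro r
    have := ((hasDerivAt_id r).pow 2).mul (S.differentiable_deriv_u r).hasDerivAt
    refine this.congr_deriv ?_
    simp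
  refine monotoneOn_of_deriv_nonneg (convex_Ici 0)
    (fun r _ => (hd r).continuousAt.continuousWithinAt)
    (fun r _ => (hd r).differentiableAt.differentiableWithinAt) fun r hr => ?_
  rw [interior_Ici] at hr
  have hr : 0 < r := hr
  have hx : (EuclideanSpace.single 0 r : Space) ≠ 0 := by
    simpa using hr.ne'
  have hnorm : ‖(EuclideanSpace.single 0 r : Space)‖ = r := by simp [abs_of_pos hr]
  have hlap := S.laplacian_U hx
  rw [hnorm, S.poisson] at hlap
  have hnn : 0 ≤ 4 * Real.pi * ∫ v : Space, S.φ (energy S.U (EuclideanSpace.single 0 r, v))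
      (angMom (EuclideanSpace.single 0 r, v)) :=
    mul_nonneg (by positivity) (integral_nonneg fun v => S.isAdmissible.nonneg _ _)
  rw [hlap] at hnn
  rw [(hd r).deriv]
  have : 2 * r * deriv S.u r + r ^ 2 * deriv (deriv S.u) r =
      r ^ 2 * (deriv (deriv S.u) r + 2 * deriv S.u r / r) := by
    field_simp
    ring
  rw [this]
  positivity

theorem mass_nonneg {r : ℝ} (hr : 0 ≤ r) : 0 ≤ S.mass r := by
  rw [← S.mass_zero]
  exact S.monotoneOn_mass self_mem_Ici hr hr

theorem tendsto_u : Tendsto S.u atTop (𝓝 0) := by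
  refine S.tendsto_U.comp ?_
  rw [← Metric.cobounded_eq_cocompact, ← tendsto_norm_atTop_iff_cobounded]
  simpa using tendsto_abs_atTop_atTop

theorem angMom_nonneg (p : Phase) : 0 ≤ angMom p := by
  simp only [angMom, dotProduct]
  exact Finset.sum_nonneg fun i _ => mul_self_nonneg _

/-- Without mass u would be constant, hence 0 by its limit at infinity. Then every energy is
nonnegative, while f₀ > 0 requires E < E₀ < 0. -/
theorem exists_mass_pos : ∃ r > 0, 0 < S.mass r := by
  by_contra! hcon
  have hder : ∀ r ∈ interior (Ici (0 : ℝ)), deriv S.u r = 0 := by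
    intro r hr
    rw [interior_Ici] at hr
    have hr : 0 < r := hr
    have h0 := le_antisymm (hcon r hr) (S.mass_nonneg hr.le)
    exact (mul_eq_zero.1 h0).resolve_left (by positivity)
  have hmono : MonotoneOn S.u (Ici 0) := monotoneOn_of_deriv_nonneg (convex_Ici 0)
    S.continuous_u.continuousOn (S.differentiable_u.differentiableOn) fun r hr => (hder r hr).ge
  have hanti : AntitoneOn S.u (Ici 0) := antitoneOn_of_deriv_nonpos (convex_Ici 0)
    S.continuous_u.continuousOn (S.differentiable_u.differentiableOn) fun r hr => (hder r hr).le
  have hconst : ∀ r ≥ 0, S.u r = 0 := by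
    intro r hr
    refine tendsto_nhds_unique (tendsto_const_nhds.congr' ?_) S.tendsto_u
    filter_upwards [eventually_ge_atTop r] with s hs
    exact le_antisymm (hmono hr (hr.trans hs) hs) (hanti hr (hr.trans hs) hs)
  obtain ⟨p, hp⟩ := S.nonvacuum
  obtain ⟨E₀, hE₀, hE⟩ := S.isAdmissible.cutoff
  have := hE _ _ hp
  rw [energy, S.U_eq, hconst _ (norm_nonneg _)] at this
  nlinarith [sq_nonneg ‖p.2‖]

/-! ### The effective potential -/

theorem Ψ_eq (L r : ℝ) : S.Ψ L r = S.u r + L / (2 * r ^ 2) := rfl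

theorem hasDerivAt_Ψ (L : ℝ) {r : ℝ} (hr : 0 < r) :
    HasDerivAt (S.Ψ L) ((r * S.mass r - L) / r ^ 3) r := by
  have h1 : HasDerivAt (fun r : ℝ => L / (2 * r ^ 2)) (-(L / r ^ 3)) r := by
    have := (((hasDerivAt_id r).pow 2).const_mul 2).inv (by simpa using hr.ne') |>.const_mul L
    refine this.congr_deriv ?_
    simp
    field_simp
  refine ((S.hasDerivAt_u r).add h1).congr_deriv ?_
  rw [mass]
  field_simp
  ring

theorem continuousAt_Ψ (y : ℝ) {r : ℝ} (hr : 0 < r) : ContinuousAt (S.Ψ y) r :=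
  (S.hasDerivAt_Ψ y hr).continuousAt

theorem continuousOn_Ψ₂ : ContinuousOn (fun q : ℝ × ℝ => S.Ψ q.1 q.2) {q | 0 < q.2} := by
  have : ∀ q ∈ {q : ℝ × ℝ | 0 < q.2}, 2 * q.2 ^ 2 ≠ 0 := fun q hq => by
    have : 0 < q.2 := hq
    positivity
  exact (S.continuous_u.comp continuous_snd).continuousOn.add
    (continuousOn_fst.div (by fun_prop) this)

/-- The radius of the circular orbit with angular momentum `L`. -/
theorem exists_circular_radius {L : ℝ} (hL : 0 < L) :
    ∃ ρ > 0, (∀ r, 0 < r → r < ρ → r * S.mass r < L) ∧ ∀ r, ρ < r → L < r * S.mass r := by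
  obtain ⟨r₁, hr₁, hm₁⟩ := S.exists_mass_pos
  have hcont : Continuous fun r => r * S.mass r :=
    continuous_id.mul ((continuous_pow 2).mul S.continuous_deriv_u)
  -- Chosen so that R m(R) ≥ (L / m(r₁)) m(r₁) = L.
  set R := max r₁ (L / S.mass r₁) with hR
  have hR₁ : r₁ ≤ R := le_max_left _ _
  have hR0 : 0 < R := hr₁.trans_le hR₁
  have hRL : L ≤ R * S.mass R := by
    have h1 : S.mass r₁ ≤ S.mass R := S.monotoneOn_mass hr₁.le hR0.le hR₁
    have h2 : L / S.mass r₁ ≤ R := le_max_right _ _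
    rw [div_le_iff₀ hm₁] at h2
    exact h2.trans (mul_le_mul_of_nonneg_left h1 hR0.le)
  obtain ⟨ρ, hρ, hρL⟩ := intermediate_value_Icc hR0.le hcont.continuousOn
    (show L ∈ Icc (0 * S.mass 0) (R * S.mass R) from ⟨by rw [zero_mul]; exact hL.le, hRL⟩)
  simp only at hρL
  have hρ0 : 0 < ρ := by
    rcases hρ.1.eq_or_lt with h | h
    · rw [← h, zero_mul] at hρL
      exact absurd hρL hL.ne
    · exact h
  -- The mass is only weakly monotone; the strict inequalities for r m(r) on the two sides of ρ come
  -- from the factor r together with m(ρ) > 0.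
  have hmρ : 0 < S.mass ρ := by
    rw [← hρL] at hL
    exact pos_of_mul_pos_right hL hρ0.le
  refine ⟨ρ, hρ0, fun r hr hrρ => ?_, fun r hr => ?_⟩
  · have h1 : S.mass r ≤ S.mass ρ := S.monotoneOn_mass hr.le hρ0.le hrρ.le
    rw [← hρL]
    calc r * S.mass r ≤ r * S.mass ρ := by gcongr
      _ < ρ * S.mass ρ := by gcongr
  · have h1 : S.mass ρ ≤ S.mass r := S.monotoneOn_mass hρ0.le (hρ0.trans hr).le hr.le
    rw [← hρL]
    calc ρ * S.mass ρ < r * S.mass ρ := by gcongr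
      _ ≤ r * S.mass r := by
        have := hρ0.trans hr
        gcongr

end RadialSteadyState

/-! ### The single well of the effective potential, turning points and non-circular orbits. -/

namespace RadialSteadyState

open Set

variable (S : RadialSteadyState)

/-- `ρ` is the radius of the circular orbit with angular momentum `L`. -/
structure IsCircular (L ρ : ℝ) : Prop where
  pos : 0 < ρ
  lt : ∀ r, 0 < r → r < ρ → r * S.mass r < L
  gt : ∀ r, ρ < r → L < r * S.mass r

variable {S}

namespace IsCircular

variable {L ρ : ℝ}

theorem strictAntiOn (h : S.IsCircular L ρ) : StrictAntiOn (S.Ψ L) (Ioc 0 ρ) := by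
  refine strictAntiOn_of_deriv_neg (convex_Ioc 0 ρ)
    (fun r hr => (S.continuousAt_Ψ L hr.1).continuousWithinAt) fun r hr => ?_
  rw [interior_Ioc] at hr
  rw [(S.hasDerivAt_Ψ L hr.1).deriv]
  exact div_neg_of_neg_of_pos (sub_neg.2 (h.lt r hr.1 hr.2)) (pow_pos hr.1 3)

theorem strictMonoOn (h : S.IsCircular L ρ) : StrictMonoOn (S.Ψ L) (Ici ρ) := by
  refine strictMonoOn_of_deriv_pos (convex_Ici ρ)
    (fun r hr => (S.continuousAt_Ψ L (h.pos.trans_le hr)).continuousWithinAt) fun r hr => ?_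
  rw [interior_Ici] at hr
  rw [(S.hasDerivAt_Ψ L (h.pos.trans hr)).deriv]
  exact div_pos (sub_pos.2 (h.gt r hr)) (pow_pos (h.pos.trans hr) 3)

theorem Ψ_le (h : S.IsCircular L ρ) {r : ℝ} (hr : 0 < r) : S.Ψ L ρ ≤ S.Ψ L r := by
  rcases le_total r ρ with hle | hle
  · exact h.strictAntiOn.antitoneOn ⟨hr, hle⟩ ⟨h.pos, le_rfl⟩ hle
  · exact h.strictMonoOn.monotoneOn self_mem_Ici hle hle

/-- The effective potential has no interior local maximum. -/
theorem Ψ_le_max (h : S.IsCircular L ρ) {a r b : ℝ} (ha : 0 < a) (har : a ≤ r) (hrb : r ≤ b) :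
    S.Ψ L r ≤ max (S.Ψ L a) (S.Ψ L b) := by
  rcases le_total r ρ with hle | hle
  · exact le_max_of_le_left (h.strictAntiOn.antitoneOn ⟨ha, har.trans hle⟩ ⟨ha.trans_le har, hle⟩ har)
  · exact le_max_of_le_right (h.strictMonoOn.monotoneOn hle (hle.trans hrb) hrb)

end IsCircular

variable (S)

theorem exists_isCircular {L : ℝ} (hL : 0 < L) : ∃ ρ, S.IsCircular L ρ := by
  obtain ⟨ρ, h1, h2, h3⟩ := S.exists_circular_radius hL
  exact ⟨ρ, h1, h2, h3⟩

/-- The energy-angular momentum pairs of non-circular orbits with positive angular momentum. -/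
def orbitSet : Set (ℝ × ℝ) := {y | y ∈ S.posSet ∧ 0 < y.2 ∧ ∃ r > 0, S.Ψ y.2 r < y.1}

theorem continuous_Ψ_param {r : ℝ} (_ : 0 < r) : Continuous fun y : ℝ × ℝ => S.Ψ y.2 r := by
  simp only [Ψ]
  fun_prop

theorem isOpen_orbitSet : IsOpen S.orbitSet := by
  have : S.orbitSet = S.posSet ∩ ({y | 0 < y.2} ∩ ⋃ r ∈ Ioi (0 : ℝ), {y | S.Ψ y.2 r < y.1}) := by
    ext y
    simp only [orbitSet, mem_ofPred_eq, mem_inter_iff, mem_iUnion, mem_Ioi, exists_prop]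
  rw [this]
  refine S.isOpen_posSet.inter ((isOpen_lt continuous_const continuous_snd).inter ?_)
  exact isOpen_biUnion fun r hr => isOpen_lt (S.continuous_Ψ_param hr) continuous_fst

theorem eventually_orbitSet {y : ℝ × ℝ} (hy : y ∈ S.orbitSet) : ∀ᶠ z in 𝓝 y, z ∈ S.orbitSet :=
  S.isOpen_orbitSet.mem_nhds hy

theorem eventually_Ψ_lt {y : ℝ × ℝ} {r : ℝ} (hr : 0 < r) (h : S.Ψ y.2 r < y.1) :
    ∀ᶠ z : ℝ × ℝ in 𝓝 y, S.Ψ z.2 r < z.1 :=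
  (isOpen_lt (S.continuous_Ψ_param hr) continuous_fst).mem_nhds h

theorem eventually_lt_Ψ {y : ℝ × ℝ} {r : ℝ} (hr : 0 < r) (h : y.1 < S.Ψ y.2 r) :
    ∀ᶠ z : ℝ × ℝ in 𝓝 y, z.1 < S.Ψ z.2 r :=
  (isOpen_lt continuous_fst (S.continuous_Ψ_param hr)).mem_nhds h

theorem tendsto_Ψ_atTop (L : ℝ) : Tendsto (S.Ψ L) atTop (𝓝 0) := by
  have h1 : Tendsto (fun r : ℝ => L / (2 * r ^ 2)) atTop (𝓝 0) :=
    tendsto_const_nhds.div_atTop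
      ((tendsto_pow_atTop (two_ne_zero)).const_mul_atTop (by norm_num))
  have h2 := S.tendsto_u.add h1
  rw [add_zero] at h2
  exact h2

theorem exists_Ψ_gt {L : ℝ} (hL : 0 < L) (E : ℝ) {δ : ℝ} (hδ : 0 < δ) :
    ∃ r, 0 < r ∧ r < δ ∧ E < S.Ψ L r := by
  have h1 : Tendsto (fun r : ℝ => 2 * r ^ 2) (𝓝[>] 0) (𝓝[>] 0) := by
    refine tendsto_nhdsWithin_iff.2 ⟨?_, ?_⟩
    · have : Continuous fun r : ℝ => 2 * r ^ 2 := by fun_prop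
      have := this.tendsto 0
      simp only [ne_eq, OfNat.ofNat_ne_zero, not_false_eq_true, zero_pow, mul_zero] at this
      exact this.mono_left nhdsWithin_le_nhds
    · filter_upwards [self_mem_nhdsWithin] with r hr
      have : 0 < r := hr
      change 0 < 2 * r ^ 2
      positivity
  have h2 : Tendsto (fun r : ℝ => L / (2 * r ^ 2)) (𝓝[>] 0) atTop :=
    (tendsto_inv_nhdsGT_zero.comp h1).const_mul_atTop hL
  have h3 : Tendsto (S.Ψ L) (𝓝[>] 0) atTop :=
    ((S.continuous_u.tendsto 0).mono_left nhdsWithin_le_nhds).add_atTop h2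
  obtain ⟨r, ⟨hr, hr'⟩, hE⟩ :=
    ((show ∀ᶠ r in 𝓝[>] (0 : ℝ), r ∈ Ioo 0 δ from Ioo_mem_nhdsGT hδ).and
      (h3.eventually_gt_atTop E)).exists
  exact ⟨r, hr, hr', hE⟩

variable {S}

/-- The turning points of a non-circular orbit. -/
theorem turning_points {y : ℝ × ℝ} (hy : y ∈ S.orbitSet) {ρ : ℝ} (hρ : S.IsCircular y.2 ρ) :
    0 < S.rMinus y.1 y.2 ∧ S.rMinus y.1 y.2 < ρ ∧ ρ < S.rPlus y.1 y.2 ∧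
      S.Ψ y.2 (S.rMinus y.1 y.2) = y.1 ∧ S.Ψ y.2 (S.rPlus y.1 y.2) = y.1 ∧
      ∀ r > 0, S.Ψ y.2 r < y.1 ↔ r ∈ Ioo (S.rMinus y.1 y.2) (S.rPlus y.1 y.2) := by
  obtain ⟨hpos, hL, r₀, hr₀, hlt⟩ := hy
  obtain ⟨E₀, hE₀, hcut⟩ := S.isAdmissible.cutoff
  have hE : y.1 < 0 := (hcut _ _ hpos).trans hE₀
  have hρE : S.Ψ y.2 ρ < y.1 := (hρ.Ψ_le hr₀).trans_lt hlt
  -- The centrifugal barrier (L > 0) produces the inner turning point; E < 0 together with Ψ_L → 0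
  -- at infinity produces the outer one.
  obtain ⟨s, hs, hsρ, hsE⟩ := S.exists_Ψ_gt hL y.1 hρ.pos
  obtain ⟨R, hRE, hRρ⟩ := (((S.tendsto_Ψ_atTop y.2).eventually_const_lt hE).and
    (eventually_gt_atTop ρ)).exists
  obtain ⟨a, ha, haE⟩ := intermediate_value_Icc' hsρ.le
    (f := S.Ψ y.2) (fun r hr => (S.continuousAt_Ψ y.2 (hs.trans_le hr.1)).continuousWithinAt)
    (show y.1 ∈ Icc (S.Ψ y.2 ρ) (S.Ψ y.2 s) from ⟨hρE.le, hsE.le⟩)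
  obtain ⟨b, hb, hbE⟩ := intermediate_value_Icc hRρ.le
    (f := S.Ψ y.2) (fun r hr => (S.continuousAt_Ψ y.2 (hρ.pos.trans_le hr.1)).continuousWithinAt)
    (show y.1 ∈ Icc (S.Ψ y.2 ρ) (S.Ψ y.2 R) from ⟨hρE.le, hRE.le⟩)
  have ha0 : 0 < a := hs.trans_le ha.1
  have haρ : a < ρ := lt_of_le_of_ne ha.2 fun h => by
    rw [h] at haE
    exact hρE.ne haE
  have hbρ : ρ < b := lt_of_le_of_ne hb.1 fun h => by
    rw [← h] at hbE
    exact hρE.ne hbE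
  have hset : {r | 0 < r ∧ S.Ψ y.2 r = y.1} = {a, b} := by
    ext r
    constructor
    · rintro ⟨hr, hrE⟩
      rcases le_total r ρ with hle | hle
      · exact Or.inl (hρ.strictAntiOn.injOn ⟨hr, hle⟩ ⟨ha0, haρ.le⟩ (hrE.trans haE.symm))
      · exact Or.inr (hρ.strictMonoOn.injOn hle hbρ.le (hrE.trans hbE.symm))
    · rintro (rfl | rfl)
      · exact ⟨ha0, haE⟩
      · exact ⟨hρ.pos.trans hbρ, hbE⟩
  have hmin : S.rMinus y.1 y.2 = a := by
    rw [rMinus, hset, csInf_pair, inf_eq_left]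
    exact (haρ.trans hbρ).le
  have hmax : S.rPlus y.1 y.2 = b := by
    rw [rPlus, hset, csSup_pair, sup_eq_right]
    exact (haρ.trans hbρ).le
  rw [hmin, hmax]
  refine ⟨ha0, haρ, hbρ, haE, hbE, fun r hr => ?_⟩
  rcases le_total r ρ with hle | hle
  · rw [← haE, hρ.strictAntiOn.lt_iff_gt ⟨hr, hle⟩ ⟨ha0, haρ.le⟩]
    exact ⟨fun h => ⟨h, hle.trans_lt hbρ⟩, fun h => h.1⟩
  · rw [← hbE, hρ.strictMonoOn.lt_iff_lt hle hbρ.le]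
    exact ⟨fun h => ⟨haρ.trans_le hle, h⟩, fun h => h.2⟩

theorem exists_isCircular_of_mem {y : ℝ × ℝ} (hy : y ∈ S.orbitSet) : ∃ ρ, S.IsCircular y.2 ρ :=
  S.exists_isCircular hy.2.1

/-! ### Dependence of the turning points on (E, L). -/

section TurningPoints

variable {y : ℝ × ℝ} (hy : y ∈ S.orbitSet)
include hy

theorem rMinus_pos : 0 < S.rMinus y.1 y.2 :=
  let ⟨_, hρ⟩ := exists_isCircular_of_mem hy
  (turning_points hy hρ).1

theorem rMinus_lt_rPlus : S.rMinus y.1 y.2 < S.rPlus y.1 y.2 :=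
  let ⟨_, hρ⟩ := exists_isCircular_of_mem hy
  (turning_points hy hρ).2.1.trans (turning_points hy hρ).2.2.1

theorem Ψ_rMinus : S.Ψ y.2 (S.rMinus y.1 y.2) = y.1 :=
  let ⟨_, hρ⟩ := exists_isCircular_of_mem hy
  (turning_points hy hρ).2.2.2.1

theorem Ψ_rPlus : S.Ψ y.2 (S.rPlus y.1 y.2) = y.1 :=
  let ⟨_, hρ⟩ := exists_isCircular_of_mem hy
  (turning_points hy hρ).2.2.2.2.1

theorem Ψ_lt_iff {r : ℝ} (hr : 0 < r) :
    S.Ψ y.2 r < y.1 ↔ r ∈ Ioo (S.rMinus y.1 y.2) (S.rPlus y.1 y.2) :=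
  let ⟨_, hρ⟩ := exists_isCircular_of_mem hy
  (turning_points hy hρ).2.2.2.2.2 r hr

/-- The sign of E - Ψ_L(r') at a fixed radius r' is an open condition on (E, L), and it tells on
which side of the turning points r' lies. -/
theorem continuousAt_rMinus : ContinuousAt (fun z : ℝ × ℝ => S.rMinus z.1 z.2) y := by
  obtain ⟨ρ, hρ⟩ := exists_isCircular_of_mem hy
  obtain ⟨ha0, haρ, hbρ, haE, hbE, hiff⟩ := turning_points hy hρ
  have hρE := S.eventually_Ψ_lt hρ.pos ((hiff ρ hρ.pos).2 ⟨haρ, hbρ⟩)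
  set a := S.rMinus y.1 y.2
  refine tendsto_order.2 ⟨fun r hr => ?_, fun r hr => ?_⟩
  -- A radius strictly between r and a which stays positive even if r is not.
  · set r' := max ((r + a) / 2) (a / 2) with hr'
    have hr'0 : 0 < r' := lt_max_of_lt_right (by linarith)
    have hrr' : r < r' := lt_max_of_lt_left (by linarith)
    have hr'a : r' < a := max_lt (by linarith) (by linarith)
    have hΨ : y.1 < S.Ψ y.2 r' := by
      rw [← haE]
      exact hρ.strictAntiOn ⟨hr'0, hr'a.le.trans haρ.le⟩ ⟨ha0, haρ.le⟩ hr'a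
    filter_upwards [S.eventually_lt_Ψ hr'0 hΨ, S.eventually_orbitSet hy, hρE] with z h1 h2 h3
    by_contra! hcon
    have h4 := (Ψ_lt_iff h2 hρ.pos).1 h3
    exact absurd ((Ψ_lt_iff h2 hr'0).2 ⟨hcon.trans_lt hrr', (hr'a.trans haρ).trans h4.2⟩) h1.not_gt
  · set r' := min r ρ with hr'
    have hr'a : a < r' := lt_min hr haρ
    have hr'0 : 0 < r' := ha0.trans hr'a
    have hΨ := S.eventually_Ψ_lt hr'0 ((hiff r' hr'0).2 ⟨hr'a, (min_le_right _ _).trans_lt hbρ⟩)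
    filter_upwards [hΨ, S.eventually_orbitSet hy] with z h1 h2
    exact ((Ψ_lt_iff h2 hr'0).1 h1).1.trans_le (min_le_left _ _)

theorem continuousAt_rPlus : ContinuousAt (fun z : ℝ × ℝ => S.rPlus z.1 z.2) y := by
  obtain ⟨ρ, hρ⟩ := exists_isCircular_of_mem hy
  obtain ⟨ha0, haρ, hbρ, haE, hbE, hiff⟩ := turning_points hy hρ
  have hρE := S.eventually_Ψ_lt hρ.pos ((hiff ρ hρ.pos).2 ⟨haρ, hbρ⟩)
  set b := S.rPlus y.1 y.2
  refine tendsto_order.2 ⟨fun r hr => ?_, fun r hr => ?_⟩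
  · set r' := max r ρ with hr'
    have hr'b : r' < b := max_lt hr hbρ
    have hr'0 : 0 < r' := lt_max_of_lt_right hρ.pos
    have hΨ := S.eventually_Ψ_lt hr'0 ((hiff r' hr'0).2 ⟨haρ.trans_le (le_max_right _ _), hr'b⟩)
    filter_upwards [hΨ, S.eventually_orbitSet hy] with z h1 h2
    exact (le_max_left _ _).trans_lt ((Ψ_lt_iff h2 hr'0).1 h1).2
  · set r' := (r + b) / 2 with hr'
    have hrr' : r' < r := by linarith
    have hr'b : b < r' := by linarith
    have hr'0 : 0 < r' := (hρ.pos.trans hbρ).trans hr'b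
    have hΨ : y.1 < S.Ψ y.2 r' := by
      rw [← hbE]
      exact hρ.strictMonoOn hbρ.le (hbρ.trans hr'b).le hr'b
    filter_upwards [S.eventually_lt_Ψ hr'0 hΨ, S.eventually_orbitSet hy, hρE] with z h1 h2 h3
    by_contra! hcon
    have h4 := (Ψ_lt_iff h2 hρ.pos).1 h3
    exact absurd ((Ψ_lt_iff h2 hr'0).2 ⟨h4.1.trans (hbρ.trans hr'b), hrr'.trans_le hcon⟩) h1.not_gt

/-- Locally uniform nondegeneracy of the turning points. -/
theorem exists_lower_bound : ∃ c > 0, ∀ᶠ z : ℝ × ℝ in 𝓝 y,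
    ∀ r ∈ Ioo (S.rMinus z.1 z.2) (S.rPlus z.1 z.2),
      c * ((r - S.rMinus z.1 z.2) * (S.rPlus z.1 z.2 - r)) ≤ 2 * z.1 - 2 * S.Ψ z.2 r := by
  obtain ⟨ρ, hρ⟩ := exists_isCircular_of_mem hy
  obtain ⟨ha0, haρ, hbρ, haE, hbE, hiff⟩ := turning_points hy hρ
  -- Three zones, fixed for y and still valid for nearby z: below m₁ the slope of Ψ is at most -c₁,
  -- above m₂ it is at least c₂, and in between Ψ is bounded by its values at m₁ and m₂, as it has
  -- no interior maximum.
  obtain ⟨m₁, hm₁a, hm₁ρ⟩ := exists_between haρ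
  obtain ⟨m₂, hm₂ρ, hm₂b⟩ := exists_between hbρ
  have hm₁0 : 0 < m₁ := ha0.trans hm₁a
  have hm₂0 : 0 < m₂ := hρ.pos.trans hm₂ρ
  set B := S.rPlus y.1 y.2 + 1 with hB
  have hB0 : 0 < B := by linarith
  -- Here and in δ₂, e₁, e₂ half of the gap at y is kept, the other half leaving room for the
  -- perturbation of (E, L).
  set δ₁ := (y.2 - m₁ * S.mass m₁) / 2 with hδ₁
  set δ₂ := (m₂ * S.mass m₂ - y.2) / 2 with hδ₂
  have hδ₁0 : 0 < δ₁ := by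
    have := hρ.lt m₁ hm₁0 hm₁ρ
    rw [hδ₁]
    linarith
  have hδ₂0 : 0 < δ₂ := by
    have := hρ.gt m₂ hm₂ρ
    rw [hδ₂]
    linarith
  have hΨ₁ : S.Ψ y.2 m₁ < y.1 := (hiff m₁ hm₁0).2 ⟨hm₁a, hm₁ρ.trans hbρ⟩
  have hΨ₂ : S.Ψ y.2 m₂ < y.1 := (hiff m₂ hm₂0).2 ⟨haρ.trans hm₂ρ, hm₂b⟩
  set e₁ := (y.1 - S.Ψ y.2 m₁) / 2 with he₁
  set e₂ := (y.1 - S.Ψ y.2 m₂) / 2 with he₂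
  have he₁0 : 0 < e₁ := by rw [he₁]; linarith
  have he₂0 : 0 < e₂ := by rw [he₂]; linarith
  set c₁ := δ₁ / m₁ ^ 3 with hc₁
  set c₂ := δ₂ / B ^ 3 with hc₂
  have hc₁0 : 0 < c₁ := by positivity
  have hc₂0 : 0 < c₂ := by positivity
  have hev₁ : ∀ᶠ z : ℝ × ℝ in 𝓝 y, y.2 - δ₁ < z.2 :=
    continuousAt_snd.eventually_const_lt (by linarith)
  have hev₂ : ∀ᶠ z : ℝ × ℝ in 𝓝 y, z.2 < y.2 + δ₂ :=
    continuousAt_snd.eventually_lt_const (by linarith)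
  have hev₃ : ∀ᶠ z : ℝ × ℝ in 𝓝 y, e₁ < z.1 - S.Ψ z.2 m₁ :=
    Tendsto.eventually_const_lt (f := fun z : ℝ × ℝ => z.1 - S.Ψ z.2 m₁)
      (show e₁ < y.1 - S.Ψ y.2 m₁ by rw [he₁]; linarith)
      (continuous_fst.sub (S.continuous_Ψ_param hm₁0)).continuousAt
  have hev₄ : ∀ᶠ z : ℝ × ℝ in 𝓝 y, e₂ < z.1 - S.Ψ z.2 m₂ :=
    Tendsto.eventually_const_lt (f := fun z : ℝ × ℝ => z.1 - S.Ψ z.2 m₂)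
      (show e₂ < y.1 - S.Ψ y.2 m₂ by rw [he₂]; linarith)
      (continuous_fst.sub (S.continuous_Ψ_param hm₂0)).continuousAt
  -- One constant per zone; B bounds the factors r - a and b - r that the zone does not use.
  refine ⟨min (2 * c₁ / B) (min (2 * c₂ / B) (2 * min e₁ e₂ / B ^ 2)), by positivity, ?_⟩
  filter_upwards [S.eventually_orbitSet hy, hev₁, hev₂, hev₃, hev₄,
    (continuousAt_rMinus hy).eventually_lt_const hm₁a,
    (continuousAt_rPlus hy).eventually_const_lt hm₂b,
    (continuousAt_rPlus hy).eventually_lt_const (show S.rPlus y.1 y.2 < B by linarith)]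
    with z hz h1 h2 h3 h4 h5 h6 h7 r hr
  obtain ⟨σ, hσ⟩ := exists_isCircular_of_mem hz
  obtain ⟨hza0, -, -, hzaE, hzbE, -⟩ := turning_points hz hσ
  set a := S.rMinus z.1 z.2
  set b := S.rPlus z.1 z.2
  have hx : 0 < r - a := sub_pos.2 hr.1
  have hx' : 0 < b - r := sub_pos.2 hr.2
  have hr0 : 0 < r := hza0.trans hr.1
  have hdiff : ∀ s > 0, DifferentiableAt ℝ (S.Ψ z.2) s := fun s hs =>
    (S.hasDerivAt_Ψ z.2 hs).differentiableAt
  rcases le_total r m₁ with hrm | hrm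
  · have key := (convex_Icc a m₁).image_sub_le_mul_sub_of_deriv_le (f := S.Ψ z.2) (C := -c₁)
      (fun s hs => (hdiff s (hza0.trans_le hs.1)).continuousAt.continuousWithinAt)
      (fun s hs => by
        rw [interior_Icc] at hs
        exact (hdiff s (hza0.trans hs.1)).differentiableWithinAt)
      (fun s hs => by
        rw [interior_Icc] at hs
        have hs0 : 0 < s := hza0.trans hs.1
        rw [(S.hasDerivAt_Ψ z.2 hs0).deriv]
        have i1 : s * S.mass s ≤ m₁ * S.mass m₁ :=
          mul_le_mul hs.2.le (S.monotoneOn_mass hs0.le hm₁0.le hs.2.le) (S.mass_nonneg hs0.le)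
            hm₁0.le
        have i2 : s * S.mass s - z.2 ≤ -δ₁ := by rw [hδ₁] at h1 ⊢; linarith
        calc (s * S.mass s - z.2) / s ^ 3 ≤ -δ₁ / s ^ 3 := by gcongr
          _ = -(δ₁ / s ^ 3) := by ring
          _ ≤ -c₁ := by
            rw [hc₁]
            have := hs.2.le
            gcongr) a ⟨le_rfl, h5.le⟩ r ⟨hr.1.le, hrm⟩ hr.1.le
    rw [hzaE] at key
    calc _ ≤ 2 * c₁ / B * ((r - a) * (b - r)) := by
          gcongr
          exact min_le_left _ _
      _ ≤ 2 * c₁ / B * ((r - a) * B) := by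
          gcongr
          linarith
      _ = 2 * (c₁ * (r - a)) := by field_simp
      _ ≤ _ := by linarith
  · rcases le_total m₂ r with hrm' | hrm'
    · have key := (convex_Icc m₂ b).mul_sub_le_image_sub_of_le_deriv (f := S.Ψ z.2) (C := c₂)
        (fun s hs => (hdiff s (hm₂0.trans_le hs.1)).continuousAt.continuousWithinAt)
        (fun s hs => by
          rw [interior_Icc] at hs
          exact (hdiff s (hm₂0.trans hs.1)).differentiableWithinAt)
        (fun s hs => by
          rw [interior_Icc] at hs
          have hs0 : 0 < s := hm₂0.trans hs.1
          rw [(S.hasDerivAt_Ψ z.2 hs0).deriv]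
          have i1 : m₂ * S.mass m₂ ≤ s * S.mass s :=
            mul_le_mul hs.1.le (S.monotoneOn_mass hm₂0.le hs0.le hs.1.le) (S.mass_nonneg hm₂0.le)
              hs0.le
          have i2 : δ₂ ≤ s * S.mass s - z.2 := by rw [hδ₂] at h2 ⊢; linarith
          have i3 : s ≤ B := hs.2.le.trans h7.le
          have i4 := hδ₂0.le.trans i2
          rw [hc₂]
          gcongr) r ⟨hrm', hr.2.le⟩ b ⟨h6.le, le_rfl⟩ hr.2.le
      rw [hzbE] at key
      calc _ ≤ 2 * c₂ / B * ((r - a) * (b - r)) := by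
            gcongr
            exact (min_le_right _ _).trans (min_le_left _ _)
        _ ≤ 2 * c₂ / B * (B * (b - r)) := by
            gcongr
            linarith
        _ = 2 * (c₂ * (b - r)) := by field_simp
        _ ≤ _ := by linarith
    · have key := hσ.Ψ_le_max hm₁0 hrm hrm'
      have hΨr : S.Ψ z.2 r ≤ z.1 - min e₁ e₂ := by
        refine key.trans (max_le ?_ ?_)
        · linarith [min_le_left e₁ e₂]
        · linarith [min_le_right e₁ e₂]
      have hm0 : 0 < min e₁ e₂ := lt_min he₁0 he₂0
      calc _ ≤ 2 * min e₁ e₂ / B ^ 2 * ((r - a) * (b - r)) := by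
            gcongr
            exact (min_le_right _ _).trans (min_le_right _ _)
        _ ≤ 2 * min e₁ e₂ / B ^ 2 * (B * B) := by
            gcongr
            · linarith
            · linarith
        _ = 2 * min e₁ e₂ := by field_simp
        _ ≤ _ := by linarith

end TurningPoints

variable (S)

/-- The radial speed at radius `r` on an orbit. -/
def speed (y : ℝ × ℝ) (r : ℝ) : ℝ := √(2 * y.1 - 2 * S.Ψ y.2 r)

theorem T_eq (y : ℝ × ℝ) :
    S.T y.1 y.2 = 2 * travelTime (S.rMinus y.1 y.2) (S.speed y) (S.rPlus y.1 y.2) := rfl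

/-- Separates the singularities at the two turning points: with x = r - a and x' = b - r the sum x +
x' is constant, and each remaining term is singular at one end only. -/
theorem _root_.VlasovPoisson.inv_sqrt_mul_le {x x' : ℝ} (hx : 0 < x) (hx' : 0 < x') :
    1 / √(x * x') ≤ 1 / √(x + x') * (1 / √x + 1 / √x') := by
  have h1 := Real.sqrt_pos.2 hx
  have h2 := Real.sqrt_pos.2 hx'
  have h3 : √(x + x') ≤ √x + √x' := by
    rw [Real.sqrt_le_left (by positivity)]
    nlinarith [Real.sq_sqrt hx.le, Real.sq_sqrt hx'.le]
  have h4 : 0 < √(x + x') := Real.sqrt_pos.2 (by positivity)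
  rw [Real.sqrt_mul hx.le]
  have : 1 / √(x + x') * (1 / √x + 1 / √x') = (√x + √x') / √(x + x') * (1 / (√x * √x')) := by
    field_simp
    ring
  rw [this]
  exact le_mul_of_one_le_left (by positivity) ((one_le_div h4).2 h3)

theorem _root_.VlasovPoisson.intervalIntegrable_inv_sqrt (a b : ℝ) :
    IntervalIntegrable (fun x => 1 / √x) volume a b := by
  have : (fun x : ℝ => 1 / √x) = fun x => (√x)⁻¹ := by
    funext x
    rw [one_div]
  rw [this]
  have h0 : ∀ a b : ℝ, 0 ≤ a → 0 ≤ b → IntervalIntegrable (fun x : ℝ => (√x)⁻¹) volume a b := by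
    intro a b ha hb
    refine (intervalIntegral.intervalIntegrable_rpow' (a := a) (b := b) (r := -(1 / 2))
      (by norm_num)).congr fun x hx => ?_
    have hx0 : 0 ≤ x := (le_min ha hb).trans hx.1.le
    rw [Real.rpow_neg hx0, Real.sqrt_eq_rpow]
  -- For x ≤ 0 both √x and its inverse are 0 by convention.
  have h1 : ∀ a b : ℝ, a ≤ 0 → b ≤ 0 → IntervalIntegrable (fun x : ℝ => (√x)⁻¹) volume a b := by
    intro a b ha hb
    refine (intervalIntegrable_const (c := (0 : ℝ))).congr fun x hx => ?_
    have hx0 : x ≤ 0 := hx.2.trans (max_le ha hb)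
    rw [Real.sqrt_eq_zero_of_nonpos hx0, _root_.inv_zero]
  have hz : ∀ a : ℝ, IntervalIntegrable (fun x : ℝ => (√x)⁻¹) volume 0 a := by
    intro a
    rcases le_total 0 a with h | h
    · exact h0 _ _ le_rfl h
    · exact h1 _ _ le_rfl h
  exact (hz a).symm.trans (hz b)

variable {S}

/-! ### The orbits as instances of `IsOrbit`, and continuity of the period. -/

section Orbits

variable {y : ℝ × ℝ} (hy : y ∈ S.orbitSet)
include hy

/-- The substantial point is the integrability of 1/w: by `exists_lower_bound`, w² dominates a
multiple of (r - a)(b - r), and `inv_sqrt_mul_le` reduces to inverse square root singularities. -/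
theorem isOrbit : IsOrbit (S.rMinus y.1 y.2) (S.rPlus y.1 y.2) (S.speed y)
    (fun r => (r * S.mass r - y.2) / r ^ 3) := by
  have ha0 := rMinus_pos hy
  have hab := rMinus_lt_rPlus hy
  have hQ : ∀ r ∈ Ioo (S.rMinus y.1 y.2) (S.rPlus y.1 y.2), 0 < 2 * y.1 - 2 * S.Ψ y.2 r := by
    intro r hr
    have := (Ψ_lt_iff hy (ha0.trans hr.1)).2 hr
    linarith
  have hcont : ContinuousOn (S.speed y) (Icc (S.rMinus y.1 y.2) (S.rPlus y.1 y.2)) := fun r hr =>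
    (Real.continuous_sqrt.continuousAt.comp (continuousAt_const.sub
      (continuousAt_const.mul (S.continuousAt_Ψ y.2 (ha0.trans_le hr.1))))).continuousWithinAt
  refine ⟨hab, hcont, ?_, ?_, fun r hr => Real.sqrt_pos.2 (hQ r hr), ?_, ?_, fun r hr => ?_⟩
  · rw [speed, Ψ_rMinus hy]
    simp
  · rw [speed, Ψ_rPlus hy]
    simp
  · obtain ⟨c, hc, hev⟩ := exists_lower_bound hy
    have hlow := hev.self_of_nhds
    set a := S.rMinus y.1 y.2
    set b := S.rPlus y.1 y.2
    have i1 : IntervalIntegrable (fun r => 1 / √(r - a)) volume a b := by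
      simpa using (intervalIntegrable_inv_sqrt (a - a) (b - a)).comp_sub_right a
    have i2 : IntervalIntegrable (fun r => 1 / √(b - r)) volume a b := by
      simpa using ((intervalIntegrable_inv_sqrt (b - a) (b - b)).comp_sub_left b)
    have i3 := ((i1.add i2).const_mul (1 / √c * (1 / √(b - a))))
    rw [intervalIntegrable_iff_integrableOn_Ioo_of_le hab.le] at i3 ⊢
    refine Integrable.mono' i3 ?_ ?_
    · refine ContinuousOn.aestronglyMeasurable (fun r hr => ?_) measurableSet_Ioo
      exact (continuousWithinAt_const.div ((hcont r (Ioo_subset_Icc_self hr)).mono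
        Ioo_subset_Icc_self) (Real.sqrt_pos.2 (hQ r hr)).ne')
    · refine (ae_restrict_iff' measurableSet_Ioo).2 (Eventually.of_forall fun r hr => ?_)
      have hra : 0 < r - a := sub_pos.2 hr.1
      have hrb : 0 < b - r := sub_pos.2 hr.2
      have h1 := hlow r hr
      have h2 := inv_sqrt_mul_le hra hrb
      have h3 : √c * √((r - a) * (b - r)) ≤ S.speed y r := by
        rw [← Real.sqrt_mul hc.le]
        exact Real.sqrt_le_sqrt h1
      rw [show r - a + (b - r) = b - a by ring] at h2
      have h4 : 0 < √c * √((r - a) * (b - r)) := by positivity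
      rw [Real.norm_of_nonneg (by rw [speed]; positivity)]
      calc 1 / S.speed y r ≤ 1 / (√c * √((r - a) * (b - r))) := one_div_le_one_div_of_le h4 h3
        _ = 1 / √c * (1 / √((r - a) * (b - r))) := by rw [one_div_mul_one_div]
        _ ≤ 1 / √c * (1 / √(b - a) * (1 / √(r - a) + 1 / √(b - r))) := by gcongr
        _ = _ := by ring
  · have hm : Continuous S.mass := (continuous_pow 2).mul S.continuous_deriv_u
    exact ContinuousOn.div (by fun_prop) (by fun_prop) fun r hr =>
      (pow_pos (ha0.trans_le hr.1) 3).ne'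
  · have h1 := ((S.hasDerivAt_Ψ y.2 (ha0.trans hr.1)).const_mul 2).const_sub (2 * y.1)
    refine (h1.sqrt (hQ r hr).ne').congr_deriv ?_
    have : √(2 * y.1 - 2 * S.Ψ y.2 r) ≠ 0 := (Real.sqrt_pos.2 (hQ r hr)).ne'
    rw [speed]
    field_simp

theorem T_pos : 0 < S.T y.1 y.2 := by
  rw [T_eq]
  have := (isOrbit hy).halfPeriod_pos
  linarith

omit hy in
-- Rescaling to [0, 1] moves the variable turning points into the integrand, so that dominated
-- convergence in (E, L) applies.
theorem T_eq_integral_unit (z : ℝ × ℝ) : S.T z.1 z.2 = 2 * ∫ x in (0 : ℝ)..1,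
    (S.rPlus z.1 z.2 - S.rMinus z.1 z.2) *
      (1 / S.speed z (S.rMinus z.1 z.2 + (S.rPlus z.1 z.2 - S.rMinus z.1 z.2) * x)) := by
  rw [T_eq, travelTime, intervalIntegral.integral_const_mul]
  have := intervalIntegral.mul_integral_comp_add_mul (a := 0) (b := 1)
    (f := fun r => 1 / S.speed z r) (S.rPlus z.1 z.2 - S.rMinus z.1 z.2) (S.rMinus z.1 z.2)
  rw [this]
  simp

/-- After rescaling, the factor b - a cancels against the one in the lower bound for the speed. This
leaves the bound (1/√x + 1/√(1-x))/√c, the same for all nearby (E, L). -/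
theorem continuousAt_T : ContinuousAt (fun z : ℝ × ℝ => S.T z.1 z.2) y := by
  obtain ⟨c, hc, hev⟩ := exists_lower_bound hy
  simp_rw [T_eq_integral_unit]
  refine continuousAt_const.mul ?_
  have ca := continuousAt_rMinus hy
  have cb := continuousAt_rPlus hy
  have hmem : ∀ {z : ℝ × ℝ}, z ∈ S.orbitSet → ∀ {x : ℝ}, x ∈ Ioo (0 : ℝ) 1 →
      S.rMinus z.1 z.2 + (S.rPlus z.1 z.2 - S.rMinus z.1 z.2) * x ∈
        Ioo (S.rMinus z.1 z.2) (S.rPlus z.1 z.2) := by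
    intro z hz x hx
    have := sub_pos.2 (rMinus_lt_rPlus hz)
    refine ⟨by nlinarith [mul_pos this hx.1], by nlinarith [mul_pos this (sub_pos.2 hx.2)]⟩
  have hIoo : ∀ᵐ x : ℝ, x ∈ uIoc (0 : ℝ) 1 → x ∈ Ioo (0 : ℝ) 1 := by
    have : ∀ᵐ x : ℝ, x ≠ 1 := by simp [ae_iff]
    filter_upwards [this] with x hx hx'
    rw [uIoc_of_le zero_le_one] at hx'
    exact ⟨hx'.1, lt_of_le_of_ne hx'.2 hx⟩
  refine intervalIntegral.continuousAt_of_dominated_interval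
    (bound := fun x => 1 / √c * (1 / √x + 1 / √(1 - x))) ?_ ?_ ?_ ?_
  · filter_upwards [S.eventually_orbitSet hy] with z hz
    rw [uIoc_of_le zero_le_one]
    have : ContinuousOn (fun x => (S.rPlus z.1 z.2 - S.rMinus z.1 z.2) *
        (1 / S.speed z (S.rMinus z.1 z.2 + (S.rPlus z.1 z.2 - S.rMinus z.1 z.2) * x)))
        (Ioo 0 1) := by
      refine continuousOn_const.mul (continuousOn_const.div ?_ fun x hx =>
        ((isOrbit hz).pos _ (hmem hz hx)).ne')
      exact (isOrbit hz).continuousOn.comp (by fun_prop) fun x hx =>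
        Ioo_subset_Icc_self (hmem hz hx)
    rw [← Measure.restrict_congr_set (Ioo_ae_eq_Ioc (μ := volume) (a := (0 : ℝ)) (b := 1))]
    exact this.aestronglyMeasurable measurableSet_Ioo
  · filter_upwards [S.eventually_orbitSet hy, hev] with z hz hlow
    filter_upwards [hIoo] with x hx hx'
    have hx := hx hx'
    have hr := hmem hz hx
    have h1 := hlow _ hr
    set a := S.rMinus z.1 z.2
    set b := S.rPlus z.1 z.2
    have hab : 0 < b - a := sub_pos.2 (rMinus_lt_rPlus hz)
    have hx1 : 0 < 1 - x := sub_pos.2 hx.2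
    have e : c * ((a + (b - a) * x - a) * (b - (a + (b - a) * x))) =
        c * ((b - a) ^ 2 * (x * (1 - x))) := by ring
    have h3 : √c * ((b - a) * √(x * (1 - x))) ≤ S.speed z (a + (b - a) * x) := by
      have : √c * ((b - a) * √(x * (1 - x))) = √(c * ((b - a) ^ 2 * (x * (1 - x)))) := by
        rw [Real.sqrt_mul hc.le, Real.sqrt_mul (sq_nonneg _), Real.sqrt_sq hab.le]
      rw [this, ← e]
      exact Real.sqrt_le_sqrt h1
    have h2 := inv_sqrt_mul_le hx.1 hx1
    rw [show x + (1 - x) = 1 by ring, Real.sqrt_one, div_one, one_mul] at h2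
    have hpos : 0 < x * (1 - x) := mul_pos hx.1 hx1
    have h4 : 0 < √c * ((b - a) * √(x * (1 - x))) := by positivity
    rw [Real.norm_of_nonneg (mul_nonneg hab.le (by rw [speed]; positivity))]
    calc (b - a) * (1 / S.speed z (a + (b - a) * x))
        ≤ (b - a) * (1 / (√c * ((b - a) * √(x * (1 - x))))) := by
          gcongr
      _ = 1 / √c * (1 / √(x * (1 - x))) := by field_simp
      _ ≤ _ := by gcongr
  · refine IntervalIntegrable.const_mul ((intervalIntegrable_inv_sqrt 0 1).add ?_) _
    simpa using ((intervalIntegrable_inv_sqrt 1 0).comp_sub_left 1)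
  · filter_upwards [hIoo] with x hx hx'
    have hr := hmem hy (hx hx')
    have hr0 : 0 < S.rMinus y.1 y.2 + (S.rPlus y.1 y.2 - S.rMinus y.1 y.2) * x :=
      (rMinus_pos hy).trans hr.1
    have cr : ContinuousAt (fun z : ℝ × ℝ => S.rMinus z.1 z.2 +
        (S.rPlus z.1 z.2 - S.rMinus z.1 z.2) * x) y := ca.add ((cb.sub ca).mul continuousAt_const)
    have cΨ : ContinuousAt (fun z : ℝ × ℝ => S.Ψ z.2 (S.rMinus z.1 z.2 +
        (S.rPlus z.1 z.2 - S.rMinus z.1 z.2) * x)) y := by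
      have hopen : IsOpen {q : ℝ × ℝ | 0 < q.2} := isOpen_lt continuous_const continuous_snd
      exact ContinuousAt.comp (g := fun q : ℝ × ℝ => S.Ψ q.1 q.2)
        (f := fun z : ℝ × ℝ => (z.2, S.rMinus z.1 z.2 + (S.rPlus z.1 z.2 - S.rMinus z.1 z.2) * x))
        (S.continuousOn_Ψ₂.continuousAt (hopen.mem_nhds hr0)) (continuousAt_snd.prodMk cr)
    refine (cb.sub ca).mul (continuousAt_const.div ?_ ((isOrbit hy).pos _ hr).ne')
    exact (((continuousAt_const.mul continuousAt_fst).sub (continuousAt_const.mul cΨ)).sqrt)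

end Orbits

end RadialSteadyState

/-! ### Rotation invariant functions on phase space -/

/-- Invariance under the diagonal action of the rotation group. -/
def RotationInvariant {α : Type*} (F : Phase → α) : Prop :=
  ∀ A : Space ≃ₗᵢ[ℝ] Space, LinearMap.det (A.toLinearEquiv : Space →ₗ[ℝ] Space) = 1 →
    ∀ x v : Space, F (A x, A v) = F (x, v)

/-- Two reflections: the first sends x to x', the second sends the image v₁ of v to v'. The second
fixes x', because equality of the inner products says that x' is orthogonal to v₁ - v'. -/
theorem exists_isometry_of_gram_eq {x v x' v' : Space} (hx : ‖x‖ = ‖x'‖) (hv : ‖v‖ = ‖v'‖)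
    (hxv : inner ℝ x v = inner ℝ x' v') : ∃ A : Space ≃ₗᵢ[ℝ] Space, A x = x' ∧ A v = v' := by
  set A₁ := (ℝ ∙ (x - x'))ᗮ.reflection
  have h₁ : A₁ x = x' := Submodule.reflection_sub hx
  set v₁ := A₁ v
  have hv₁ : ‖v₁‖ = ‖v'‖ := (A₁.norm_map v).trans hv
  set A₂ := (ℝ ∙ (v₁ - v'))ᗮ.reflection
  have h₂ : A₂ v₁ = v' := Submodule.reflection_sub hv₁
  have h₃ : A₂ x' = x' := by
    refine Submodule.reflection_mem_subspace_eq_self ?_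
    rw [Submodule.mem_orthogonal_singleton_iff_inner_left, inner_sub_right, ← hxv, ← h₁,
      A₁.inner_map_map, sub_self]
  refine ⟨A₁.trans A₂, ?_, ?_⟩
  · rw [LinearIsometryEquiv.trans_apply, h₁, h₃]
  · rw [LinearIsometryEquiv.trans_apply, h₂]

theorem det_isometry (A : Space ≃ₗᵢ[ℝ] Space) :
    LinearMap.det (A.toLinearEquiv : Space →ₗ[ℝ] Space) = 1 ∨
      LinearMap.det (A.toLinearEquiv : Space →ₗ[ℝ] Space) = -1 := by
  have h := A.toLinearIsometry.normDet_eq_one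
  rw [LinearMap.normDet_eq_abs_det] at h
  exact eq_or_eq_neg_of_abs_eq h

/-- If the isometry reverses orientation, it is composed with the reflection in a plane through x'
and v'; such a plane exists because two vectors do not span a three-dimensional space. -/
theorem exists_rotation_of_gram_eq {x v x' v' : Space} (hx : ‖x‖ = ‖x'‖) (hv : ‖v‖ = ‖v'‖)
    (hxv : inner ℝ x v = inner ℝ x' v') : ∃ A : Space ≃ₗᵢ[ℝ] Space,
      LinearMap.det (A.toLinearEquiv : Space →ₗ[ℝ] Space) = 1 ∧ A x = x' ∧ A v = v' := by
  obtain ⟨A, hAx, hAv⟩ := exists_isometry_of_gram_eq hx hv hxv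
  rcases det_isometry A with hA | hA
  · exact ⟨A, hA, hAx, hAv⟩
  obtain ⟨n, hn, hn0⟩ : ∃ n ∈ (Submodule.span ℝ {x', v'})ᗮ, n ≠ 0 := by
    refine Submodule.exists_mem_ne_zero_of_ne_bot fun hbot => ?_
    have h1 := Submodule.finrank_add_finrank_orthogonal (Submodule.span ℝ {x', v'})
    have h2 : Module.finrank ℝ (Submodule.span ℝ {x', v'}) ≤ 2 := by
      classical
      have := finrank_span_finset_le_card (R := ℝ) ({x', v'} : Finset Space)
      rw [Finset.coe_pair] at this
      exact this.trans Finset.card_le_two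
    rw [hbot, finrank_bot, finrank_euclideanSpace_fin] at h1
    omega
  set R := (ℝ ∙ n)ᗮ.reflection
  have hR : ∀ z ∈ ({x', v'} : Set Space), R z = z := fun z hz => by
    refine Submodule.reflection_mem_subspace_eq_self ?_
    rw [Submodule.mem_orthogonal_singleton_iff_inner_right]
    rw [real_inner_comm]
    exact hn z (Submodule.subset_span hz)
  have hdet : LinearMap.det (R.toLinearEquiv : Space →ₗ[ℝ] Space) = -1 := by
    have h := (ℝ ∙ n)ᗮ.det_reflection
    rw [Submodule.orthogonal_orthogonal, finrank_span_singleton hn0, pow_one] at h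
    exact h
  refine ⟨A.trans R, ?_, ?_, ?_⟩
  · have : ((A.trans R).toLinearEquiv : Space →ₗ[ℝ] Space) =
        (R.toLinearEquiv : Space →ₗ[ℝ] Space) ∘ₗ (A.toLinearEquiv : Space →ₗ[ℝ] Space) := rfl
    rw [this, LinearMap.det_comp, hdet, hA]
    norm_num
  · rw [LinearIsometryEquiv.trans_apply, hAx, hR _ (by simp)]
  · rw [LinearIsometryEquiv.trans_apply, hAv, hR _ (by simp)]

theorem RotationInvariant.eq {α : Type*} {F : Phase → α} (hF : RotationInvariant F)
    {p q : Phase} (hx : ‖p.1‖ = ‖q.1‖) (hv : ‖p.2‖ = ‖q.2‖)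
    (hxv : inner ℝ p.1 p.2 = inner ℝ q.1 q.2) : F p = F q := by
  obtain ⟨A, hA, hAx, hAv⟩ := exists_rotation_of_gram_eq hx hv hxv
  have := hF A hA p.1 p.2
  rw [hAx, hAv] at this
  exact this.symm

theorem angMom_eq (p : Phase) : angMom p = ‖p.1‖ ^ 2 * ‖p.2‖ ^ 2 - inner ℝ p.1 p.2 ^ 2 := by
  simp only [angMom, cross_apply, EuclideanSpace.real_norm_sq_eq, PiLp.inner_apply,
    Fin.sum_univ_three, vec3_dotProduct, RCLike.inner_apply, conj_trivial]
  simp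
  ring

theorem continuous_angMom : Continuous angMom := by
  have : angMom = fun p => ‖p.1‖ ^ 2 * ‖p.2‖ ^ 2 - inner ℝ p.1 p.2 ^ 2 := funext angMom_eq
  rw [this]
  fun_prop

theorem rotationInvariant_angMom : RotationInvariant angMom := fun A _ x v => by
  simp [angMom_eq]

/-- The phase-space point with radius `r`, radial velocity `w` and tangential velocity `ρ`. -/
def planar (r w ρ : ℝ) : Phase := (!₂[r, 0, 0], !₂[w, ρ, 0])

theorem norm_planar_fst (r w ρ : ℝ) : ‖(planar r w ρ).1‖ = |r| := by
  simp [planar, EuclideanSpace.norm_eq, Fin.sum_univ_three, Real.sqrt_sq_eq_abs]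

theorem norm_sq_planar_snd (r w ρ : ℝ) : ‖(planar r w ρ).2‖ ^ 2 = w ^ 2 + ρ ^ 2 := by
  simp [planar, EuclideanSpace.real_norm_sq_eq, Fin.sum_univ_three]

theorem inner_planar (r w ρ : ℝ) : inner ℝ (planar r w ρ).1 (planar r w ρ).2 = r * w := by
  simp [planar, PiLp.inner_apply, Fin.sum_univ_three, mul_comm]

theorem angMom_planar (r w ρ : ℝ) : angMom (planar r w ρ) = (r * ρ) ^ 2 := by
  rw [angMom_eq, norm_planar_fst, norm_sq_planar_snd, inner_planar, sq_abs]
  ring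

theorem continuous_planar : Continuous fun q : ℝ × ℝ × ℝ => planar q.1 q.2.1 q.2.2 := by
  unfold planar
  refine Continuous.prodMk ?_ ?_
  · refine (PiLp.continuous_toLp 2 _).comp (continuous_pi fun i => ?_)
    fin_cases i <;> simp <;> fun_prop
  · refine (PiLp.continuous_toLp 2 _).comp (continuous_pi fun i => ?_)
    fin_cases i <;> simp <;> fun_prop

/-! ### Integration of rotation invariant functions -/

theorem lintegral_norm (f : ℝ → ℝ≥0∞) (hf : Measurable f) :
    ∫⁻ x : Space, f ‖x‖ =
      (volume : Measure Space).toSphere Set.univ * ∫⁻ r in Set.Ioi 0, ENNReal.ofReal (r ^ 2) * f r := by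
  have hdim : Module.finrank ℝ Space - 1 = 2 := by simp
  have h0 := (volume : Measure Space).measurePreserving_homeomorphUnitSphereProd
  rw [hdim] at h0
  calc ∫⁻ x : Space, f ‖x‖ = ∫⁻ x : ({(0)}ᶜ : Set Space), f ‖x.1‖ ∂(volume.comap Subtype.val) := by
        rw [lintegral_subtype_comap (measurableSet_singleton _).compl (fun x : Space => f ‖x‖),
          restrict_compl_singleton]
    _ = ∫⁻ q, f q.2 ∂((volume : Measure Space).toSphere.prod (Measure.volumeIoiPow 2)) := by
        rw [← h0.lintegral_comp_emb (Homeomorph.measurableEmbedding _)]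
        simp
    _ = (volume : Measure Space).toSphere Set.univ * ∫⁻ r, f r ∂(Measure.volumeIoiPow 2) := by
        have h1 : Measurable fun q : Metric.sphere (0 : Space) 1 × Set.Ioi (0 : ℝ) => f q.2 :=
          hf.comp (measurable_subtype_coe.comp measurable_snd)
        rw [lintegral_prod _ h1.aemeasurable]
        simp only [lintegral_const]
        rw [mul_comm]
    _ = _ := by
        congr 1
        have h1 : Measurable fun r : Set.Ioi (0 : ℝ) => f r := hf.comp measurable_subtype_coe
        rw [Measure.volumeIoiPow, lintegral_withDensity_eq_lintegral_mul _ (by fun_prop) h1]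
        exact lintegral_subtype_comap measurableSet_Ioi (fun r : ℝ => ENNReal.ofReal (r ^ 2) * f r)

theorem measurePreserving_euclidean_three :
    MeasurePreserving (fun q : ℝ × ℝ × ℝ => (!₂[q.1, q.2.1, q.2.2] : Space)) := by
  have h1 := (volume_preserving_finTwoArrow ℝ).symm
  have h2 := (MeasurePreserving.id (volume : Measure ℝ)).prod h1
  have h3 := (volume_preserving_piFinSuccAbove (fun _ : Fin 3 => ℝ) 0).symm
  have h4 := (PiLp.volume_preserving_toLp (Fin 3)).comp (h3.comp h2)
  rw [← Measure.volume_eq_prod] at h4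
  convert h4 using 1
  funext q
  ext i
  fin_cases i <;> rfl

/-- Cylindrical coordinates about the first axis; the integrand does not depend on the azimuth,
which contributes 2π. -/
theorem lintegral_axial (f : Space → ℝ≥0∞) (hf : Measurable f)
    (hsymm : ∀ w a b : ℝ, f !₂[w, a, b] = f !₂[w, √(a ^ 2 + b ^ 2), 0]) :
    ∫⁻ v : Space, f v = ENNReal.ofReal (2 * Real.pi) *
      ∫⁻ w : ℝ, ∫⁻ ρ in Set.Ioi (0 : ℝ), ENNReal.ofReal ρ * f !₂[w, ρ, 0] := by
  have hm := measurePreserving_euclidean_three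
  have hf2 : Measurable fun q : ℝ × ℝ × ℝ => f !₂[q.1, q.2.1, q.2.2] := hf.comp hm.measurable
  rw [← hm.lintegral_comp hf, Measure.volume_eq_prod, lintegral_prod _ hf2.aemeasurable,
    ← lintegral_const_mul']
  · refine lintegral_congr fun w => ?_
    have hf3 : Measurable fun ρ : ℝ => f !₂[w, ρ, 0] :=
      hf2.comp (g := fun q : ℝ × ℝ × ℝ => f !₂[q.1, q.2.1, q.2.2])
        (f := fun ρ : ℝ => (w, ρ, (0 : ℝ))) (by fun_prop)
    rw [← lintegral_comp_polarCoord_symm, polarCoord_target, Measure.volume_eq_prod,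
      ← Measure.prod_restrict, lintegral_prod _ (by fun_prop), ← lintegral_const_mul _ (by fun_prop)]
    refine setLIntegral_congr_fun measurableSet_Ioi fun ρ hρ => ?_
    have hρ0 : (0 : ℝ) < ρ := hρ
    have : ∀ θ : ℝ, ENNReal.ofReal ρ • f !₂[w, (polarCoord.symm (ρ, θ)).1,
        (polarCoord.symm (ρ, θ)).2] = ENNReal.ofReal ρ * f !₂[w, ρ, 0] := by
      intro θ
      rw [hsymm, polarCoord_symm_apply, smul_eq_mul]
      simp only
      rw [show (ρ * Real.cos θ) ^ 2 + (ρ * Real.sin θ) ^ 2 = ρ ^ 2 * (Real.cos θ ^ 2 + Real.sin θ ^ 2)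
        by ring, Real.cos_sq_add_sin_sq, mul_one, Real.sqrt_sq hρ0.le]
    simp only [this]
    rw [setLIntegral_const, Real.volume_Ioo, mul_comm]
    congr 2
    ring
  · exact ENNReal.ofReal_ne_top

/-- The normalization constant in the integration formula for rotation invariant functions. -/
def sphereConst : ℝ≥0∞ := (volume : Measure Space).toSphere Set.univ * ENNReal.ofReal Real.pi

theorem sphereConst_ne_zero : sphereConst ≠ 0 := by
  refine mul_ne_zero ?_ ?_
  · rw [Ne, Measure.measure_univ_eq_zero]
    exact Measure.toSphere_ne_zero _
  · rw [Ne, ENNReal.ofReal_eq_zero, not_le]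
    exact Real.pi_pos

theorem sphereConst_ne_top : sphereConst ≠ ∞ :=
  ENNReal.mul_ne_top (measure_ne_top _ _) ENNReal.ofReal_ne_top

/-- The substitution L = r²ρ² at fixed r. The resulting factor r⁻² cancels the r² of the volume
element in x. -/
theorem lintegral_rho (r : ℝ) (hr : 0 < r) (f : ℝ → ℝ≥0∞) :
    ∫⁻ ρ in Set.Ioi (0 : ℝ), ENNReal.ofReal ρ * f ρ =
      ENNReal.ofReal (1 / (2 * r ^ 2)) * ∫⁻ L in Set.Ioi (0 : ℝ), f (√L / r) := by
  have himage : (fun ρ : ℝ => r ^ 2 * ρ ^ 2) '' Set.Ioi 0 = Set.Ioi 0 := by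
    ext L
    constructor
    · rintro ⟨ρ, hρ, rfl⟩
      have : 0 < ρ := hρ
      exact Set.mem_Ioi.2 (by positivity)
    · intro hL
      have h0 : 0 < L := hL
      refine ⟨√L / r, Set.mem_Ioi.2 (by positivity), ?_⟩
      simp only
      rw [div_pow, Real.sq_sqrt h0.le]
      field_simp
  have hinj : Set.InjOn (fun ρ : ℝ => r ^ 2 * ρ ^ 2) (Set.Ioi 0) := by
    intro a ha b hb hab
    have ha : 0 < a := ha
    have hb : 0 < b := hb
    exact (sq_eq_sq₀ ha.le hb.le).1 (mul_left_cancel₀ (by positivity) hab)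
  have key := lintegral_image_eq_lintegral_abs_deriv_mul (s := Set.Ioi (0 : ℝ))
    (f := fun ρ : ℝ => r ^ 2 * ρ ^ 2) (f' := fun ρ => r ^ 2 * (2 * ρ)) measurableSet_Ioi
    (fun ρ _ => by simpa using (((hasDerivAt_pow 2 ρ).const_mul (r ^ 2)).hasDerivWithinAt))
    hinj (fun L => f (√L / r))
  rw [himage] at key
  rw [key, ← lintegral_const_mul' _ _ ENNReal.ofReal_ne_top]
  refine setLIntegral_congr_fun measurableSet_Ioi fun ρ hρ => ?_
  have h0 : 0 < ρ := hρ
  have h1 : √(r ^ 2 * ρ ^ 2) / r = ρ := by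
    rw [← mul_pow, Real.sqrt_sq (by positivity)]
    field_simp
  rw [h1, ← mul_assoc, ← ENNReal.ofReal_mul (by positivity), abs_of_pos (by positivity)]
  congr 2
  field_simp

/-- A rotation brings x onto the first axis, a second one about this axis brings v into a fixed
plane. The volume element is then |S²| r² dr · 2πρ dρ dw, which equals |S²| π dr dw dL for L =
(rρ)²; only a constant is left. -/
theorem lintegral_planar {F : Phase → ℝ≥0∞} (hF : Measurable F) (hsymm : RotationInvariant F) :
    ∫⁻ p : Phase, F p = sphereConst *
      ∫⁻ r in Set.Ioi (0 : ℝ), ∫⁻ w : ℝ, ∫⁻ L in Set.Ioi (0 : ℝ), F (planar r w (√L / r)) := by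
  have hpl : Measurable fun q : ℝ × ℝ × ℝ => planar q.1 q.2.1 q.2.2 := continuous_planar.measurable
  have hG : Measurable fun r : ℝ => ∫⁻ v : Space, F (!₂[r, 0, 0], v) := by
    refine Measurable.lintegral_prod_right' (f := fun q : ℝ × Space => F (!₂[q.1, 0, 0], q.2)) ?_
    refine hF.comp (Measurable.prodMk ?_ measurable_snd)
    exact (hpl.comp (f := fun q : ℝ × Space => (q.1, (0 : ℝ), (0 : ℝ))) (by fun_prop)).fst
  have h1 : ∀ x : Space, ∫⁻ v, F (x, v) = ∫⁻ v, F (!₂[‖x‖, 0, 0], v) := by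
    intro x
    obtain ⟨A, hA, hAx, -⟩ := exists_rotation_of_gram_eq (x := x) (v := 0) (x' := !₂[‖x‖, 0, 0])
      (v' := 0) ((abs_norm x).symm.trans (norm_planar_fst ‖x‖ 0 0).symm) rfl (by simp)
    have h2 : Measurable fun v => F (!₂[‖x‖, 0, 0], v) :=
      hF.comp (measurable_const.prodMk measurable_id)
    rw [← A.measurePreserving.lintegral_comp h2]
    refine lintegral_congr fun v => ?_
    rw [← hAx, hsymm A hA]
  rw [Measure.volume_eq_prod, lintegral_prod _ hF.aemeasurable, lintegral_congr h1,
    lintegral_norm _ hG, sphereConst, mul_assoc]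
  congr 1
  rw [← lintegral_const_mul' _ _ ENNReal.ofReal_ne_top]
  refine setLIntegral_congr_fun measurableSet_Ioi fun r hr => ?_
  have hr0 : 0 < r := hr
  rw [lintegral_axial (fun v => F (!₂[r, 0, 0], v))
    (hF.comp (measurable_const.prodMk measurable_id))]
  · simp_rw [lintegral_rho r hr0]
    rw [lintegral_const_mul' _ _ ENNReal.ofReal_ne_top, ← mul_assoc, ← mul_assoc,
      ← ENNReal.ofReal_mul (by positivity), ← ENNReal.ofReal_mul (by positivity)]
    congr 2
    field_simp
  · intro w a b
    refine hsymm.eq rfl ?_ ?_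
    · refine (sq_eq_sq₀ (norm_nonneg _) (norm_nonneg _)).1 ?_
      simp only [EuclideanSpace.real_norm_sq_eq, Fin.sum_univ_three]
      simp [Real.sq_sqrt (by positivity : 0 ≤ a ^ 2 + b ^ 2)]
      ring
    · simp [PiLp.inner_apply, Fin.sum_univ_three]

/-- E = w²/2 + c gives dw = dE/|w|; the two signs of w become the outgoing and the ingoing branch.
-/
theorem lintegral_energy_substitution (c : ℝ) (f : ℝ → ℝ≥0∞) (hf : Measurable f) :
    ∫⁻ w : ℝ, f w = ∫⁻ E in Set.Ioi c, ENNReal.ofReal (1 / √(2 * E - 2 * c)) *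
      (f √(2 * E - 2 * c) + f (-√(2 * E - 2 * c))) := by
  have himage : (fun w : ℝ => w ^ 2 / 2 + c) '' Set.Ioi 0 = Set.Ioi c := by
    ext E
    constructor
    · rintro ⟨w, hw, rfl⟩
      have : 0 < w := hw
      exact Set.mem_Ioi.2 (by have := pow_pos this 2; linarith)
    · intro hE
      have h0 : 0 < 2 * E - 2 * c := by have : c < E := hE; linarith
      refine ⟨√(2 * E - 2 * c), Real.sqrt_pos.2 h0, ?_⟩
      simp only
      rw [Real.sq_sqrt h0.le]
      ring
  have hinj : Set.InjOn (fun w : ℝ => w ^ 2 / 2 + c) (Set.Ioi 0) := by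
    intro a ha b hb hab
    have ha : 0 < a := ha
    have hb : 0 < b := hb
    simp only at hab
    exact (sq_eq_sq₀ ha.le hb.le).1 (by linarith)
  have key := lintegral_image_eq_lintegral_abs_deriv_mul (s := Set.Ioi (0 : ℝ))
    (f := fun w : ℝ => w ^ 2 / 2 + c) (f' := fun w => w) measurableSet_Ioi
    (fun w _ => by
      simpa using ((((hasDerivAt_pow 2 w).div_const 2).add_const c).hasDerivWithinAt))
    hinj (fun E => ENNReal.ofReal (1 / √(2 * E - 2 * c)) *
      (f √(2 * E - 2 * c) + f (-√(2 * E - 2 * c))))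
  rw [himage] at key
  rw [key]
  have h1 : ∫⁻ w in Set.Ioi (0 : ℝ), ENNReal.ofReal |w| *
      (ENNReal.ofReal (1 / √(2 * (w ^ 2 / 2 + c) - 2 * c)) *
      (f √(2 * (w ^ 2 / 2 + c) - 2 * c) + f (-√(2 * (w ^ 2 / 2 + c) - 2 * c)))) =
      ∫⁻ w in Set.Ioi (0 : ℝ), (f w + f (-w)) := by
    refine setLIntegral_congr_fun measurableSet_Ioi fun w hw => ?_
    have h0 : 0 < w := hw
    rw [show 2 * (w ^ 2 / 2 + c) - 2 * c = w ^ 2 by ring, Real.sqrt_sq h0.le, abs_of_pos h0,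
      ← mul_assoc, ← ENNReal.ofReal_mul h0.le, mul_one_div_cancel h0.ne', ENNReal.ofReal_one,
      one_mul]
  rw [h1, lintegral_add_left hf, ← lintegral_add_compl f (measurableSet_Ioi (a := (0 : ℝ))),
    Set.compl_Ioi]
  congr 1
  rw [Measure.restrict_congr_set Iio_ae_eq_Iic.symm]
  have := (Measure.measurePreserving_neg (volume : Measure ℝ)).setLIntegral_comp_preimage
    (measurableSet_Iio (a := (0 : ℝ))) hf
  rw [← this]
  simp

namespace RadialSteadyState

open Set

variable (S : RadialSteadyState)

/-! ### Energy and angular momentum -/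

theorem energy_eq (p : Phase) : energy S.U p = ‖p.2‖ ^ 2 / 2 + S.u ‖p.1‖ := by
  rw [energy, S.U_eq]

theorem continuous_energy : Continuous (energy S.U) := by
  have h : energy S.U = fun p => ‖p.2‖ ^ 2 / 2 + S.u ‖p.1‖ := funext S.energy_eq
  have hu := S.continuous_u
  rw [h]
  fun_prop

theorem rotationInvariant_energy : RotationInvariant (energy S.U) := fun A _ x v => by
  simp [energy_eq]

/-- The energy-angular momentum map. -/
def energyAngMom (p : Phase) : ℝ × ℝ := (energy S.U p, angMom p)

theorem continuous_energyAngMom : Continuous S.energyAngMom :=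
  S.continuous_energy.prodMk continuous_angMom

theorem rotationInvariant_energyAngMom : RotationInvariant S.energyAngMom := fun A hA x v =>
  Prod.ext (S.rotationInvariant_energy A hA x v) (rotationInvariant_angMom A hA x v)

theorem Ω₀_eq : S.Ω₀ = S.energyAngMom ⁻¹' S.posSet := rfl

theorem isOpen_Ω₀ : IsOpen S.Ω₀ := S.isOpen_posSet.preimage S.continuous_energyAngMom

/-- The points of the orbits: `σ = 1` for increasing and `σ = -1` for decreasing radius. -/
def orbitPoint (σ : ℝ) (q : (ℝ × ℝ) × ℝ) : Phase :=
  planar q.2 (σ * S.speed q.1 q.2) (√q.1.2 / q.2)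

/-- The set of pairs of an energy-angular momentum pair and a radius on the corresponding orbit. -/
def orbitRegion : Set ((ℝ × ℝ) × ℝ) := {q | 0 < q.2 ∧ 0 < q.1.2 ∧ S.Ψ q.1.2 q.2 < q.1.1}

theorem measurable_Ψ : Measurable fun q : (ℝ × ℝ) × ℝ => S.Ψ q.1.2 q.2 := by
  have hu := S.continuous_u.measurable
  simp only [Ψ_eq]
  fun_prop

theorem measurable_speed : Measurable fun q : (ℝ × ℝ) × ℝ => S.speed q.1 q.2 := by
  have h := S.measurable_Ψ
  unfold speed
  fun_prop

theorem measurable_orbitPoint (σ : ℝ) : Measurable (S.orbitPoint σ) := by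
  have h := S.measurable_speed
  exact continuous_planar.measurable.comp (by fun_prop :
    Measurable fun q : (ℝ × ℝ) × ℝ => (q.2, σ * S.speed q.1 q.2, √q.1.2 / q.2))

theorem measurableSet_orbitRegion : MeasurableSet S.orbitRegion := by
  have h := S.measurable_Ψ
  exact (measurableSet_lt measurable_const measurable_snd).inter
    ((measurableSet_lt measurable_const measurable_fst.snd).inter
      (measurableSet_lt h measurable_fst.fst))

variable {S} in
theorem speed_sq {y : ℝ × ℝ} {r : ℝ} (h : S.Ψ y.2 r ≤ y.1) :
    S.speed y r ^ 2 = 2 * y.1 - 2 * S.Ψ y.2 r := by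
  rw [speed, Real.sq_sqrt]
  linarith

theorem energyAngMom_orbitPoint {σ : ℝ} (hσ : σ ^ 2 = 1) {y : ℝ × ℝ} {r : ℝ} (hr : 0 < r)
    (hL : 0 ≤ y.2) (h : S.Ψ y.2 r ≤ y.1) : S.energyAngMom (S.orbitPoint σ (y, r)) = y := by
  refine Prod.ext ?_ ?_
  · change energy S.U (S.orbitPoint σ (y, r)) = y.1
    rw [energy_eq, orbitPoint, norm_planar_fst, norm_sq_planar_snd, mul_pow, hσ, one_mul,
      speed_sq h, div_pow, Real.sq_sqrt hL, abs_of_pos hr, Ψ_eq]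
    field_simp
    ring
  · change angMom (S.orbitPoint σ (y, r)) = y.2
    rw [orbitPoint, angMom_planar, mul_div_cancel₀ _ hr.ne', Real.sq_sqrt hL]

/-- The difference of the two sides is the radial kinetic energy (x·v)²/(2|x|²). -/
theorem energy_ge {p : Phase} (hp : p.1 ≠ 0) : S.Ψ (angMom p) ‖p.1‖ ≤ energy S.U p := by
  have h0 : 0 < ‖p.1‖ := norm_pos_iff.2 hp
  have h1 : angMom p / (2 * ‖p.1‖ ^ 2) ≤ ‖p.2‖ ^ 2 / 2 := by
    rw [angMom_eq, div_le_div_iff₀ (by positivity) (by norm_num)]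
    nlinarith [sq_nonneg (inner ℝ p.1 p.2)]
  rw [energy_eq, Ψ_eq]
  linarith

theorem orbitSet_subset_ΩEL : S.orbitSet ⊆ S.ΩEL := by
  rintro y ⟨hy, hL, r, hr, hΨ⟩
  have h := S.energyAngMom_orbitPoint (σ := 1) (by norm_num) hr hL.le hΨ.le
  refine ⟨S.orbitPoint 1 (y, r), ?_, h⟩
  rw [Ω₀_eq, mem_preimage, h]
  exact hy

/-- What separates `ΩEL` from `orbitSet` are purely radial motions (L = 0) and circular orbits (E at
the minimum of Ψ_L). Neither is interior: L cannot be lowered below 0, nor E below the minimum. -/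
theorem interior_ΩEL : interior S.ΩEL = S.orbitSet := by
  refine Subset.antisymm (fun y hy => ?_) (interior_maximal S.orbitSet_subset_ΩEL S.isOpen_orbitSet)
  obtain ⟨ε, hε, hball⟩ := Metric.isOpen_iff.1 isOpen_interior y hy
  have hmem : ∀ a b : ℝ, |a| < ε → |b| < ε → (y.1 + a, y.2 + b) ∈ S.ΩEL := fun a b ha hb =>
    interior_subset (hball (by
      rw [Metric.mem_ball, Prod.dist_eq, max_lt_iff, Real.dist_eq, Real.dist_eq]
      simpa using ⟨ha, hb⟩))
  have hL : 0 < y.2 := by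
    obtain ⟨p, -, hp⟩ := hmem 0 (-(ε / 2)) (by simpa) (by rw [abs_neg, abs_of_pos] <;> linarith)
    have h1 : angMom p = y.2 + -(ε / 2) := congrArg Prod.snd hp
    linarith [angMom_nonneg p]
  refine ⟨?_, hL, ?_⟩
  · obtain ⟨p, hp, hpy⟩ := hmem 0 0 (by simpa) (by simpa)
    have : S.energyAngMom p = y := by
      rw [add_zero, add_zero] at hpy
      exact hpy
    rw [← this]
    exact hp
  · obtain ⟨p, -, hp⟩ := hmem (-(ε / 2)) 0 (by rw [abs_neg, abs_of_pos] <;> linarith) (by simpa)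
    have h1 : angMom p = y.2 + 0 := congrArg Prod.snd hp
    have h2 : energy S.U p = y.1 + -(ε / 2) := congrArg Prod.fst hp
    have hp0 : p.1 ≠ 0 := by
      intro h
      rw [angMom_eq, h] at h1
      simp at h1
      linarith
    refine ⟨‖p.1‖, norm_pos_iff.2 hp0, ?_⟩
    have := S.energy_ge hp0
    rw [h1, h2, add_zero] at this
    linarith

/-! ### The weight -/

/-- The weight `1 / |φ'|` on the set of positive density, times a normalization constant. -/
def weight : ℝ × ℝ → ℝ :=
  S.posSet.indicator fun y => sphereConst.toReal * (1 / |S.φ' y.1 y.2|)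

theorem sphereConst_toReal_pos : 0 < sphereConst.toReal :=
  ENNReal.toReal_pos sphereConst_ne_zero sphereConst_ne_top

theorem weight_pos {y : ℝ × ℝ} (hy : y ∈ S.posSet) : 0 < S.weight y := by
  rw [weight, indicator_of_mem hy]
  exact mul_pos sphereConst_toReal_pos (one_div_pos.2 (abs_pos.2 (S.isAdmissible.deriv_ne _ _ hy)))

theorem weight_nonneg (y : ℝ × ℝ) : 0 ≤ S.weight y := by
  by_cases hy : y ∈ S.posSet
  · exact (S.weight_pos hy).le
  · rw [weight, indicator_of_notMem hy]

theorem continuousOn_weight : ContinuousOn S.weight S.posSet := by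
  have h : ContinuousOn (fun y : ℝ × ℝ => sphereConst.toReal * (1 / |S.φ' y.1 y.2|)) S.posSet :=
    continuousOn_const.mul (continuousOn_const.div S.isAdmissible.continuousOn.abs
      fun y hy => (abs_pos.2 (S.isAdmissible.deriv_ne _ _ hy)).ne')
  exact h.congr fun y hy => indicator_of_mem hy _

theorem _root_.VlasovPoisson.measurable_indicator_of_continuousOn {X : Type*} [TopologicalSpace X]
    [MeasurableSpace X] [BorelSpace X] {s : Set X} (hs : MeasurableSet s) {f : X → ℝ}
    (hf : ContinuousOn f s) : Measurable (s.indicator f) := by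
  classical
  rw [← piecewise_eq_indicator]
  exact ContinuousOn.measurable_piecewise hf continuousOn_const hs

theorem measurable_weight : Measurable S.weight := by
  have h := measurable_indicator_of_continuousOn S.isOpen_posSet.measurableSet S.continuousOn_weight
  have h2 : S.posSet.indicator S.weight = S.weight := by
    rw [weight, indicator_indicator, inter_self]
  rwa [h2] at h

/-- The constant put into `weight` is compensated by the factor in front; it cancels against the one
in `lintegral_planar`, so the orbit formulas are free of constants. -/
theorem ν_eq : S.ν = sphereConst⁻¹ •
    (volume.withDensity fun p => ENNReal.ofReal (S.weight (S.energyAngMom p))) := by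
  rw [ν, ← withDensity_indicator S.isOpen_Ω₀.measurableSet, ← withDensity_smul]
  · congr 1
    funext p
    by_cases hp : p ∈ S.Ω₀
    · rw [indicator_of_mem hp, Pi.smul_apply, weight, indicator_of_mem (by exact hp),
        ENNReal.ofReal_mul sphereConst_toReal_pos.le, ENNReal.ofReal_toReal sphereConst_ne_top,
        smul_eq_mul, ← mul_assoc, ENNReal.inv_mul_cancel sphereConst_ne_zero sphereConst_ne_top,
        one_mul]
      rfl
    · rw [indicator_of_notMem hp, Pi.smul_apply, weight, indicator_of_notMem (by exact hp)]
      simp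
  · exact (S.measurable_weight.comp S.continuous_energyAngMom.measurable).ennreal_ofReal

/-- The density of the measure `orbitMeasure`. -/
def orbitDensity (q : (ℝ × ℝ) × ℝ) : ℝ :=
  S.orbitRegion.indicator (fun q => S.weight q.1 * (1 / S.speed q.1 q.2)) q

theorem orbitDensity_nonneg (q : (ℝ × ℝ) × ℝ) : 0 ≤ S.orbitDensity q :=
  indicator_nonneg (fun _ _ => mul_nonneg (S.weight_nonneg _)
    (one_div_nonneg.2 (Real.sqrt_nonneg _))) q

theorem measurable_orbitDensity : Measurable S.orbitDensity := by
  have h1 := S.measurable_weight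
  have h2 := S.measurable_speed
  exact Measurable.indicator (by fun_prop) S.measurableSet_orbitRegion

/-- The measure on the set of orbit points which represents the weighted measure. -/
def orbitMeasure : Measure ((ℝ × ℝ) × ℝ) :=
  volume.withDensity fun q => ENNReal.ofReal (S.orbitDensity q)

theorem lintegral_orbitMeasure {h : (ℝ × ℝ) × ℝ → ℝ≥0∞} (hh : Measurable h) :
    ∫⁻ q, h q ∂S.orbitMeasure = ∫⁻ q, ENNReal.ofReal (S.orbitDensity q) * h q :=
  lintegral_withDensity_eq_lintegral_mul _ S.measurable_orbitDensity.ennreal_ofReal hh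

theorem orbitDensity_of_nonpos_radius {r : ℝ} (hr : ¬ 0 < r) (y : ℝ × ℝ) :
    S.orbitDensity (y, r) = 0 := indicator_of_notMem (fun h => hr h.1) _

/-- At fixed radius, w is traded for E at each fixed L, and the two signs of w become the two orbit
points. G takes (E, L) as a separate argument so that these values can be simplified after the
substitution. -/
theorem lintegral_planar_slice {G : ℝ × ℝ → Phase → ℝ≥0∞}
    (hG : Measurable fun q : (ℝ × ℝ) × Phase => G q.1 q.2) {r : ℝ} (hr : 0 < r) :
    ∫⁻ w : ℝ, ∫⁻ L in Ioi (0 : ℝ), G (S.energyAngMom (planar r w (√L / r))) (planar r w (√L / r)) =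
      ∫⁻ L : ℝ, ∫⁻ E : ℝ, S.orbitRegion.indicator (fun q => ENNReal.ofReal (1 / S.speed q.1 q.2) *
        (G q.1 (S.orbitPoint 1 q) + G q.1 (S.orbitPoint (-1) q))) ((E, L), r) := by
  have hpl : Measurable fun q : ℝ × ℝ => planar r q.1 (√q.2 / r) :=
    continuous_planar.measurable.comp (by fun_prop : Measurable fun q : ℝ × ℝ => (r, q.1, √q.2 / r))
  have hGr : Measurable fun q : ℝ × ℝ =>
      G (S.energyAngMom (planar r q.1 (√q.2 / r))) (planar r q.1 (√q.2 / r)) :=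
    hG.comp ((S.continuous_energyAngMom.measurable.comp hpl).prodMk hpl)
  rw [lintegral_lintegral_swap hGr.aemeasurable, ← lintegral_indicator measurableSet_Ioi]
  refine lintegral_congr fun L => ?_
  by_cases hL : 0 < L
  swap
  · rw [indicator_of_notMem (show L ∉ Ioi 0 from hL)]
    have : ∀ E, ((E, L), r) ∉ S.orbitRegion := fun E h => hL h.2.1
    simp only [indicator_of_notMem (this _), lintegral_zero]
  have hGL : Measurable fun w : ℝ =>
      G (S.energyAngMom (planar r w (√L / r))) (planar r w (√L / r)) :=
    have h : Measurable fun w : ℝ => planar r w (√L / r) :=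
      continuous_planar.measurable.comp (by fun_prop : Measurable fun w : ℝ => (r, w, √L / r))
    hG.comp ((S.continuous_energyAngMom.measurable.comp h).prodMk h)
  rw [indicator_of_mem (mem_Ioi.2 hL), lintegral_energy_substitution (S.Ψ L r) _ hGL,
    ← lintegral_indicator measurableSet_Ioi]
  refine lintegral_congr fun E => ?_
  by_cases hE : S.Ψ L r < E
  swap
  · have hmem : ((E, L), r) ∉ S.orbitRegion := fun h => hE h.2.2
    rw [indicator_of_notMem (show E ∉ Ioi (S.Ψ L r) from hE), indicator_of_notMem hmem]
  have e1 := S.energyAngMom_orbitPoint (σ := 1) (y := (E, L)) (by norm_num) hr hL.le hE.le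
  have e2 := S.energyAngMom_orbitPoint (σ := -1) (y := (E, L)) (by norm_num) hr hL.le hE.le
  have p1 : S.orbitPoint 1 ((E, L), r) = planar r √(2 * E - 2 * S.Ψ L r) (√L / r) := by
    simp [orbitPoint, speed]
  have p2 : S.orbitPoint (-1) ((E, L), r) = planar r (-√(2 * E - 2 * S.Ψ L r)) (√L / r) := by
    simp [orbitPoint, speed]
  have hmem : ((E, L), r) ∈ S.orbitRegion := ⟨hr, hL, hE⟩
  rw [indicator_of_mem (mem_Ioi.2 hE), indicator_of_mem hmem, ← p1, ← p2, e1, e2]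
  rfl

/-- Integration over phase space in terms of the orbits. -/
theorem lintegral_ν {F : Phase → ℝ≥0∞} (hF : Measurable F) (hsymm : RotationInvariant F) :
    ∫⁻ p, F p ∂S.ν =
      ∫⁻ q, (F (S.orbitPoint 1 q) + F (S.orbitPoint (-1) q)) ∂S.orbitMeasure := by
  have hW : Measurable fun p => ENNReal.ofReal (S.weight (S.energyAngMom p)) :=
    (S.measurable_weight.comp S.continuous_energyAngMom.measurable).ennreal_ofReal
  have hG : Measurable fun p => ENNReal.ofReal (S.weight (S.energyAngMom p)) * F p := hW.mul hF
  have hG' : Measurable fun q : (ℝ × ℝ) × Phase => ENNReal.ofReal (S.weight q.1) * F q.2 :=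
    (S.measurable_weight.comp measurable_fst).ennreal_ofReal.mul (hF.comp measurable_snd)
  have hGs : RotationInvariant fun p => ENNReal.ofReal (S.weight (S.energyAngMom p)) * F p :=
    fun A hA x v => by
      simp only [hsymm A hA x v, S.rotationInvariant_energyAngMom A hA x v]
  have h1 : ∫⁻ p, F p ∂S.ν = ∫⁻ r in Ioi (0 : ℝ), ∫⁻ w : ℝ, ∫⁻ L in Ioi (0 : ℝ),
      ENNReal.ofReal (S.weight (S.energyAngMom (planar r w (√L / r)))) *
        F (planar r w (√L / r)) := by
    rw [ν_eq, lintegral_smul_measure, lintegral_withDensity_eq_lintegral_mul _ hW hF]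
    simp only [Pi.mul_apply]
    rw [lintegral_planar hG hGs, smul_eq_mul, ← mul_assoc,
      ENNReal.inv_mul_cancel sphereConst_ne_zero sphereConst_ne_top, one_mul]
  have hFF : Measurable fun q => F (S.orbitPoint 1 q) + F (S.orbitPoint (-1) q) :=
    (hF.comp (S.measurable_orbitPoint 1)).add (hF.comp (S.measurable_orbitPoint (-1)))
  have hDF : Measurable fun q => ENNReal.ofReal (S.orbitDensity q) *
      (F (S.orbitPoint 1 q) + F (S.orbitPoint (-1) q)) :=
    S.measurable_orbitDensity.ennreal_ofReal.mul hFF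
  rw [h1, lintegral_orbitMeasure _ hFF, Measure.volume_eq_prod,
    lintegral_prod_symm _ hDF.aemeasurable, ← lintegral_indicator measurableSet_Ioi]
  refine lintegral_congr fun r => ?_
  by_cases hr : 0 < r
  swap
  · rw [indicator_of_notMem (show r ∉ Ioi 0 from hr)]
    simp only [S.orbitDensity_of_nonpos_radius hr, ENNReal.ofReal_zero, zero_mul, lintegral_zero]
  have hDr : Measurable fun y : ℝ × ℝ => ENNReal.ofReal (S.orbitDensity (y, r)) *
      (F (S.orbitPoint 1 (y, r)) + F (S.orbitPoint (-1) (y, r))) :=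
    hDF.comp measurable_prodMk_right
  rw [indicator_of_mem (mem_Ioi.2 hr), Measure.volume_eq_prod, lintegral_prod_symm _ hDr.aemeasurable,
    S.lintegral_planar_slice (G := fun y p => ENNReal.ofReal (S.weight y) * F p) hG' hr]
  refine lintegral_congr fun L => lintegral_congr fun E => ?_
  rw [orbitDensity]
  by_cases hmem : ((E, L), r) ∈ S.orbitRegion
  · rw [indicator_of_mem hmem, indicator_of_mem hmem, ENNReal.ofReal_mul (S.weight_nonneg _)]
    ring
  · rw [indicator_of_notMem hmem, indicator_of_notMem hmem, ENNReal.ofReal_zero, zero_mul]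

end RadialSteadyState

namespace RadialSteadyState

open Set

variable (S : RadialSteadyState)

/-! ### Orbit integrals -/

variable {S} in
theorem mem_orbitRegion_iff {y : ℝ × ℝ} (hy : y ∈ S.orbitSet) {r : ℝ} :
    (y, r) ∈ S.orbitRegion ↔ r ∈ Ioo (S.rMinus y.1 y.2) (S.rPlus y.1 y.2) := by
  constructor
  · rintro ⟨hr, -, h⟩
    exact (Ψ_lt_iff hy hr).1 h
  · intro h
    have hr := (rMinus_pos hy).trans h.1
    exact ⟨hr, hy.2.1, (Ψ_lt_iff hy hr).2 h⟩

/-- The radii which occur on an orbit. -/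
def radii (y : ℝ × ℝ) : Set ℝ := Ioo (S.rMinus y.1 y.2) (S.rPlus y.1 y.2)

theorem measurableSet_radii (y : ℝ × ℝ) : MeasurableSet (S.radii y) := measurableSet_Ioo

variable {S} in
theorem orbitDensity_of_mem {y : ℝ × ℝ} (hy : y ∈ S.orbitSet) (r : ℝ) :
    S.orbitDensity (y, r) = (S.radii y).indicator (fun r => S.weight y * (1 / S.speed y r)) r := by
  rw [orbitDensity]
  by_cases hr : r ∈ S.radii y
  · rw [indicator_of_mem hr, indicator_of_mem ((mem_orbitRegion_iff hy).2 hr)]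
  · rw [indicator_of_notMem hr, indicator_of_notMem fun h => hr ((mem_orbitRegion_iff hy).1 h)]

theorem orbitDensity_of_notMem {y : ℝ × ℝ} (hy : y ∉ S.orbitSet) (r : ℝ) :
    S.orbitDensity (y, r) = 0 := by
  rw [orbitDensity]
  by_cases hr : (y, r) ∈ S.orbitRegion
  · have h : y ∉ S.posSet := fun h => hy ⟨h, hr.2.1, r, hr.1, hr.2.2⟩
    rw [indicator_of_mem hr, weight, indicator_of_notMem (by exact h), zero_mul]
  · rw [indicator_of_notMem hr]

theorem measurableSet_orbitSet : MeasurableSet S.orbitSet := S.isOpen_orbitSet.measurableSet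

theorem lintegral_orbitMeasure_iterated {h : (ℝ × ℝ) × ℝ → ℝ≥0∞} (hh : Measurable h) :
    ∫⁻ q, h q ∂S.orbitMeasure = ∫⁻ y in S.orbitSet, ENNReal.ofReal (S.weight y) *
      ∫⁻ r in S.radii y, ENNReal.ofReal (1 / S.speed y r) * h (y, r) := by
  have hD : Measurable fun q => ENNReal.ofReal (S.orbitDensity q) * h q :=
    S.measurable_orbitDensity.ennreal_ofReal.mul hh
  rw [lintegral_orbitMeasure _ hh, Measure.volume_eq_prod, lintegral_prod _ hD.aemeasurable,
    ← lintegral_indicator S.measurableSet_orbitSet]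
  refine lintegral_congr fun y => ?_
  by_cases hy : y ∈ S.orbitSet
  · rw [indicator_of_mem hy, ← lintegral_const_mul' _ _ ENNReal.ofReal_ne_top,
      ← lintegral_indicator (S.measurableSet_radii y)]
    refine lintegral_congr fun r => ?_
    rw [orbitDensity_of_mem hy]
    by_cases hr : r ∈ S.radii y
    · rw [indicator_of_mem hr, indicator_of_mem hr, ENNReal.ofReal_mul (S.weight_nonneg _), mul_assoc]
    · rw [indicator_of_notMem hr, indicator_of_notMem hr, ENNReal.ofReal_zero, zero_mul]
  · rw [indicator_of_notMem hy]
    simp only [S.orbitDensity_of_notMem hy, ENNReal.ofReal_zero, zero_mul, lintegral_zero]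

theorem integrable_orbitMeasure_iff {h : (ℝ × ℝ) × ℝ → ℝ} :
    Integrable h S.orbitMeasure ↔ Integrable fun q => S.orbitDensity q * h q := by
  rw [orbitMeasure, integrable_withDensity_iff_integrable_smul'
    S.measurable_orbitDensity.ennreal_ofReal (by simp)]
  simp only [ENNReal.toReal_ofReal (S.orbitDensity_nonneg _), smul_eq_mul]

/-- The integral of a function over an orbit with respect to the travel time. -/
def orbitIntegral (h : (ℝ × ℝ) × ℝ → ℝ) (y : ℝ × ℝ) : ℝ :=
  ∫ r in S.radii y, h (y, r) / S.speed y r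

theorem integral_orbitDensity_mul (h : (ℝ × ℝ) × ℝ → ℝ) (y : ℝ × ℝ) :
    ∫ r, S.orbitDensity (y, r) * h (y, r) =
      S.orbitSet.indicator (fun y => S.weight y * S.orbitIntegral h y) y := by
  by_cases hy : y ∈ S.orbitSet
  · rw [indicator_of_mem hy, orbitIntegral, ← integral_const_mul,
      ← integral_indicator (S.measurableSet_radii y)]
    refine integral_congr_ae (Eventually.of_forall fun r => ?_)
    simp only [orbitDensity_of_mem hy]
    by_cases hr : r ∈ S.radii y
    · rw [indicator_of_mem hr, indicator_of_mem hr]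
      ring
    · rw [indicator_of_notMem hr, indicator_of_notMem hr, zero_mul]
  · rw [indicator_of_notMem hy]
    simp only [S.orbitDensity_of_notMem hy, zero_mul, integral_zero]

variable {S} in
theorem integral_orbitMeasure {h : (ℝ × ℝ) × ℝ → ℝ} (hi : Integrable h S.orbitMeasure) :
    ∫ q, h q ∂S.orbitMeasure = ∫ y in S.orbitSet, S.weight y * S.orbitIntegral h y := by
  have h1 := S.integrable_orbitMeasure_iff.1 hi
  rw [orbitMeasure, integral_withDensity_eq_integral_toReal_smul
    S.measurable_orbitDensity.ennreal_ofReal (by simp)]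
  simp only [ENNReal.toReal_ofReal (S.orbitDensity_nonneg _), smul_eq_mul]
  rw [Measure.volume_eq_prod, integral_prod _ h1, ← integral_indicator S.measurableSet_orbitSet]
  exact integral_congr_ae (Eventually.of_forall fun y => S.integral_orbitDensity_mul h y)

variable {S} in
theorem integrableOn_weight_mul_orbitIntegral {h : (ℝ × ℝ) × ℝ → ℝ}
    (hi : Integrable h S.orbitMeasure) :
    IntegrableOn (fun y => S.weight y * S.orbitIntegral h y) S.orbitSet := by
  have h1 := S.integrable_orbitMeasure_iff.1 hi
  rw [← integrable_indicator_iff S.measurableSet_orbitSet]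
  refine h1.integral_prod_left.congr (Eventually.of_forall fun y => ?_)
  exact S.integral_orbitDensity_mul h y

variable {S} in
theorem ae_integrableOn_div_speed {h : (ℝ × ℝ) × ℝ → ℝ} (hi : Integrable h S.orbitMeasure) :
    ∀ᵐ y, y ∈ S.orbitSet → IntegrableOn (fun r => h (y, r) / S.speed y r) (S.radii y) := by
  have h1 := S.integrable_orbitMeasure_iff.1 hi
  rw [Measure.volume_eq_prod] at h1
  filter_upwards [h1.prod_right_ae] with y hint hy
  have h2 := (hint.const_mul (S.weight y)⁻¹).integrableOn (s := S.radii y)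
  refine h2.congr_fun (fun r hr => ?_) (S.measurableSet_radii y)
  have hW := (S.weight_pos hy.1).ne'
  simp only [orbitDensity_of_mem hy]
  rw [indicator_of_mem hr]
  field_simp

/-! ### Rotation invariant functions and the orbit measure -/

variable {S} in
theorem integrable_comp_orbitPoint {f : Phase → ℝ} (hf : Measurable f) (hs : RotationInvariant f)
    (hi : Integrable f S.ν) : Integrable (fun q => f (S.orbitPoint 1 q)) S.orbitMeasure ∧
      Integrable (fun q => f (S.orbitPoint (-1) q)) S.orbitMeasure := by
  have h1 := S.lintegral_ν hf.enorm (fun A hA x v => by rw [hs A hA x v])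
  have h2 : ∫⁻ p, ‖f p‖ₑ ∂S.ν < ∞ := hi.2
  have m1 : Measurable fun q => f (S.orbitPoint 1 q) := hf.comp (S.measurable_orbitPoint 1)
  have m2 : Measurable fun q => f (S.orbitPoint (-1) q) := hf.comp (S.measurable_orbitPoint (-1))
  rw [h1, lintegral_add_left m1.enorm, ENNReal.add_lt_top] at h2
  exact ⟨⟨m1.aestronglyMeasurable, h2.1⟩, ⟨m2.aestronglyMeasurable, h2.2⟩⟩

variable {S} in
theorem integral_ν {f : Phase → ℝ} (hf : Measurable f) (hs : RotationInvariant f)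
    (hi : Integrable f S.ν) : ∫ p, f p ∂S.ν =
      ∫ q, (f (S.orbitPoint 1 q) + f (S.orbitPoint (-1) q)) ∂S.orbitMeasure := by
  obtain ⟨i1, i2⟩ := integrable_comp_orbitPoint hf hs hi
  have m1 : Measurable fun q => f (S.orbitPoint 1 q) := hf.comp (S.measurable_orbitPoint 1)
  have m2 : Measurable fun q => f (S.orbitPoint (-1) q) := hf.comp (S.measurable_orbitPoint (-1))
  have key : ∀ {F : Phase → ℝ}, Measurable F → RotationInvariant F → Integrable F S.ν →
      (∫⁻ p, ENNReal.ofReal (F p) ∂S.ν).toReal =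
        (∫⁻ q, ENNReal.ofReal (F (S.orbitPoint 1 q)) ∂S.orbitMeasure).toReal +
        (∫⁻ q, ENNReal.ofReal (F (S.orbitPoint (-1) q)) ∂S.orbitMeasure).toReal := by
    intro F hF hFs hFi
    obtain ⟨j1, j2⟩ := integrable_comp_orbitPoint hF hFs hFi
    have n1 : Measurable fun q => F (S.orbitPoint 1 q) := hF.comp (S.measurable_orbitPoint 1)
    rw [S.lintegral_ν hF.ennreal_ofReal (fun A hA x v => by rw [hFs A hA x v]),
      lintegral_add_left n1.ennreal_ofReal, ENNReal.toReal_add]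
    · exact ((lintegral_mono fun q => Real.ofReal_le_enorm _).trans_lt j1.2).ne
    · exact ((lintegral_mono fun q => Real.ofReal_le_enorm _).trans_lt j2.2).ne
  rw [integral_add i1 i2, integral_eq_lintegral_pos_part_sub_lintegral_neg_part hi,
    integral_eq_lintegral_pos_part_sub_lintegral_neg_part i1,
    integral_eq_lintegral_pos_part_sub_lintegral_neg_part i2, key hf hs hi,
    key (F := fun p => -f p) hf.neg (fun A hA x v => by simp only [hs A hA x v]) hi.neg]
  ring

variable {S} in
theorem memLp_comp_orbitPoint {f : Phase → ℝ} (hf : Measurable f) (hs : RotationInvariant f)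
    (hi : MemLp f 2 S.ν) : MemLp (fun q => f (S.orbitPoint 1 q)) 2 S.orbitMeasure ∧
      MemLp (fun q => f (S.orbitPoint (-1) q)) 2 S.orbitMeasure := by
  have m1 : Measurable fun q => f (S.orbitPoint 1 q) := hf.comp (S.measurable_orbitPoint 1)
  have m2 : Measurable fun q => f (S.orbitPoint (-1) q) := hf.comp (S.measurable_orbitPoint (-1))
  have h := integrable_comp_orbitPoint (hf.pow_const 2)
    (fun A hA x v => by simp only [hs A hA x v]) hi.integrable_sq
  exact ⟨(memLp_two_iff_integrable_sq m1.aestronglyMeasurable).2 h.1,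
    (memLp_two_iff_integrable_sq m2.aestronglyMeasurable).2 h.2⟩

theorem ae_orbitMeasure_mem : ∀ᵐ q ∂S.orbitMeasure, q.1 ∈ S.orbitSet ∧ q.2 ∈ S.radii q.1 := by
  have hm : MeasurableSet {q : (ℝ × ℝ) × ℝ | q.1 ∈ S.orbitSet ∧ q ∈ S.orbitRegion} :=
    (measurable_fst S.measurableSet_orbitSet).inter S.measurableSet_orbitRegion
  have h : ∀ᵐ q ∂S.orbitMeasure, q.1 ∈ S.orbitSet ∧ q ∈ S.orbitRegion := by
    rw [orbitMeasure, ae_withDensity_iff S.measurable_orbitDensity.ennreal_ofReal]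
    refine Eventually.of_forall fun q hq => ?_
    by_contra hcon
    refine hq ?_
    rw [ENNReal.ofReal_eq_zero]
    refine le_of_eq ?_
    by_cases h1 : q.1 ∈ S.orbitSet
    · exact indicator_of_notMem (fun h2 => hcon ⟨h1, h2⟩) _
    · exact S.orbitDensity_of_notMem h1 q.2
  filter_upwards [h] with q hq
  exact ⟨hq.1, (mem_orbitRegion_iff hq.1).1 hq.2⟩

variable {S} in
theorem energyAngMom_orbitPoint_of_mem {σ : ℝ} (hσ : σ ^ 2 = 1) {q : (ℝ × ℝ) × ℝ}
    (hy : q.1 ∈ S.orbitSet) (hr : q.2 ∈ S.radii q.1) :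
    S.energyAngMom (S.orbitPoint σ q) = q.1 :=
  have h := (mem_orbitRegion_iff hy).2 hr
  S.energyAngMom_orbitPoint hσ h.1 h.2.1.le h.2.2.le

/-! ### The period and the energy measure -/

/-- The period, set to zero off the set of non-circular orbits. -/
def period : ℝ × ℝ → ℝ := S.orbitSet.indicator fun y => S.T y.1 y.2

theorem continuousOn_T : ContinuousOn (fun y : ℝ × ℝ => S.T y.1 y.2) S.orbitSet := fun _ hy =>
  (continuousAt_T hy).continuousWithinAt

theorem measurable_period : Measurable S.period :=
  measurable_indicator_of_continuousOn S.measurableSet_orbitSet S.continuousOn_T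

variable {S} in
theorem period_of_mem {y : ℝ × ℝ} (hy : y ∈ S.orbitSet) : S.period y = S.T y.1 y.2 :=
  indicator_of_mem hy _

variable {S} in
theorem period_eq {y : ℝ × ℝ} (hy : y ∈ S.orbitSet) :
    S.period y = 2 * travelTime (S.rMinus y.1 y.2) (S.speed y) (S.rPlus y.1 y.2) :=
  period_of_mem hy

variable {S} in
theorem period_pos {y : ℝ × ℝ} (hy : y ∈ S.orbitSet) : 0 < S.period y := by
  rw [period_of_mem hy]
  exact T_pos hy

/-- The distribution of energy and angular momentum with respect to the weighted measure. -/
def energyMeasure : Measure (ℝ × ℝ) :=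
  (volume.restrict S.orbitSet).withDensity fun y => ENNReal.ofReal (S.weight y * S.period y)

theorem measurable_weight_mul_period : Measurable fun y => S.weight y * S.period y :=
  S.measurable_weight.mul S.measurable_period

instance : SigmaFinite S.energyMeasure :=
  SigmaFinite.withDensity_ofReal _

variable {S} in
theorem lintegral_inv_speed {y : ℝ × ℝ} (hy : y ∈ S.orbitSet) :
    2 * ∫⁻ r in S.radii y, ENNReal.ofReal (1 / S.speed y r) = ENNReal.ofReal (S.period y) := by
  have h := isOrbit hy
  rw [radii, ← ofReal_integral_eq_lintegral_ofReal h.integrableOn_inv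
    (Eventually.of_forall fun r => one_div_nonneg.2 (Real.sqrt_nonneg _)), period_eq hy,
    ENNReal.ofReal_mul (by norm_num), travelTime, intervalIntegral.integral_of_le h.lt.le,
    integral_Ioc_eq_integral_Ioo]
  simp

/-- Integrating dr/w over both branches of an orbit gives T(E, L), which is why `energyMeasure`
carries the factor `period`. -/
theorem measurePreserving_energyAngMom : MeasurePreserving S.energyAngMom S.ν S.energyMeasure := by
  refine ⟨S.continuous_energyAngMom.measurable, Measure.ext fun s hs => ?_⟩
  have hm : Measurable (s.indicator (1 : ℝ × ℝ → ℝ≥0∞)) := measurable_one.indicator hs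
  rw [Measure.map_apply S.continuous_energyAngMom.measurable hs, ← lintegral_indicator_one
    (S.continuous_energyAngMom.measurable hs), ← lintegral_indicator_one hs]
  have h1 : ∀ p, (S.energyAngMom ⁻¹' s).indicator (1 : Phase → ℝ≥0∞) p =
      s.indicator (1 : ℝ × ℝ → ℝ≥0∞) (S.energyAngMom p) := fun p => rfl
  simp only [h1]
  have hm2 : Measurable fun p => s.indicator (1 : ℝ × ℝ → ℝ≥0∞) (S.energyAngMom p) :=
    hm.comp S.continuous_energyAngMom.measurable
  have hm3 : Measurable fun q : (ℝ × ℝ) × ℝ => 2 * s.indicator (1 : ℝ × ℝ → ℝ≥0∞) q.1 :=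
    (hm.comp measurable_fst).const_mul 2
  rw [S.lintegral_ν hm2 (fun A hA x v => by
    simp only [S.rotationInvariant_energyAngMom A hA x v])]
  have h2 : ∫⁻ q, (s.indicator (1 : ℝ × ℝ → ℝ≥0∞) (S.energyAngMom (S.orbitPoint 1 q)) +
      s.indicator (1 : ℝ × ℝ → ℝ≥0∞) (S.energyAngMom (S.orbitPoint (-1) q))) ∂S.orbitMeasure =
      ∫⁻ q, 2 * s.indicator (1 : ℝ × ℝ → ℝ≥0∞) q.1 ∂S.orbitMeasure := by
    refine lintegral_congr_ae ?_
    filter_upwards [S.ae_orbitMeasure_mem] with q hq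
    rw [energyAngMom_orbitPoint_of_mem (by norm_num) hq.1 hq.2,
      energyAngMom_orbitPoint_of_mem (by norm_num) hq.1 hq.2, two_mul]
  rw [h2, lintegral_orbitMeasure_iterated _ hm3, energyMeasure,
    lintegral_withDensity_eq_lintegral_mul _ S.measurable_weight_mul_period.ennreal_ofReal hm]
  refine setLIntegral_congr_fun S.measurableSet_orbitSet fun y hy => ?_
  simp only [Pi.mul_apply]
  rw [lintegral_mul_const' _ _ (ENNReal.mul_ne_top (by simp) (by
    by_cases hys : y ∈ s <;> simp [hys])), ← mul_assoc, ← mul_assoc,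
    ENNReal.ofReal_mul (S.weight_nonneg _), ← lintegral_inv_speed hy]
  ring

theorem ae_energyMeasure_of_ae {P : ℝ × ℝ → Prop} (h : ∀ᵐ y, y ∈ S.orbitSet → P y) :
    ∀ᵐ y ∂S.energyMeasure, P y := by
  refine (withDensity_absolutelyContinuous _ _).ae_le ?_
  exact (ae_restrict_iff' S.measurableSet_orbitSet).2 h

theorem energyMeasure_lt_top {K : Set (ℝ × ℝ)} (hK : IsCompact K) (hKs : K ⊆ S.orbitSet) :
    S.energyMeasure K < ∞ := by
  have hc : ContinuousOn (fun y : ℝ × ℝ => S.weight y * S.T y.1 y.2) K :=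
    (S.continuousOn_weight.mono fun y hy => (hKs hy).1).mul (S.continuousOn_T.mono hKs)
  have hi := hc.integrableOn_compact (μ := volume) hK
  rw [energyMeasure, withDensity_apply _ hK.measurableSet, Measure.restrict_restrict hK.measurableSet,
    inter_eq_self_of_subset_left hKs]
  have h2 : ∫⁻ y in K, ENNReal.ofReal (S.weight y * S.period y) =
      ∫⁻ y in K, ENNReal.ofReal (S.weight y * S.T y.1 y.2) :=
    setLIntegral_congr_fun hK.measurableSet fun y hy => by
      simp only [period_of_mem (hKs hy)]
  rw [h2]
  exact hi.lintegral_lt_top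

/-- Through this, values of the continuous functions (2πk/T)² at single points of `orbitSet` become
points of the spectrum. -/
theorem energyMeasure_pos {O : Set (ℝ × ℝ)} (hO : IsOpen O) (hne : O.Nonempty)
    (hOs : O ⊆ S.orbitSet) : 0 < S.energyMeasure O := by
  rw [energyMeasure, withDensity_apply _ hO.measurableSet, Measure.restrict_restrict hO.measurableSet,
    inter_eq_self_of_subset_left hOs, setLIntegral_pos_iff
    S.measurable_weight_mul_period.ennreal_ofReal]
  refine (hO.measure_pos volume hne).trans_le (measure_mono fun y hy => ⟨?_, hy⟩)
  rw [Function.mem_support]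
  exact (ENNReal.ofReal_pos.2 (mul_pos (S.weight_pos (hOs hy).1) (period_pos (hOs hy)))).ne'

end RadialSteadyState

namespace RadialSteadyState

open Set InnerProductSpace

variable (S : RadialSteadyState)

/-! ### The fundamental lemma on the set of orbits -/

theorem orbitIntegral_mul (c : ℝ × ℝ → ℝ) (h : (ℝ × ℝ) × ℝ → ℝ) (y : ℝ × ℝ) :
    S.orbitIntegral (fun q => c q.1 * h q) y = c y * S.orbitIntegral h y := by
  simp only [orbitIntegral, mul_div_assoc]
  rw [integral_const_mul]

variable {S} in
-- Functions of (E, L) are constant along orbits and factor out of the orbit integral; the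
-- fundamental lemma in the (E, L) plane applies, and the weight is positive on `orbitSet`. The
-- exceptional null set depends on h.
theorem ae_orbitIntegral_eq_zero {h : (ℝ × ℝ) × ℝ → ℝ}
    (hi : ∀ K, IsCompact K → K ⊆ S.orbitSet → IntegrableOn h (Prod.fst ⁻¹' K) S.orbitMeasure)
    (h0 : ∀ χ : ℝ × ℝ → ℝ, ContDiff ℝ (⊤ : ℕ∞) χ → HasCompactSupport χ → tsupport χ ⊆ S.orbitSet →
      ∫ q, χ q.1 * h q ∂S.orbitMeasure = 0) :
    ∀ᵐ y, y ∈ S.orbitSet → S.orbitIntegral h y = 0 := by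
  have hK : ∀ K, IsCompact K → K ⊆ S.orbitSet →
      Integrable ((Prod.fst ⁻¹' K).indicator h) S.orbitMeasure := fun K hK hKs =>
    (hi K hK hKs).integrable_indicator (measurable_fst hK.measurableSet)
  have hind : ∀ (K : Set (ℝ × ℝ)) y, y ∈ K →
      S.orbitIntegral ((Prod.fst ⁻¹' K).indicator h) y = S.orbitIntegral h y := by
    intro K y hy
    have : ∀ r, (Prod.fst ⁻¹' K).indicator h (y, r) = h (y, r) := fun r =>
      indicator_of_mem (by exact hy) h
    simp only [orbitIntegral, this]
  have hloc : LocallyIntegrableOn (fun y => S.weight y * S.orbitIntegral h y) S.orbitSet := by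
    rw [locallyIntegrableOn_iff S.isOpen_orbitSet.isLocallyClosed]
    intro K hKs hKc
    refine ((integrableOn_weight_mul_orbitIntegral (hK K hKc hKs)).mono_set hKs).congr_fun
      (fun y hy => ?_) hKc.measurableSet
    simp only [hind K y hy]
  have key := S.isOpen_orbitSet.ae_eq_zero_of_integral_contDiff_smul_eq_zero hloc ?_
  · filter_upwards [key] with y hy hmem
    exact (mul_eq_zero.1 (hy hmem)).resolve_left (S.weight_pos hmem.1).ne'
  · intro χ hχ hc hs
    have e : ∀ q, χ q.1 * h q = χ q.1 * (Prod.fst ⁻¹' tsupport χ).indicator h q := by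
      intro q
      by_cases hq : q.1 ∈ tsupport χ
      · rw [indicator_of_mem (by exact hq)]
      · rw [image_eq_zero_of_notMem_tsupport hq, zero_mul, zero_mul]
    obtain ⟨B, hB⟩ := hχ.continuous.bounded_above_of_compact_support hc
    have hint : Integrable (fun q => χ q.1 * h q) S.orbitMeasure := by
      simp only [e]
      exact (hK _ hc hs).bdd_mul (hχ.continuous.comp continuous_fst).aestronglyMeasurable
        (Eventually.of_forall fun q => hB q.1)
    have h1 := h0 χ hχ hc hs
    rw [integral_orbitMeasure hint] at h1
    rw [← h1, ← integral_indicator S.measurableSet_orbitSet]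
    refine integral_congr_ae (Eventually.of_forall fun y => ?_)
    simp only [smul_eq_mul]
    by_cases hy : y ∈ S.orbitSet
    · rw [indicator_of_mem hy, orbitIntegral_mul]
      ring
    · rw [indicator_of_notMem hy, image_eq_zero_of_notMem_tsupport fun h => hy (hs h), zero_mul]

variable {S} in
-- 1/w is integrable on each orbit, h²/w on almost every one, and |h| ≤ 1 + h².
theorem ae_integrableOn_of_memLp {h : (ℝ × ℝ) × ℝ → ℝ} (hm : Measurable h)
    (hi : MemLp h 2 S.orbitMeasure) :
    ∀ᵐ y, y ∈ S.orbitSet → IntegrableOn (fun r => h (y, r) / S.speed y r) (S.radii y) := by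
  filter_upwards [ae_integrableOn_div_speed hi.integrable_sq] with y hy hmem
  have h1 := (isOrbit hmem).integrableOn_inv
  have hms : Measurable (S.speed y) := S.measurable_speed.comp measurable_prodMk_left
  refine (h1.add (hy hmem)).mono' ((hm.comp measurable_prodMk_left).div hms).aestronglyMeasurable ?_
  refine (ae_restrict_iff' (S.measurableSet_radii y)).2 (Eventually.of_forall fun r hr => ?_)
  have hw := (isOrbit hmem).pos r hr
  rw [Real.norm_eq_abs, abs_div, abs_of_pos hw, Pi.add_apply, ← add_div]
  gcongr
  nlinarith [sq_abs (h (y, r)), sq_nonneg (|h (y, r)| - 1), abs_nonneg (h (y, r))]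

/-- `orbitMeasure` counts a single branch while `energyMeasure` counts both, hence an inequality. -/
theorem orbitMeasure_fst_preimage_le {K : Set (ℝ × ℝ)} (hK : MeasurableSet K) :
    S.orbitMeasure (Prod.fst ⁻¹' K) ≤ S.energyMeasure K := by
  have hm : Measurable fun p => K.indicator (1 : ℝ × ℝ → ℝ≥0∞) (S.energyAngMom p) :=
    (measurable_one.indicator hK).comp S.continuous_energyAngMom.measurable
  have hpre : ∀ p, (S.energyAngMom ⁻¹' K).indicator (1 : Phase → ℝ≥0∞) p =
      K.indicator (1 : ℝ × ℝ → ℝ≥0∞) (S.energyAngMom p) := fun p => rfl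
  rw [← S.measurePreserving_energyAngMom.measure_preimage hK.nullMeasurableSet,
    ← lintegral_indicator_one (measurable_fst hK),
    ← lintegral_indicator_one (S.continuous_energyAngMom.measurable hK)]
  simp only [hpre]
  rw [S.lintegral_ν hm (fun A hA x v => by simp only [S.rotationInvariant_energyAngMom A hA x v])]
  refine lintegral_mono_ae ?_
  filter_upwards [S.ae_orbitMeasure_mem] with q hq
  rw [energyAngMom_orbitPoint_of_mem (by norm_num) hq.1 hq.2]
  exact le_add_right le_rfl

theorem orbitMeasure_lt_top {K : Set (ℝ × ℝ)} (hK : IsCompact K) (hKs : K ⊆ S.orbitSet) :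
    S.orbitMeasure (Prod.fst ⁻¹' K) < ∞ :=
  (S.orbitMeasure_fst_preimage_le hK.measurableSet).trans_lt (S.energyMeasure_lt_top hK hKs)

theorem quasiMeasurePreserving_fst :
    Measure.QuasiMeasurePreserving Prod.fst S.orbitMeasure S.energyMeasure := by
  refine ⟨measurable_fst, Measure.AbsolutelyContinuous.mk fun s hs h0 => ?_⟩
  rw [Measure.map_apply measurable_fst hs]
  exact le_antisymm ((S.orbitMeasure_fst_preimage_le hs).trans h0.le) (zero_le)

variable {S} in
theorem integrableOn_fst_preimage {h : (ℝ × ℝ) × ℝ → ℝ} (hi : MemLp h 2 S.orbitMeasure)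
    {K : Set (ℝ × ℝ)} (hK : IsCompact K) (hKs : K ⊆ S.orbitSet) :
    IntegrableOn h (Prod.fst ⁻¹' K) S.orbitMeasure := by
  have : IsFiniteMeasure (S.orbitMeasure.restrict (Prod.fst ⁻¹' K)) :=
    ⟨by simpa using S.orbitMeasure_lt_top hK hKs⟩
  exact (hi.restrict _).integrable (by norm_num)

/-! ### The angle variable -/

/-- The time which has passed since the last passage through the inner turning point. -/
def elapsed (q : (ℝ × ℝ) × ℝ) : ℝ :=
  ∫ s, S.orbitRegion.indicator (fun q => 1 / S.speed q.1 q.2) (q.1, s) *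
    (Iio q.2).indicator (fun _ => (1 : ℝ)) s

/-- Writing the travel time as an integral over the whole line with indicators makes joint
measurability in (E, L, r) a statement about integrals depending on a parameter, with no regularity
of the turning points involved. -/
theorem measurable_elapsed : Measurable S.elapsed := by
  have h1 : Measurable (S.orbitRegion.indicator fun q => 1 / S.speed q.1 q.2) :=
    (measurable_const.div S.measurable_speed).indicator S.measurableSet_orbitRegion
  have h2 : Measurable fun z : ((ℝ × ℝ) × ℝ) × ℝ => (Iio z.1.2).indicator (fun _ => (1 : ℝ)) z.2 := by
    have : MeasurableSet {z : ((ℝ × ℝ) × ℝ) × ℝ | z.2 < z.1.2} :=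
      measurableSet_lt measurable_snd measurable_fst.snd
    exact (measurable_const (a := (1 : ℝ))).indicator this
  have h3 : Measurable fun z : ((ℝ × ℝ) × ℝ) × ℝ =>
      S.orbitRegion.indicator (fun q => 1 / S.speed q.1 q.2) (z.1.1, z.2) *
        (Iio z.1.2).indicator (fun _ => (1 : ℝ)) z.2 :=
    (h1.comp (measurable_fst.fst.prodMk measurable_snd)).mul h2
  exact (h3.stronglyMeasurable.integral_prod_right (ν := volume)).measurable

variable {S} in
theorem elapsed_of_mem {y : ℝ × ℝ} (hy : y ∈ S.orbitSet) {r : ℝ} (hr : r ∈ S.radii y) :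
    S.elapsed (y, r) = travelTime (S.rMinus y.1 y.2) (S.speed y) r := by
  rw [elapsed, travelTime, intervalIntegral.integral_of_le hr.1.le, integral_Ioc_eq_integral_Ioo,
    ← integral_indicator measurableSet_Ioo]
  refine integral_congr_ae (Eventually.of_forall fun s => ?_)
  simp only
  by_cases hs : s ∈ Ioo (S.rMinus y.1 y.2) r
  · rw [indicator_of_mem hs, indicator_of_mem ((mem_orbitRegion_iff hy).2 ⟨hs.1, hs.2.trans hr.2⟩),
      indicator_of_mem (by exact hs.2), mul_one]
  · rw [indicator_of_notMem hs]
    by_cases hsr : s < r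
    · rw [indicator_of_notMem fun h => hs ⟨((mem_orbitRegion_iff hy).1 h).1, hsr⟩, zero_mul]
    · rw [indicator_of_notMem (s := Iio r) (by exact hsr), mul_zero]

/-- The angle variable of the radial motion, normalized to period one. -/
def angle (p : Phase) : ℝ :=
  (if 0 ≤ inner ℝ p.1 p.2 then S.elapsed (S.energyAngMom p, ‖p.1‖)
    else -S.elapsed (S.energyAngMom p, ‖p.1‖)) / S.period (S.energyAngMom p)

theorem measurable_angle : Measurable S.angle := by
  have h1 : Measurable fun p : Phase => S.elapsed (S.energyAngMom p, ‖p.1‖) :=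
    S.measurable_elapsed.comp (S.continuous_energyAngMom.measurable.prodMk (by fun_prop))
  have h2 : MeasurableSet {p : Phase | 0 ≤ inner ℝ p.1 p.2} :=
    measurableSet_le measurable_const (by fun_prop)
  exact (Measurable.ite h2 h1 h1.neg).div
    (S.measurable_period.comp S.continuous_energyAngMom.measurable)

theorem rotationInvariant_angle : RotationInvariant S.angle := fun A hA x v => by
  simp only [angle, S.rotationInvariant_energyAngMom A hA x v, LinearIsometryEquiv.inner_map_map,
    LinearIsometryEquiv.norm_map]

variable {S} in
theorem norm_orbitPoint_fst {σ : ℝ} {q : (ℝ × ℝ) × ℝ} (hq : 0 < q.2) :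
    ‖(S.orbitPoint σ q).1‖ = q.2 := by
  rw [orbitPoint, norm_planar_fst, abs_of_pos hq]

variable {S} in
theorem inner_orbitPoint {σ : ℝ} {q : (ℝ × ℝ) × ℝ} :
    inner ℝ (S.orbitPoint σ q).1 (S.orbitPoint σ q).2 = q.2 * (σ * S.speed q.1 q.2) := by
  rw [orbitPoint, inner_planar]

section OrbitPoint

variable {S}
variable {y : ℝ × ℝ} (hy : y ∈ S.orbitSet) {r : ℝ} (hr : r ∈ S.radii y)
include hy hr

theorem radius_pos : 0 < r := (rMinus_pos hy).trans hr.1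

theorem speed_pos : 0 < S.speed y r := (isOrbit hy).pos r hr

theorem angle_orbitPoint_one : S.angle (S.orbitPoint 1 (y, r)) =
    travelTime (S.rMinus y.1 y.2) (S.speed y) r /
      (2 * travelTime (S.rMinus y.1 y.2) (S.speed y) (S.rPlus y.1 y.2)) := by
  have h0 : 0 ≤ inner ℝ (S.orbitPoint 1 (y, r)).1 (S.orbitPoint 1 (y, r)).2 := by
    rw [inner_orbitPoint, one_mul]
    exact (mul_pos (radius_pos hy hr) (speed_pos hy hr)).le
  have h1 := energyAngMom_orbitPoint_of_mem (σ := 1) (q := (y, r)) (one_pow 2) hy hr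
  have h2 := norm_orbitPoint_fst (S := S) (σ := 1) (q := (y, r)) (radius_pos hy hr)
  rw [angle, if_pos h0, h1, h2, elapsed_of_mem hy hr, period_eq hy]

theorem angle_orbitPoint_neg_one : S.angle (S.orbitPoint (-1) (y, r)) =
    -travelTime (S.rMinus y.1 y.2) (S.speed y) r /
      (2 * travelTime (S.rMinus y.1 y.2) (S.speed y) (S.rPlus y.1 y.2)) := by
  have h0 : ¬ 0 ≤ inner ℝ (S.orbitPoint (-1) (y, r)).1 (S.orbitPoint (-1) (y, r)).2 := by
    have h3 := mul_pos (radius_pos hy hr) (speed_pos hy hr)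
    rw [inner_orbitPoint, neg_one_mul, mul_neg, not_le]
    exact neg_lt_zero.2 h3
  have h1 := energyAngMom_orbitPoint_of_mem (σ := -1) (q := (y, r)) neg_one_sq hy hr
  have h2 := norm_orbitPoint_fst (S := S) (σ := -1) (q := (y, r)) (radius_pos hy hr)
  rw [angle, if_neg h0, h1, h2, elapsed_of_mem hy hr, period_eq hy]

end OrbitPoint

/-- The trigonometric functions of the angle variable. -/
def mode (k : ℤ) (p : Phase) : ℝ := trigBasis k (S.angle p)

theorem measurable_mode (k : ℤ) : Measurable (S.mode k) :=
  (continuous_trigBasis k).measurable.comp S.measurable_angle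

theorem rotationInvariant_mode (k : ℤ) : RotationInvariant (S.mode k) := fun A hA x v => by
  rw [mode, mode, S.rotationInvariant_angle A hA x v]

theorem abs_mode_le (k : ℤ) (p : Phase) : |S.mode k p| ≤ √2 := abs_trigBasis_le k _

/-- The integrand of the Fourier coefficients of a function along the orbits. -/
def modeProduct (k : ℤ) (f : Phase → ℝ) (q : (ℝ × ℝ) × ℝ) : ℝ :=
  S.mode k (S.orbitPoint 1 q) * f (S.orbitPoint 1 q) +
    S.mode k (S.orbitPoint (-1) q) * f (S.orbitPoint (-1) q)

/-- The Fourier coefficients of a function along the orbits. -/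
def coeff (k : ℤ) (f : Phase → ℝ) (y : ℝ × ℝ) : ℝ :=
  orbitCoeff (S.rMinus y.1 y.2) (S.rPlus y.1 y.2) (S.speed y) k
    (fun r => f (S.orbitPoint 1 (y, r))) (fun r => f (S.orbitPoint (-1) (y, r)))

variable {S} in
theorem orbitIntegral_modeProduct {y : ℝ × ℝ} (hy : y ∈ S.orbitSet) (k : ℤ) (f : Phase → ℝ) :
    S.orbitIntegral (S.modeProduct k f) y = S.coeff k f y := by
  refine setIntegral_congr_fun (S.measurableSet_radii y) fun r hr => ?_
  simp only [modeProduct, mode, angle_orbitPoint_one hy hr, angle_orbitPoint_neg_one hy hr]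
  ring

variable {S} in
theorem integral_inv_speed {y : ℝ × ℝ} (hy : y ∈ S.orbitSet) :
    ∫ r in S.radii y, 1 / S.speed y r = S.period y / 2 := by
  rw [period_eq hy, travelTime, intervalIntegral.integral_of_le (isOrbit hy).lt.le,
    integral_Ioc_eq_integral_Ioo, radii]
  ring

variable {S} in
theorem integral_energyMeasure {F : ℝ × ℝ → ℝ} (hF : Measurable F)
    (hi : Integrable F S.energyMeasure) :
    Integrable (fun q => 2 * F q.1) S.orbitMeasure ∧
      ∫ y, F y ∂S.energyMeasure = ∫ q, 2 * F q.1 ∂S.orbitMeasure := by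
  have hmp := S.measurePreserving_energyAngMom
  have hm : Measurable fun p => F (S.energyAngMom p) := hF.comp hmp.measurable
  have hrot : RotationInvariant fun p => F (S.energyAngMom p) := fun A hA x v => by
    simp only [S.rotationInvariant_energyAngMom A hA x v]
  have hi2 : Integrable (fun p => F (S.energyAngMom p)) S.ν :=
    (hmp.integrable_comp hi.aestronglyMeasurable).2 hi
  have hae : (fun q => F (S.energyAngMom (S.orbitPoint 1 q)) +
      F (S.energyAngMom (S.orbitPoint (-1) q))) =ᵐ[S.orbitMeasure] fun q => 2 * F q.1 := by
    filter_upwards [S.ae_orbitMeasure_mem] with q hq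
    rw [energyAngMom_orbitPoint_of_mem (by norm_num) hq.1 hq.2,
      energyAngMom_orbitPoint_of_mem (by norm_num) hq.1 hq.2, two_mul]
  obtain ⟨i1, i2⟩ := integrable_comp_orbitPoint hm hrot hi2
  refine ⟨(i1.add i2).congr hae, ?_⟩
  rw [← hmp.map_eq, integral_map hmp.measurable.aemeasurable hF.aestronglyMeasurable,
    integral_ν hm hrot hi2]
  exact integral_congr_ae hae

variable {S} in
theorem memLp_comp_fst {F : ℝ × ℝ → ℝ} (hF : Measurable F) (hi : MemLp F 2 S.energyMeasure) :
    MemLp (fun q : (ℝ × ℝ) × ℝ => F q.1) 2 S.orbitMeasure := by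
  have h := (integral_energyMeasure (hF.pow_const 2) hi.integrable_sq).1
  have hm : Measurable fun q : (ℝ × ℝ) × ℝ => F q.1 := hF.comp measurable_fst
  refine (memLp_two_iff_integrable_sq hm.aestronglyMeasurable).2 ?_
  refine (h.const_mul (1 / 2)).congr (Eventually.of_forall fun q => ?_)
  ring

/-! ### Fourier decomposition of the Hilbert space -/

/-- The linear embedding `c ↦ c(E, L) eₖ` of `L²` into the Hilbert space. -/
def modeLin (k : ℤ) : Lp ℝ 2 S.energyMeasure →ₗ[ℝ] S.H where
  toFun c := ⟨mulLp S.ν (S.mode k) (S.measurable_mode k) (√2) (S.abs_mode_le k)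
      (Lp.compMeasurePreservingₗ ℝ S.energyAngMom S.measurePreserving_energyAngMom c), by
    refine ⟨fun p => S.mode k p * c (S.energyAngMom p), (S.measurable_mode k).mul
      ((Lp.stronglyMeasurable c).measurable.comp S.continuous_energyAngMom.measurable),
      fun A hA x v => ?_, ?_⟩
    · simp only [S.rotationInvariant_mode k A hA x v, S.rotationInvariant_energyAngMom A hA x v]
    · filter_upwards [mulLp_apply (S.mode k) (S.measurable_mode k) (√2) (S.abs_mode_le k)
        (Lp.compMeasurePreserving S.energyAngMom S.measurePreserving_energyAngMom c),
        Lp.coeFn_compMeasurePreserving c S.measurePreserving_energyAngMom] with p h1 h2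
      rw [h2] at h1
      exact h1⟩
  map_add' c d := by
    refine Subtype.ext ?_
    change mulLp _ _ _ _ _ _ = mulLp _ _ _ _ _ _ + mulLp _ _ _ _ _ _
    rw [map_add, map_add]
  map_smul' a c := by
    refine Subtype.ext ?_
    change mulLp _ _ _ _ _ _ = a • mulLp _ _ _ _ _ _
    rw [map_smul, map_smul]

theorem modeLin_apply (k : ℤ) (c : Lp ℝ 2 S.energyMeasure) :
    (S.modeLin k c : Lp ℝ 2 S.ν) =ᵐ[S.ν] fun p => S.mode k p * c (S.energyAngMom p) := by
  filter_upwards [mulLp_apply (S.mode k) (S.measurable_mode k) (√2) (S.abs_mode_le k)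
    (Lp.compMeasurePreserving S.energyAngMom S.measurePreserving_energyAngMom c),
    Lp.coeFn_compMeasurePreserving c S.measurePreserving_energyAngMom] with p h1 h2
  rw [h2] at h1
  exact h1

/-- `f` is a measurable spherically symmetric representative of `g`. -/
structure IsRep (g : S.H) (f : Phase → ℝ) : Prop where
  measurable : Measurable f
  rotationInvariant : RotationInvariant f
  ae_eq : (g : Lp ℝ 2 S.ν) =ᵐ[S.ν] f

theorem exists_isRep (g : S.H) : ∃ f, S.IsRep g f := by
  obtain ⟨f, h1, h2, h3⟩ := g.2
  exact ⟨f, h1, h2, h3⟩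

variable {S} in
theorem IsRep.memLp {g : S.H} {f : Phase → ℝ} (h : S.IsRep g f) : MemLp f 2 S.ν :=
  (memLp_congr_ae h.ae_eq).1 (Lp.memLp _)

theorem isRep_modeLin (k : ℤ) (c : Lp ℝ 2 S.energyMeasure) :
    S.IsRep (S.modeLin k c) fun p => S.mode k p * c (S.energyAngMom p) :=
  ⟨(S.measurable_mode k).mul
      ((Lp.stronglyMeasurable c).measurable.comp S.continuous_energyAngMom.measurable),
    fun A hA x v => by
      simp only [S.rotationInvariant_mode k A hA x v, S.rotationInvariant_energyAngMom A hA x v],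
    S.modeLin_apply k c⟩

variable {S} in
theorem inner_modeLin (k : ℤ) (c : Lp ℝ 2 S.energyMeasure) {g : S.H} {f : Phase → ℝ}
    (hf : S.IsRep g f) : Integrable (fun q => c q.1 * S.modeProduct k f q) S.orbitMeasure ∧
      ⟪S.modeLin k c, g⟫_ℝ = ∫ q, c q.1 * S.modeProduct k f q ∂S.orbitMeasure := by
  have hm := S.isRep_modeLin k c
  have hprod : Integrable (fun p => S.mode k p * c (S.energyAngMom p) * f p) S.ν :=
    hm.memLp.integrable_mul hf.memLp
  have hmeas : Measurable fun p => S.mode k p * c (S.energyAngMom p) * f p :=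
    hm.measurable.mul hf.measurable
  have hrot : RotationInvariant fun p => S.mode k p * c (S.energyAngMom p) * f p :=
    fun A hA x v => by
      simp only [S.rotationInvariant_mode k A hA x v, S.rotationInvariant_energyAngMom A hA x v,
        hf.rotationInvariant A hA x v]
  have hae : (fun q => S.mode k (S.orbitPoint 1 q) * c (S.energyAngMom (S.orbitPoint 1 q)) *
        f (S.orbitPoint 1 q) + S.mode k (S.orbitPoint (-1) q) *
        c (S.energyAngMom (S.orbitPoint (-1) q)) * f (S.orbitPoint (-1) q))
      =ᵐ[S.orbitMeasure] fun q => c q.1 * S.modeProduct k f q := by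
    filter_upwards [S.ae_orbitMeasure_mem] with q hq
    rw [energyAngMom_orbitPoint_of_mem (by norm_num) hq.1 hq.2,
      energyAngMom_orbitPoint_of_mem (by norm_num) hq.1 hq.2, modeProduct]
    ring
  obtain ⟨i1, i2⟩ := integrable_comp_orbitPoint hmeas hrot hprod
  refine ⟨(i1.add i2).congr hae, ?_⟩
  rw [Submodule.coe_inner, L2.inner_def]
  have h1 : ∫ p, ⟪(S.modeLin k c : Lp ℝ 2 S.ν) p, (g : Lp ℝ 2 S.ν) p⟫_ℝ ∂S.ν =
      ∫ p, S.mode k p * c (S.energyAngMom p) * f p ∂S.ν := by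
    refine integral_congr_ae ?_
    filter_upwards [hm.ae_eq, hf.ae_eq] with p e1 e2
    rw [e1, e2, RCLike.inner_apply, conj_trivial, mul_comm]
  rw [h1, integral_ν hmeas hrot hprod]
  exact integral_congr_ae hae

/-- On each orbit the trigonometric functions have time integrals δ_jk T, and this T is the density
built into `energyMeasure`; so orthonormality along orbits integrates to orthogonality and isometry.
-/
theorem inner_modeLin_modeLin (j k : ℤ) (c d : Lp ℝ 2 S.energyMeasure) :
    ⟪S.modeLin j c, S.modeLin k d⟫_ℝ = if j = k then ⟪c, d⟫_ℝ else 0 := by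
  obtain ⟨hint, heq⟩ := inner_modeLin j c (S.isRep_modeLin k d)
  have hcd : Integrable (fun y => c y * d y) S.energyMeasure :=
    (Lp.memLp c).integrable_mul (Lp.memLp d)
  obtain ⟨hi2, he2⟩ := integral_energyMeasure (F := fun y => c y * d y)
    ((Lp.stronglyMeasurable c).measurable.mul (Lp.stronglyMeasurable d).measurable) hcd
  have h3 : ⟪c, d⟫_ℝ = ∫ y in S.orbitSet, S.weight y * (c y * d y * S.period y) := by
    have h4 : ⟪c, d⟫_ℝ = ∫ y, c y * d y ∂S.energyMeasure := by
      rw [L2.inner_def]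
      refine integral_congr_ae (Eventually.of_forall fun y => ?_)
      simp only [RCLike.inner_apply, conj_trivial]
      rw [mul_comm]
    rw [h4, he2, integral_orbitMeasure hi2]
    refine setIntegral_congr_fun S.measurableSet_orbitSet fun y hy => ?_
    have h5 := S.orbitIntegral_mul (fun y => 2 * (c y * d y)) (fun _ => 1) y
    simp only [mul_one] at h5
    rw [h5, orbitIntegral, integral_inv_speed hy]
    ring
  rw [heq, integral_orbitMeasure hint, h3]
  have h6 : ∀ y ∈ S.orbitSet, S.orbitIntegral (fun q => c q.1 *
      S.modeProduct j (fun p => S.mode k p * d (S.energyAngMom p)) q) y =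
      c y * d y * (if j = k then S.period y else 0) := by
    intro y hy
    rw [S.orbitIntegral_mul c, orbitIntegral, mul_assoc, period_eq hy]
    congr 1
    rw [← (isOrbit hy).integral_trigBasis_mul_orbit j k, ← integral_const_mul]
    refine setIntegral_congr_fun (S.measurableSet_radii y) fun r hr => ?_
    have e1 := energyAngMom_orbitPoint_of_mem (σ := 1) (q := (y, r)) (one_pow 2) hy hr
    have e2 := energyAngMom_orbitPoint_of_mem (σ := -1) (q := (y, r)) neg_one_sq hy hr
    simp only [modeProduct, mode, angle_orbitPoint_one hy hr, angle_orbitPoint_neg_one hy hr, e1, e2]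
    ring
  split_ifs with hjk
  · refine setIntegral_congr_fun S.measurableSet_orbitSet fun y hy => ?_
    simp only [h6 y hy, if_pos hjk]
  · rw [setIntegral_congr_fun S.measurableSet_orbitSet (g := fun _ => 0)]
    · simp
    · intro y hy
      simp only [h6 y hy, if_neg hjk, mul_zero]

/-- The isometric embedding `c ↦ c(E, L) eₖ` of `L²` into the Hilbert space. -/
def modeMap (k : ℤ) : Lp ℝ 2 S.energyMeasure →ₗᵢ[ℝ] S.H where
  toLinearMap := S.modeLin k
  norm_map' c := by
    have h := S.inner_modeLin_modeLin k k c c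
    rw [if_pos rfl, real_inner_self_eq_norm_sq, real_inner_self_eq_norm_sq] at h
    exact (sq_eq_sq₀ (norm_nonneg _) (norm_nonneg _)).1 h

theorem orthogonalFamily_modeMap :
    OrthogonalFamily ℝ (fun _ : ℤ => Lp ℝ 2 S.energyMeasure) S.modeMap := fun j k hjk c d =>
  (S.inner_modeLin_modeLin j k c d).trans (if_neg hjk)

variable {S} in
theorem memLp_test {χ : ℝ × ℝ → ℝ} (hχ : Continuous χ) (hc : HasCompactSupport χ)
    (hs : tsupport χ ⊆ S.orbitSet) : MemLp χ 2 S.energyMeasure := by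
  obtain ⟨B, hB⟩ := hχ.bounded_above_of_compact_support hc
  have hK : MeasurableSet (tsupport χ) := (isClosed_tsupport χ).measurableSet
  have : IsFiniteMeasure (S.energyMeasure.restrict (tsupport χ)) :=
    ⟨by simpa using S.energyMeasure_lt_top hc hs⟩
  have h1 : MemLp χ 2 (S.energyMeasure.restrict (tsupport χ)) :=
    MemLp.of_bound hχ.aestronglyMeasurable B (Eventually.of_forall hB)
  rw [← memLp_indicator_iff_restrict hK] at h1
  convert h1 using 1
  exact (indicator_eq_self.2 (subset_tsupport χ)).symm

variable {S} in
theorem integral_test_mul_modeProduct {χ : ℝ × ℝ → ℝ} (hχ : Continuous χ) (hc : HasCompactSupport χ)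
    (hs : tsupport χ ⊆ S.orbitSet) (k : ℤ) {g : S.H} {f : Phase → ℝ} (hf : S.IsRep g f) :
    Integrable (fun q => χ q.1 * S.modeProduct k f q) S.orbitMeasure ∧
    ∫ q, χ q.1 * S.modeProduct k f q ∂S.orbitMeasure =
      ⟪S.modeMap k ((memLp_test hχ hc hs).toLp χ), g⟫_ℝ := by
  obtain ⟨h1, h2⟩ := inner_modeLin k ((memLp_test hχ hc hs).toLp χ) hf
  have h3 : (fun q => (memLp_test hχ hc hs).toLp χ q.1 * S.modeProduct k f q)
      =ᵐ[S.orbitMeasure] fun q => χ q.1 * S.modeProduct k f q := by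
    filter_upwards [S.quasiMeasurePreserving_fst.ae (memLp_test hχ hc hs).coeFn_toLp] with q hq
    rw [hq]
  exact ⟨h1.congr h3, (h2.trans (integral_congr_ae h3)).symm⟩

variable {S} in
theorem memLp_modeProduct (k : ℤ) {f : Phase → ℝ} (hf : Measurable f) (hs : RotationInvariant f)
    (hi : MemLp f 2 S.ν) :
    Measurable (S.modeProduct k f) ∧ MemLp (S.modeProduct k f) 2 S.orbitMeasure := by
  have hm : Measurable fun p => S.mode k p * f p := (S.measurable_mode k).mul hf
  have hr : RotationInvariant fun p => S.mode k p * f p := fun A hA x v => by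
    simp only [S.rotationInvariant_mode k A hA x v, hs A hA x v]
  have hL : MemLp (fun p => S.mode k p * f p) 2 S.ν :=
    hi.of_le_mul (c := √2) hm.aestronglyMeasurable (Eventually.of_forall fun p => by
      rw [norm_mul]
      exact mul_le_mul_of_nonneg_right (S.abs_mode_le k p) (norm_nonneg _))
  obtain ⟨h1, h2⟩ := memLp_comp_orbitPoint hm hr hL
  exact ⟨(hm.comp (S.measurable_orbitPoint 1)).add (hm.comp (S.measurable_orbitPoint (-1))),
    h1.add h2⟩

variable {S} in
theorem ae_coeff_eq_zero {g : S.H} {f : Phase → ℝ} (hf : S.IsRep g f) (k : ℤ)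
    (h0 : ∀ c, ⟪S.modeMap k c, g⟫_ℝ = 0) : ∀ᵐ y, y ∈ S.orbitSet → S.coeff k f y = 0 := by
  obtain ⟨-, h2⟩ := memLp_modeProduct k hf.measurable hf.rotationInvariant hf.memLp
  have h := ae_orbitIntegral_eq_zero (fun K hK hKs => integrableOn_fst_preimage h2 hK hKs)
    (fun χ hχ hc hs => (integral_test_mul_modeProduct hχ.continuous hc hs k hf).2.trans (h0 _))
  filter_upwards [h] with y hy hmem
  rw [← orbitIntegral_modeProduct hmem, hy hmem]

variable {S} in
/-- The orbit integrals of the values of a square integrable function exist. -/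
theorem IsRep.ae_integrableOn {g : S.H} {f : Phase → ℝ} (hf : S.IsRep g f) :
    ∀ᵐ y, y ∈ S.orbitSet →
      IntegrableOn (fun r => f (S.orbitPoint 1 (y, r)) / S.speed y r) (S.radii y) ∧
      IntegrableOn (fun r => f (S.orbitPoint (-1) (y, r)) / S.speed y r) (S.radii y) := by
  obtain ⟨h1, h2⟩ := memLp_comp_orbitPoint hf.measurable hf.rotationInvariant hf.memLp
  filter_upwards [ae_integrableOn_of_memLp (hf.measurable.comp (S.measurable_orbitPoint 1)) h1,
    ae_integrableOn_of_memLp (hf.measurable.comp (S.measurable_orbitPoint (-1))) h2] with y e1 e2 hy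
  exact ⟨e1 hy, e2 hy⟩

variable {S} in
-- Completeness of the modes: as k ranges over a countable set, on almost every orbit all Fourier
-- coefficients vanish at once, and `ae_eq_zero_of_orbitCoeff` applies there.
theorem eq_zero_of_inner_modeMap {g : S.H} (h0 : ∀ k c, ⟪S.modeMap k c, g⟫_ℝ = 0) : g = 0 := by
  obtain ⟨f, hf⟩ := S.exists_isRep g
  have hk : ∀ᵐ y, ∀ k, y ∈ S.orbitSet → S.coeff k f y = 0 :=
    ae_all_iff.2 fun k => ae_coeff_eq_zero hf k (h0 k)
  have hm : Measurable fun q => ‖f (S.orbitPoint 1 q)‖ₑ + ‖f (S.orbitPoint (-1) q)‖ₑ :=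
    (hf.measurable.comp (S.measurable_orbitPoint 1)).enorm.add
      (hf.measurable.comp (S.measurable_orbitPoint (-1))).enorm
  have hzero : ∫⁻ p, ‖f p‖ₑ ∂S.ν = 0 := by
    rw [S.lintegral_ν hf.measurable.enorm (fun A hA x v => by rw [hf.rotationInvariant A hA x v]),
      S.lintegral_orbitMeasure_iterated hm]
    refine (lintegral_congr_ae ?_).trans lintegral_zero
    rw [Filter.EventuallyEq, ae_restrict_iff' S.measurableSet_orbitSet]
    filter_upwards [hk, hf.ae_integrableOn] with y e1 e2 hy
    have e3 := (isOrbit hy).ae_eq_zero_of_orbitCoeff (e2 hy).1 (e2 hy).2 fun k => e1 k hy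
    have e4 : ∫⁻ r in S.radii y, ENNReal.ofReal (1 / S.speed y r) *
        (‖f (S.orbitPoint 1 (y, r))‖ₑ + ‖f (S.orbitPoint (-1) (y, r))‖ₑ) = 0 := by
      refine (lintegral_congr_ae ?_).trans lintegral_zero
      rw [Filter.EventuallyEq, ae_restrict_iff' (S.measurableSet_radii y)]
      filter_upwards [e3] with r e5 hr
      rw [(e5 hr).1, (e5 hr).2]
      simp
    rw [e4, mul_zero]
  have hae : f =ᵐ[S.ν] 0 := by
    filter_upwards [(lintegral_eq_zero_iff hf.measurable.enorm).1 hzero] with p hp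
    exact enorm_eq_zero.1 hp
  exact Subtype.ext (Lp.ext (hf.ae_eq.trans (hae.trans (Lp.coeFn_zero ℝ 2 S.ν).symm)))

theorem isHilbertSum_modeMap :
    IsHilbertSum ℝ (fun _ : ℤ => Lp ℝ 2 S.energyMeasure) S.modeMap := by
  refine IsHilbertSum.mk S.orthogonalFamily_modeMap (top_le_iff.2 ?_)
  rw [Submodule.topologicalClosure_eq_top_iff, Submodule.eq_bot_iff]
  intro g hg
  refine eq_zero_of_inner_modeMap fun k c => ?_
  exact (Submodule.mem_orthogonal _ _).1 hg _
    (Submodule.mem_iSup_of_mem k (LinearMap.mem_range_self (S.modeMap k).toLinearMap c))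

/-- The Fourier decomposition of the Hilbert space. -/
def fourier : S.H ≃ₗᵢ[ℝ] FourierSpace S.energyMeasure :=
  S.isHilbertSum_modeMap.linearIsometryEquiv

theorem inner_fourier (k : ℤ) (c : Lp ℝ 2 S.energyMeasure) (g : S.H) :
    ⟪c, S.fourier g k⟫_ℝ = ⟪S.modeMap k c, g⟫_ℝ := by
  classical
  have h := S.isHilbertSum_modeMap.linearIsometryEquiv_symm_apply_single (i := k) c
  rw [← h, ← lp.inner_single_left (𝕜 := ℝ) k c (S.fourier g)]
  have h2 := S.fourier.symm.inner_map_map (lp.single 2 k c) (S.fourier g)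
  rw [S.fourier.symm_apply_apply] at h2
  exact h2.symm

variable {S} in
/-- The components of the Fourier decomposition are the Fourier coefficients along the orbits. -/
theorem ae_coeff_eq {g : S.H} {f : Phase → ℝ} (hf : S.IsRep g f) (k : ℤ) :
    ∀ᵐ y, y ∈ S.orbitSet → S.coeff k f y = S.period y * S.fourier g k y := by
  obtain ⟨m2, h2⟩ := memLp_modeProduct k hf.measurable hf.rotationInvariant hf.memLp
  have mG : Measurable (S.fourier g k) := (Lp.stronglyMeasurable (S.fourier g k)).measurable
  have h3 : MemLp (fun q : (ℝ × ℝ) × ℝ => 2 * S.fourier g k q.1) 2 S.orbitMeasure :=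
    (memLp_comp_fst mG (Lp.memLp _)).const_mul 2
  have m3 : Measurable fun q : (ℝ × ℝ) × ℝ => 2 * S.fourier g k q.1 :=
    (mG.comp measurable_fst).const_mul 2
  -- The comparison function is constant along each orbit. Its factor 2 is there because the
  -- integral of dr/w over one branch is T/2.
  have h := ae_orbitIntegral_eq_zero
    (h := fun q => S.modeProduct k f q - 2 * S.fourier g k q.1)
    (fun K hK hKs => integrableOn_fst_preimage (h2.sub h3) hK hKs) ?_
  · filter_upwards [h, ae_integrableOn_of_memLp m2 h2, ae_integrableOn_of_memLp m3 h3]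
      with y e1 e2 e3 hy
    have e4 := e1 hy
    have e5 := S.orbitIntegral_mul (fun y => 2 * S.fourier g k y) (fun _ => 1) y
    simp only [mul_one] at e5
    have e6 : S.orbitIntegral (fun q => S.modeProduct k f q - 2 * S.fourier g k q.1) y =
        S.orbitIntegral (S.modeProduct k f) y -
          S.orbitIntegral (fun q => 2 * S.fourier g k q.1) y := by
      simp only [orbitIntegral, sub_div]
      exact integral_sub (e2 hy) (e3 hy)
    rw [e6, e5, orbitIntegral_modeProduct hy, orbitIntegral, integral_inv_speed hy] at e4
    linarith
  · intro χ hχ hc hs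
    have hL := memLp_test hχ.continuous hc hs
    obtain ⟨i1, e1⟩ := integral_test_mul_modeProduct hχ.continuous hc hs k hf
    have hprod : Integrable (fun y => χ y * S.fourier g k y) S.energyMeasure :=
      hL.integrable_mul (Lp.memLp _)
    obtain ⟨i2, e2⟩ := integral_energyMeasure (F := fun y => χ y * S.fourier g k y)
      (hχ.continuous.measurable.mul mG) hprod
    have e3 : ⟪hL.toLp χ, S.fourier g k⟫_ℝ = ∫ y, χ y * S.fourier g k y ∂S.energyMeasure := by
      rw [L2.inner_def]
      refine integral_congr_ae ?_
      filter_upwards [hL.coeFn_toLp] with y hy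
      rw [hy, RCLike.inner_apply, conj_trivial, mul_comm]
    have e4 : ∀ q : (ℝ × ℝ) × ℝ, χ q.1 * (S.modeProduct k f q - 2 * S.fourier g k q.1) =
        χ q.1 * S.modeProduct k f q - 2 * (χ q.1 * S.fourier g k q.1) := fun q => by ring
    simp only [e4]
    rw [integral_sub i1 i2, e1, ← e2, ← e3, inner_fourier, sub_self]

end RadialSteadyState

/-! ### The transport operator on smooth functions -/

theorem HasDerivAt.euclidean_three {f g h : ℝ → ℝ} {f' g' h' t : ℝ} (hf : HasDerivAt f f' t)
    (hg : HasDerivAt g g' t) (hh : HasDerivAt h h' t) :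
    HasDerivAt (fun s => (!₂[f s, g s, h s] : Space)) !₂[f', g', h'] t := by
  have h1 : HasDerivAt (fun s => ![f s, g s, h s]) ![f', g', h'] t := by
    refine hasDerivAt_pi.2 fun i => ?_
    fin_cases i
    · exact hf
    · exact hg
    · exact hh
  exact (EuclideanSpace.equiv (Fin 3) ℝ).symm.hasFDerivAt.comp_hasDerivAt t h1

theorem smoothTransport_eq {U : Space → ℝ} {ξ : Phase → ℝ} (hξ : Differentiable ℝ ξ) (p : Phase) :
    smoothTransport U ξ p = fderiv ℝ ξ p (p.2, -gradient U p.1) := by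
  have h1 : HasFDerivAt (fun x => ξ (x, p.2)) (fderiv ℝ ξ p ∘L .inl ℝ Space Space) p.1 :=
    HasFDerivAt.comp (g := ξ) p.1 (hξ p).hasFDerivAt (hasFDerivAt_prodMk_left p.1 p.2)
  have h2 : HasFDerivAt (fun v => ξ (p.1, v)) (fderiv ℝ ξ p ∘L .inr ℝ Space Space) p.2 :=
    HasFDerivAt.comp (g := ξ) p.2 (hξ p).hasFDerivAt (hasFDerivAt_prodMk_right p.1 p.2)
  rw [smoothTransport, h1.fderiv, h2.fderiv]
  simp only [ContinuousLinearMap.comp_apply, ContinuousLinearMap.inl_apply,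
    ContinuousLinearMap.inr_apply]
  rw [← map_sub]
  simp

theorem gradient_isometry {U : Space → ℝ} (hU : Differentiable ℝ U) (A : Space ≃ₗᵢ[ℝ] Space)
    (hA : ∀ x, U (A x) = U x) (x : Space) : gradient U (A x) = A (gradient U x) := by
  refine ext_inner_right ℝ fun z => ?_
  obtain ⟨z, rfl⟩ := A.surjective z
  have h1 : HasFDerivAt (fun x => U (A x)) ((fderiv ℝ U (A x)) ∘L
      (A.toContinuousLinearEquiv : Space →L[ℝ] Space)) x :=
    HasFDerivAt.comp (g := U) x (hU (A x)).hasFDerivAt A.toContinuousLinearEquiv.hasFDerivAt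
  simp only [hA] at h1
  have h2 := congrArg (fun f => f z) h1.fderiv
  rw [A.inner_map_map, gradient, gradient, InnerProductSpace.toDual_symm_apply,
    InnerProductSpace.toDual_symm_apply]
  exact h2.symm

theorem rotationInvariant_smoothTransport {U : Space → ℝ} (hU : Differentiable ℝ U)
    (hrad : ∀ x y : Space, ‖x‖ = ‖y‖ → U x = U y) {ξ : Phase → ℝ} (hξ : Differentiable ℝ ξ)
    (hs : RotationInvariant ξ) : RotationInvariant (smoothTransport U ξ) := fun A hA x v => by
  rw [smoothTransport_eq hξ, smoothTransport_eq hξ,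
    gradient_isometry hU A (fun x => hrad _ _ (A.norm_map x)), ← map_neg]
  set B := A.toContinuousLinearEquiv.prodCongr A.toContinuousLinearEquiv
  have h1 : HasFDerivAt (fun p => ξ (B p)) ((fderiv ℝ ξ (B (x, v))) ∘L
      (B : Phase →L[ℝ] Phase)) (x, v) :=
    HasFDerivAt.comp (g := ξ) (x, v) (hξ _).hasFDerivAt B.hasFDerivAt
  have h2 : (fun p => ξ (B p)) = ξ := funext fun p => hs A hA p.1 p.2
  rw [h2] at h1
  exact (congrArg (fun f => f (v, -gradient U x)) h1.fderiv).symm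

theorem continuous_gradient {U : Space → ℝ} (hU : ContDiff ℝ 1 U) : Continuous (gradient U) :=
  (InnerProductSpace.toDual ℝ Space).symm.continuous.comp (hU.continuous_fderiv one_ne_zero)

theorem continuous_smoothTransport {U : Space → ℝ} (hU : ContDiff ℝ 1 U) {ξ : Phase → ℝ}
    (hξ : ContDiff ℝ 1 ξ) : Continuous (smoothTransport U ξ) := by
  have h1 : smoothTransport U ξ = fun p => fderiv ℝ ξ p (p.2, -gradient U p.1) :=
    funext fun p => smoothTransport_eq (hξ.differentiable one_ne_zero) p
  rw [h1]
  have h2 := continuous_gradient hU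
  exact (hξ.continuous_fderiv one_ne_zero).clm_apply (by fun_prop)

theorem tsupport_smoothTransport_subset {U : Space → ℝ} {ξ : Phase → ℝ} (hξ : Differentiable ℝ ξ) :
    tsupport (smoothTransport U ξ) ⊆ tsupport ξ := by
  refine closure_minimal (fun p hp => ?_) (isClosed_tsupport ξ)
  refine support_fderiv_subset ℝ fun h0 => hp ?_
  rw [smoothTransport_eq hξ, h0]
  rfl

/-- Rotation invariant functions are constant under rotations in the plane of motion. -/
theorem fderiv_planar_rotation {ξ : Phase → ℝ} (hξ : Differentiable ℝ ξ)
    (hs : RotationInvariant ξ) (r a b : ℝ) :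
    fderiv ℝ ξ (planar r a b) (!₂[0, r, 0], !₂[-b, a, 0]) = 0 := by
  set γ : ℝ → Phase := fun t => (!₂[r * Real.cos t, r * Real.sin t, 0],
    !₂[a * Real.cos t - b * Real.sin t, a * Real.sin t + b * Real.cos t, 0]) with hγ
  have h0 : γ 0 = planar r a b := by simp [hγ, planar]
  have h1 : HasDerivAt γ (!₂[0, r, 0], !₂[-b, a, 0]) 0 := by
    have hc : HasDerivAt Real.cos 0 0 := by simpa using Real.hasDerivAt_cos 0
    have hsn : HasDerivAt Real.sin 1 0 := by simpa using Real.hasDerivAt_sin 0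
    refine HasDerivAt.prodMk ?_ ?_
    · refine HasDerivAt.euclidean_three ?_ ?_ (hasDerivAt_const _ _)
      · simpa using hc.const_mul r
      · simpa using hsn.const_mul r
    · refine HasDerivAt.euclidean_three ?_ ?_ (hasDerivAt_const _ _)
      · exact ((hc.const_mul a).sub (hsn.const_mul b)).congr_deriv (by simp)
      · exact ((hsn.const_mul a).add (hc.const_mul b)).congr_deriv (by simp)
  have h2 : ∀ t, ξ (γ t) = ξ (planar r a b) := by
    intro t
    have hcs := Real.cos_sq_add_sin_sq t
    refine hs.eq ?_ ?_ ?_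
    · refine (sq_eq_sq₀ (norm_nonneg _) (norm_nonneg _)).1 ?_
      simp only [hγ, planar, EuclideanSpace.real_norm_sq_eq, Fin.sum_univ_three]
      simp
      linear_combination r ^ 2 * hcs
    · refine (sq_eq_sq₀ (norm_nonneg _) (norm_nonneg _)).1 ?_
      simp only [hγ, planar, EuclideanSpace.real_norm_sq_eq, Fin.sum_univ_three]
      simp
      linear_combination (a ^ 2 + b ^ 2) * hcs
    · simp only [hγ, planar, PiLp.inner_apply, Fin.sum_univ_three]
      simp
      linear_combination (r * a) * hcs
  have h3 := (hξ (γ 0)).hasFDerivAt.comp_hasDerivAt 0 h1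
  have h4 : ξ ∘ γ = fun _ => ξ (planar r a b) := funext h2
  rw [h4, h0] at h3
  exact h3.unique (hasDerivAt_const _ _)

namespace RadialSteadyState

open Set InnerProductSpace

variable (S : RadialSteadyState)

theorem contDiff_one_U : ContDiff ℝ 1 S.U := S.contDiff_U.of_le (by norm_num)

variable {S} in
/-- The transport operator is the derivative along the orbits. -/
theorem hasDerivAt_orbitPoint {ξ : Phase → ℝ} (hξ : Differentiable ℝ ξ) (hs : RotationInvariant ξ)
    {σ : ℝ} (hσ : σ ^ 2 = 1) {y : ℝ × ℝ} (hy : y ∈ S.orbitSet) {r : ℝ} (hr : r ∈ S.radii y) :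
    HasDerivAt (fun s => ξ (S.orbitPoint σ (y, s)))
      (σ * smoothTransport S.U ξ (S.orbitPoint σ (y, r)) / S.speed y r) r := by
  have hr0 := radius_pos hy hr
  have hw0 := speed_pos hy hr
  have hw := (isOrbit hy).hasDerivAt r hr
  set w := S.speed y r with hwdef
  set F := (r * S.mass r - y.2) / r ^ 3 with hF
  set l := √y.2 with hl
  have hl2 : l ^ 2 = y.2 := Real.sq_sqrt hy.2.1.le
  have h1 : HasDerivAt (fun s => S.orbitPoint σ (y, s))
      (!₂[1, 0, 0], !₂[σ * (-F / w), -l / r ^ 2, 0]) r := by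
    refine HasDerivAt.prodMk ?_ ?_
    · exact HasDerivAt.euclidean_three (hasDerivAt_id r) (hasDerivAt_const _ _) (hasDerivAt_const _ _)
    · refine HasDerivAt.euclidean_three (hw.const_mul σ) ?_ (hasDerivAt_const _ _)
      refine ((hasDerivAt_const r l).div (hasDerivAt_id r) hr0.ne').congr_deriv ?_
      simp
  have h2 := (hξ (S.orbitPoint σ (y, r))).hasFDerivAt.comp_hasDerivAt r h1
  refine h2.congr_deriv ?_
  have h3 := fderiv_planar_rotation hξ hs r (σ * w) (l / r)
  have hgrad : gradient S.U (S.orbitPoint σ (y, r)).1 = !₂[deriv S.u r, 0, 0] := by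
    have hx : ‖(S.orbitPoint σ (y, r)).1‖ = r := norm_orbitPoint_fst (q := (y, r)) hr0
    rw [S.gradient_U (norm_ne_zero_iff.1 (by rw [hx]; exact hr0.ne')), hx]
    ext i
    fin_cases i <;> simp [orbitPoint, planar]
    field_simp
  -- The phase-space velocity is σw times the tangent to r ↦ `orbitPoint` plus an infinitesimal
  -- rotation of angular speed l/r², on which the derivative of a rotation invariant function
  -- vanishes.
  have hdir : ((S.orbitPoint σ (y, r)).2, -gradient S.U (S.orbitPoint σ (y, r)).1) =
      (σ * w) • ((!₂[1, 0, 0], !₂[σ * (-F / w), -l / r ^ 2, 0]) : Phase) +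
        (l / r ^ 2) • ((!₂[0, r, 0], !₂[-(l / r), σ * w, 0]) : Phase) := by
    rw [hgrad]
    refine Prod.ext ?_ ?_
    · ext i
      fin_cases i <;> simp [orbitPoint, planar]
      · exact Or.inl hwdef.symm
      · field_simp
        rfl
    · ext i
      fin_cases i <;> simp
      · have e1 : σ * w * (σ * (-F / w)) = -F := by
          field_simp
          rw [hσ]
          ring
        rw [e1, hF, mass]
        field_simp
        rw [hl2]
        ring
      · ring
  have h4 : smoothTransport S.U ξ (S.orbitPoint σ (y, r)) =
      σ * w * fderiv ℝ ξ (S.orbitPoint σ (y, r)) (!₂[1, 0, 0], !₂[σ * (-F / w), -l / r ^ 2, 0]) := by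
    rw [smoothTransport_eq hξ, hdir, map_add, map_smul, map_smul]
    have h5 : fderiv ℝ ξ (S.orbitPoint σ (y, r)) (!₂[0, r, 0], !₂[-(l / r), σ * w, 0]) = 0 := h3
    rw [h5, smul_zero, add_zero, smul_eq_mul]
  rw [h4]
  have : ∀ z : ℝ, z = σ * (σ * w * z) / w := by
    intro z
    field_simp
    rw [hσ]
    ring
  exact this _

/-! ### Elements of the Hilbert space given by continuous functions -/

theorem ν_lt_top {K : Set Phase} (hK : IsCompact K) (hKs : K ⊆ S.Ω₀) : S.ν K < ∞ := by
  have hc : ContinuousOn (fun p => 1 / |S.φ' (energy S.U p) (angMom p)|) K := by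
    have h : ContinuousOn (fun y : ℝ × ℝ => 1 / |S.φ' y.1 y.2|) S.posSet :=
      continuousOn_const.div S.isAdmissible.continuousOn.abs
        fun y hy => (abs_pos.2 (S.isAdmissible.deriv_ne _ _ hy)).ne'
    have hm : MapsTo S.energyAngMom K S.posSet := fun p hp => by
      have h1 := hKs hp
      rwa [S.Ω₀_eq] at h1
    exact ContinuousOn.comp (g := fun y : ℝ × ℝ => 1 / |S.φ' y.1 y.2|) (f := S.energyAngMom) h
      S.continuous_energyAngMom.continuousOn hm
  have hi := hc.integrableOn_compact (μ := volume) hK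
  rw [ν, withDensity_apply _ hK.measurableSet, Measure.restrict_restrict hK.measurableSet,
    inter_eq_self_of_subset_left hKs]
  exact hi.lintegral_lt_top

variable {S} in
theorem memLp_of_continuous {η : Phase → ℝ} (hη : Continuous η) (hc : HasCompactSupport η)
    (hs : tsupport η ⊆ S.Ω₀) : MemLp η 2 S.ν := by
  obtain ⟨B, hB⟩ := hη.bounded_above_of_compact_support hc
  have hK : MeasurableSet (tsupport η) := (isClosed_tsupport η).measurableSet
  have : IsFiniteMeasure (S.ν.restrict (tsupport η)) :=
    ⟨by simpa using S.ν_lt_top hc hs⟩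
  have h1 : MemLp η 2 (S.ν.restrict (tsupport η)) :=
    MemLp.of_bound hη.aestronglyMeasurable B (Eventually.of_forall hB)
  rw [← memLp_indicator_iff_restrict hK] at h1
  convert h1 using 1
  exact (indicator_eq_self.2 (subset_tsupport η)).symm

theorem exists_isRep_of_memLp {f : Phase → ℝ} (hm : Measurable f) (hs : RotationInvariant f)
    (hL : MemLp f 2 S.ν) : ∃ g : S.H, S.IsRep g f :=
  ⟨⟨hL.toLp f, f, hm, hs, hL.coeFn_toLp⟩, hm, hs, hL.coeFn_toLp⟩

variable {S} in
theorem IsTest.exists_isRep {ξ : Phase → ℝ} (h : S.IsTest ξ) : ∃ g : S.H, S.IsRep g ξ :=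
  S.exists_isRep_of_memLp h.1.continuous.measurable h.2.2.2
    (memLp_of_continuous h.1.continuous h.2.1 h.2.2.1)

variable {S} in
theorem IsTest.exists_isRep_smoothTransport {ξ : Phase → ℝ} (h : S.IsTest ξ) :
    ∃ g : S.H, S.IsRep g (smoothTransport S.U ξ) := by
  have hd : Differentiable ℝ ξ := h.1.differentiable one_ne_zero
  have hcont := continuous_smoothTransport S.contDiff_one_U h.1
  have hsub := tsupport_smoothTransport_subset (U := S.U) hd
  exact S.exists_isRep_of_memLp hcont.measurable
    (rotationInvariant_smoothTransport (S.contDiff_one_U.differentiable one_ne_zero) S.radial_U hd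
      h.2.2.2)
    (memLp_of_continuous hcont (h.2.1.of_isClosed_subset (isClosed_tsupport _) hsub)
      (hsub.trans h.2.2.1))

variable {S} in
theorem continuousOn_orbitPoint (σ : ℝ) {y : ℝ × ℝ} (hy : y ∈ S.orbitSet) :
    ContinuousOn (fun r => S.orbitPoint σ (y, r)) (Icc (S.rMinus y.1 y.2) (S.rPlus y.1 y.2)) := by
  have hw := (isOrbit hy).continuousOn
  refine continuous_planar.comp_continuousOn (s := Icc (S.rMinus y.1 y.2) (S.rPlus y.1 y.2))
    (f := fun r => (r, σ * S.speed y r, √y.2 / r)) ?_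
  refine continuousOn_id.prodMk ((continuousOn_const.mul hw).prodMk ?_)
  exact continuousOn_const.div continuousOn_id fun r hr => ((rMinus_pos hy).trans_le hr.1).ne'

variable {S} in
-- A test function is C¹ along the orbit up to the turning points, and its two branches agree there
-- because w = 0; integration by parts then has no boundary terms.
theorem coeff_smoothTransport {ξ : Phase → ℝ} (h : S.IsTest ξ) {y : ℝ × ℝ} (hy : y ∈ S.orbitSet)
    (k : ℤ) : S.coeff k (smoothTransport S.U ξ) y =
      2 * Real.pi * k / S.period y * S.coeff (-k) ξ y := by
  have hd : Differentiable ℝ ξ := h.1.differentiable one_ne_zero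
  have hcont := continuous_smoothTransport S.contDiff_one_U h.1
  have hend : ∀ r, S.speed y r = 0 → S.orbitPoint 1 (y, r) = S.orbitPoint (-1) (y, r) := by
    intro r hr
    simp [orbitPoint, hr]
  rw [coeff, coeff, period_eq hy]
  refine (isOrbit hy).orbitCoeff_of_hasDerivAt
    (h.1.continuous.comp_continuousOn (continuousOn_orbitPoint 1 hy))
    (h.1.continuous.comp_continuousOn (continuousOn_orbitPoint (-1) hy))
    (hcont.comp_continuousOn (continuousOn_orbitPoint 1 hy))
    (hcont.comp_continuousOn (continuousOn_orbitPoint (-1) hy))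
    (fun r hr => ?_) (fun r hr => ?_) ?_ ?_ k
  · exact (hasDerivAt_orbitPoint hd h.2.2.2 (σ := 1) (one_pow 2) hy hr).congr_deriv (by simp)
  · exact (hasDerivAt_orbitPoint hd h.2.2.2 (σ := -1) neg_one_sq hy hr).congr_deriv (by simp)
  · exact congrArg ξ (hend _ (isOrbit hy).left)
  · exact congrArg ξ (hend _ (isOrbit hy).right)

end RadialSteadyState

/-! ### Test functions supported on orbits -/

theorem contDiff_angMom : ContDiff ℝ 1 angMom := by
  have h : angMom = fun p => ‖p.1‖ ^ 2 * ‖p.2‖ ^ 2 - (inner ℝ p.1 p.2) ^ 2 := funext angMom_eq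
  rw [h]
  exact ((contDiff_fst.norm_sq ℝ).mul (contDiff_snd.norm_sq ℝ)).sub
    ((contDiff_fst.inner ℝ contDiff_snd).pow 2)

namespace RadialSteadyState

open Set InnerProductSpace

variable (S : RadialSteadyState)

theorem contDiff_energyAngMom : ContDiff ℝ 1 S.energyAngMom := by
  have h : ContDiff ℝ 1 (energy S.U) :=
    ((contDiff_snd.norm_sq ℝ).div_const 2).add (S.contDiff_one_U.comp contDiff_fst)
  exact h.prodMk contDiff_angMom

/-- E < E₀ < 0 and U → 0 at infinity confine x to a compact set; the energy bound then confines v.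
-/
theorem isCompact_preimage_energyAngMom {K : Set (ℝ × ℝ)} (hK : IsClosed K) (hKs : K ⊆ S.posSet) :
    IsCompact (S.energyAngMom ⁻¹' K) := by
  obtain ⟨E₀, hE₀, hcut⟩ := S.isAdmissible.cutoff
  have h1 : ∀ᶠ x in cocompact Space, E₀ < S.U x := S.tendsto_U.eventually_const_lt hE₀
  obtain ⟨C, hC, hCs⟩ := mem_cocompact.1 h1
  obtain ⟨B, hB⟩ := hC.exists_bound_of_continuousOn S.contDiff_U.continuous.continuousOn
  refine (hC.prod (isCompact_closedBall (0 : Space) (2 * B + 1))).of_isClosed_subset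
    (hK.preimage S.continuous_energyAngMom) fun p hp => ?_
  have hE : ‖p.2‖ ^ 2 / 2 + S.U p.1 < E₀ := hcut _ _ (hKs hp)
  have hx : p.1 ∈ C := by
    by_contra hx
    have h2 : E₀ < S.U p.1 := hCs hx
    have := sq_nonneg ‖p.2‖
    linarith
  refine ⟨hx, ?_⟩
  have h3 := neg_le_of_abs_le (hB _ hx)
  have h4 : 0 ≤ B := (norm_nonneg _).trans (hB _ hx)
  rw [mem_closedBall_zero_iff]
  nlinarith [norm_nonneg p.2]

variable {S} in
-- The factor a may be singular at x = 0: on the support of χ one has L > 0, which excludes x = 0.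
theorem isTest_mul {χ : ℝ × ℝ → ℝ} (hχ : ContDiff ℝ (⊤ : ℕ∞) χ) (hs : tsupport χ ⊆ S.orbitSet)
    {a : Phase → ℝ} (ha : ∀ p : Phase, p.1 ≠ 0 → ContDiffAt ℝ 1 a p) (hr : RotationInvariant a) :
    S.IsTest fun p => χ (S.energyAngMom p) * a p := by
  have hcl : IsClosed (S.energyAngMom ⁻¹' tsupport χ) :=
    (isClosed_tsupport χ).preimage S.continuous_energyAngMom
  have hzero : ∀ p, p ∉ S.energyAngMom ⁻¹' tsupport χ → χ (S.energyAngMom p) * a p = 0 :=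
    fun p hp => by rw [image_eq_zero_of_notMem_tsupport hp, zero_mul]
  have hpos : tsupport χ ⊆ S.posSet := fun y hy => (hs hy).1
  have hsub : tsupport (fun p => χ (S.energyAngMom p) * a p) ⊆ S.energyAngMom ⁻¹' tsupport χ :=
    closure_minimal (fun p hp => by_contra fun h => hp (hzero p h)) hcl
  refine ⟨contDiff_iff_contDiffAt.2 fun p => ?_, ?_, hsub.trans fun p hp => hpos hp,
    fun A hA x v => ?_⟩
  · by_cases hp : p.1 = 0
    · have hnot : p ∉ S.energyAngMom ⁻¹' tsupport χ := fun h => by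
        have h1 : 0 < angMom p := (hs h).2.1
        rw [angMom_eq, hp] at h1
        simp at h1
      refine (contDiffAt_const (c := (0 : ℝ))).congr_of_eventuallyEq ?_
      filter_upwards [hcl.isOpen_compl.mem_nhds hnot] with q hq
      exact hzero q hq
    · exact (((hχ.of_le (by exact_mod_cast le_top)).comp S.contDiff_energyAngMom).contDiffAt).mul
        (ha p hp)
  · exact (S.isCompact_preimage_energyAngMom (isClosed_tsupport χ) hpos).of_isClosed_subset
      (isClosed_tsupport _) hsub
  · simp only [S.rotationInvariant_energyAngMom A hA x v, hr A hA x v]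

variable {S} in
-- Over a compact K the turning points stay in a compact subinterval of (0, ∞), on which c is
-- bounded.
theorem integrableOn_mul_fst_preimage {c h : (ℝ × ℝ) × ℝ → ℝ} (hm : Measurable c)
    (hc : ContinuousOn c {q | 0 < q.2}) (hi : MemLp h 2 S.orbitMeasure)
    {K : Set (ℝ × ℝ)} (hK : IsCompact K) (hKs : K ⊆ S.orbitSet) :
    IntegrableOn (fun q => c q * h q) (Prod.fst ⁻¹' K) S.orbitMeasure := by
  have h1 : ContinuousOn (fun y : ℝ × ℝ => S.rMinus y.1 y.2) K := fun y hy =>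
    (continuousAt_rMinus (hKs hy)).continuousWithinAt
  have h2 : ContinuousOn (fun y : ℝ × ℝ => S.rPlus y.1 y.2) K := fun y hy =>
    (continuousAt_rPlus (hKs hy)).continuousWithinAt
  obtain ⟨δ, hδ, hδK⟩ := hK.exists_forall_le' h1 (a := 0) fun y hy => rMinus_pos (hKs hy)
  obtain ⟨R, hR⟩ := hK.bddAbove_image h2
  have hsub : K ×ˢ Icc δ R ⊆ {q : (ℝ × ℝ) × ℝ | 0 < q.2} := fun q hq => hδ.trans_le hq.2.1
  obtain ⟨B, hB⟩ := (hK.prod isCompact_Icc).exists_bound_of_continuousOn (hc.mono hsub)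
  refine (integrableOn_fst_preimage hi hK hKs).bdd_mul (c := B) hm.aestronglyMeasurable ?_
  refine (ae_restrict_iff' (measurable_fst hK.measurableSet)).2 ?_
  filter_upwards [S.ae_orbitMeasure_mem] with q hq hqK
  exact hB q ⟨hqK, (hδK _ hqK).trans hq.2.1.le, hq.2.2.le.trans (hR (mem_image_of_mem _ hqK))⟩

/-! ### The weak transport equation along orbits -/

variable {S} in
/-- A pair in the weak graph satisfies the transport equation along almost every orbit, weakly
against functions which extend to phase space. -/
theorem ae_orbitIntegral_of_mem_weakTransportGraph {g m : S.H}
    (hgm : (g, m) ∈ S.weakTransportGraph) {f μ : Phase → ℝ} (hf : S.IsRep g f) (hμ : S.IsRep m μ)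
    {a : Phase → ℝ} (ha : ∀ p : Phase, p.1 ≠ 0 → ContDiffAt ℝ 1 a p) (hr : RotationInvariant a)
    {A B : ℝ → (ℝ × ℝ) × ℝ → ℝ}
    (mA : ∀ σ, Measurable (A σ)) (mB : ∀ σ, Measurable (B σ))
    (cA : ∀ σ, ContinuousOn (A σ) {q | 0 < q.2}) (cB : ∀ σ, ContinuousOn (B σ) {q | 0 < q.2})
    (hA : ∀ σ, σ ^ 2 = 1 → ∀ y ∈ S.orbitSet, ∀ r ∈ S.radii y, a (S.orbitPoint σ (y, r)) = A σ (y, r))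
    (hB : ∀ σ, σ ^ 2 = 1 → ∀ y ∈ S.orbitSet, ∀ r ∈ S.radii y,
      HasDerivAt (fun s => A σ (y, s)) (σ * B σ (y, r) / S.speed y r) r) :
    ∀ᵐ y, y ∈ S.orbitSet → S.orbitIntegral (fun q =>
      B 1 q * f (S.orbitPoint 1 q) + B (-1) q * f (S.orbitPoint (-1) q) +
        (A 1 q * μ (S.orbitPoint 1 q) + A (-1) q * μ (S.orbitPoint (-1) q))) y = 0 := by
  obtain ⟨f1, f2⟩ := memLp_comp_orbitPoint hf.measurable hf.rotationInvariant hf.memLp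
  obtain ⟨μ1, μ2⟩ := memLp_comp_orbitPoint hμ.measurable hμ.rotationInvariant hμ.memLp
  refine ae_orbitIntegral_eq_zero (fun K hK hKs =>
    ((integrableOn_mul_fst_preimage (mB 1) (cB 1) f1 hK hKs).add
      (integrableOn_mul_fst_preimage (mB (-1)) (cB (-1)) f2 hK hKs)).add
    ((integrableOn_mul_fst_preimage (mA 1) (cA 1) μ1 hK hKs).add
      (integrableOn_mul_fst_preimage (mA (-1)) (cA (-1)) μ2 hK hKs))) fun χ hχ _ hs => ?_
  have hξ := isTest_mul hχ hs ha hr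
  set ξ : Phase → ℝ := fun p => χ (S.energyAngMom p) * a p with hξdef
  have hd : Differentiable ℝ ξ := hξ.1.differentiable one_ne_zero
  have hDm := (continuous_smoothTransport S.contDiff_one_U hξ.1).measurable
  have hDr := rotationInvariant_smoothTransport (S.contDiff_one_U.differentiable one_ne_zero)
    S.radial_U hd hξ.2.2.2
  have e1 : ∀ σ, σ ^ 2 = 1 → ∀ y ∈ S.orbitSet, ∀ r ∈ S.radii y,
      ξ (S.orbitPoint σ (y, r)) = χ y * A σ (y, r) := fun σ hσ y hy r hr => by
    simp only [hξdef]
    rw [energyAngMom_orbitPoint_of_mem (q := (y, r)) hσ hy hr, hA σ hσ y hy r hr]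
  -- χ(E, L) is constant along the orbit, so only a is differentiated; uniqueness of the derivative
  -- along the orbit identifies the transport of the test function.
  have e2 : ∀ σ, σ ^ 2 = 1 → ∀ y ∈ S.orbitSet, ∀ r ∈ S.radii y,
      smoothTransport S.U ξ (S.orbitPoint σ (y, r)) = χ y * B σ (y, r) := fun σ hσ y hy r hr => by
    have d1 := hasDerivAt_orbitPoint hd hξ.2.2.2 hσ hy hr
    have d2 : HasDerivAt (fun s => ξ (S.orbitPoint σ (y, s)))
        (χ y * (σ * B σ (y, r) / S.speed y r)) r := by
      refine ((hB σ hσ y hy r hr).const_mul (χ y)).congr_of_eventuallyEq ?_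
      filter_upwards [isOpen_Ioo.mem_nhds hr] with s hs
      exact e1 σ hσ y hy s hs
    have d3 := d1.unique d2
    have hw := (speed_pos hy hr).ne'
    have hσ0 : σ ≠ 0 := fun h => by simp [h] at hσ
    field_simp at d3
    linarith
  obtain ⟨i1, i2, e3⟩ := hgm ξ hξ
  have c1 : (fun p => (g : Lp ℝ 2 S.ν) p * smoothTransport S.U ξ p) =ᵐ[S.ν]
      fun p => f p * smoothTransport S.U ξ p := hf.ae_eq.mul (ae_eq_refl _)
  have c2 : (fun p => (m : Lp ℝ 2 S.ν) p * ξ p) =ᵐ[S.ν] fun p => μ p * ξ p :=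
    hμ.ae_eq.mul (ae_eq_refl _)
  have j1 := i1.congr c1
  have j2 := i2.congr c2
  have e4 : ∫ p, (f p * smoothTransport S.U ξ p + μ p * ξ p) ∂S.ν = 0 := by
    rw [integral_add j1 j2, ← integral_congr_ae c1, ← integral_congr_ae c2]
    linarith
  rw [integral_ν (f := fun p => f p * smoothTransport S.U ξ p + μ p * ξ p)
    ((hf.measurable.mul hDm).add (hμ.measurable.mul hξ.1.continuous.measurable))
    (fun A hA x v => by simp only [hf.rotationInvariant A hA x v, hμ.rotationInvariant A hA x v,
      hDr A hA x v, hξ.2.2.2 A hA x v]) (j1.add j2)] at e4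
  rw [← e4]
  refine integral_congr_ae ?_
  filter_upwards [S.ae_orbitMeasure_mem] with q hq
  have t1 := e1 1 (one_pow 2) q.1 hq.1 q.2 hq.2
  have t2 := e1 (-1) neg_one_sq q.1 hq.1 q.2 hq.2
  have t3 := e2 1 (one_pow 2) q.1 hq.1 q.2 hq.2
  have t4 := e2 (-1) neg_one_sq q.1 hq.1 q.2 hq.2
  simp only [Prod.mk.eta] at t1 t2 t3 t4
  rw [t1, t2, t3, t4]
  ring

theorem continuousOn_speed : ContinuousOn (fun q : (ℝ × ℝ) × ℝ => S.speed q.1 q.2) {q | 0 < q.2} := by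
  have h1 : ContinuousOn (fun q : (ℝ × ℝ) × ℝ => S.Ψ q.1.2 q.2) {q | 0 < q.2} :=
    ContinuousOn.comp (g := fun q : ℝ × ℝ => S.Ψ q.1 q.2) (f := fun q : (ℝ × ℝ) × ℝ => (q.1.2, q.2))
      S.continuousOn_Ψ₂ (by fun_prop) fun q hq => hq
  exact Real.continuous_sqrt.comp_continuousOn
    ((continuous_const.mul (continuous_fst.comp continuous_fst)).continuousOn.sub
      (continuousOn_const.mul h1))

variable {S} in
-- Tests of the form |x|ⁿ, even under time reversal. Their transport is ±w n rⁿ⁻¹ on the two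
-- branches, so f enters through its odd part and μ through its even part.
theorem ae_integral_even_of_mem_weakTransportGraph {g m : S.H}
    (hgm : (g, m) ∈ S.weakTransportGraph) {f μ : Phase → ℝ} (hf : S.IsRep g f) (hμ : S.IsRep m μ)
    (n : ℕ) : ∀ᵐ y, y ∈ S.orbitSet → ∫ r in S.radii y,
      ((f (S.orbitPoint 1 (y, r)) - f (S.orbitPoint (-1) (y, r))) * (n * r ^ (n - 1)) +
        (μ (S.orbitPoint 1 (y, r)) + μ (S.orbitPoint (-1) (y, r))) / S.speed y r * r ^ n) = 0 := by
  have h := ae_orbitIntegral_of_mem_weakTransportGraph hgm hf hμ (a := fun p => ‖p.1‖ ^ n)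
    (A := fun _ q => q.2 ^ n) (B := fun σ q => σ * S.speed q.1 q.2 * (n * q.2 ^ (n - 1)))
    (fun p hp => (contDiffAt_fst.norm ℝ hp).pow n)
    (fun A _ x v => by simp only [A.norm_map])
    (fun σ => measurable_snd.pow_const n)
    (fun σ => (S.measurable_speed.const_mul σ).mul ((measurable_snd.pow_const _).const_mul _))
    (fun σ => (continuous_snd.pow n).continuousOn)
    (fun σ => (S.continuousOn_speed.const_mul σ).mul
      ((continuous_snd.pow (n - 1)).const_mul (n : ℝ)).continuousOn)
    (fun σ _ y hy r hr => by
      rw [norm_orbitPoint_fst (q := (y, r)) (radius_pos hy hr)])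
    (fun σ hσ y hy r hr => (hasDerivAt_pow n r).congr_deriv (by
      have := (speed_pos hy hr).ne'
      field_simp
      rw [hσ, mul_one]))
  filter_upwards [h] with y hy hmem
  rw [← hy hmem]
  refine setIntegral_congr_fun (S.measurableSet_radii y) fun r hr => ?_
  have := (speed_pos hmem hr).ne'
  simp only
  field_simp
  ring

variable {S} in
-- Tests of the form radial velocity times |x|ⁿ, which take the values ±w rⁿ on the two branches;
-- the parities of f and μ are exchanged compared with the tests |x|ⁿ.
theorem ae_integral_odd_of_mem_weakTransportGraph {g m : S.H}
    (hgm : (g, m) ∈ S.weakTransportGraph) {f μ : Phase → ℝ} (hf : S.IsRep g f) (hμ : S.IsRep m μ)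
    (n : ℕ) : ∀ᵐ y, y ∈ S.orbitSet → ∫ r in S.radii y,
      ((f (S.orbitPoint 1 (y, r)) + f (S.orbitPoint (-1) (y, r))) * S.speed y r *
          (n * r ^ (n - 1)) +
        ((f (S.orbitPoint 1 (y, r)) + f (S.orbitPoint (-1) (y, r))) *
            (-((r * S.mass r - y.2) / r ^ 3) / S.speed y r) +
          (μ (S.orbitPoint 1 (y, r)) - μ (S.orbitPoint (-1) (y, r)))) * r ^ n) = 0 := by
  have mF : Measurable fun q : (ℝ × ℝ) × ℝ => (q.2 * S.mass q.2 - q.1.2) / q.2 ^ 3 := by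
    have : Measurable S.mass :=
      ((continuous_pow 2).mul S.continuous_deriv_u).measurable
    exact ((measurable_snd.mul (this.comp measurable_snd)).sub
      (measurable_snd.comp measurable_fst)).div (measurable_snd.pow_const 3)
  have cF : ContinuousOn (fun q : (ℝ × ℝ) × ℝ => (q.2 * S.mass q.2 - q.1.2) / q.2 ^ 3)
      {q | 0 < q.2} := by
    have : Continuous S.mass := (continuous_pow 2).mul S.continuous_deriv_u
    exact ((continuous_snd.mul (this.comp continuous_snd)).sub
      (continuous_snd.comp continuous_fst)).continuousOn.div (continuous_snd.pow 3).continuousOn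
        fun q hq => pow_ne_zero 3 (ne_of_gt hq)
  have h := ae_orbitIntegral_of_mem_weakTransportGraph hgm hf hμ
    (a := fun p => ⟪p.1, p.2⟫_ℝ / ‖p.1‖ * ‖p.1‖ ^ n)
    (A := fun σ q => σ * S.speed q.1 q.2 * q.2 ^ n)
    (B := fun _ q => -((q.2 * S.mass q.2 - q.1.2) / q.2 ^ 3) * q.2 ^ n +
      S.speed q.1 q.2 * S.speed q.1 q.2 * (n * q.2 ^ (n - 1)))
    (fun p hp => ((contDiffAt_fst.inner ℝ contDiffAt_snd).div (contDiffAt_fst.norm ℝ hp)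
      (norm_ne_zero_iff.2 hp)).mul ((contDiffAt_fst.norm ℝ hp).pow n))
    (fun A _ x v => by simp only [A.norm_map, A.inner_map_map])
    (fun σ => (S.measurable_speed.const_mul σ).mul (measurable_snd.pow_const n))
    (fun σ => (mF.neg.mul (measurable_snd.pow_const n)).add
      ((S.measurable_speed.mul S.measurable_speed).mul ((measurable_snd.pow_const _).const_mul _)))
    (fun σ => (S.continuousOn_speed.const_mul σ).mul (continuous_snd.pow n).continuousOn)
    (fun σ => (cF.neg.mul (continuous_snd.pow n).continuousOn).add
      ((S.continuousOn_speed.mul S.continuousOn_speed).mul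
      ((continuous_snd.pow (n - 1)).const_mul (n : ℝ)).continuousOn))
    (fun σ _ y hy r hr => by
      have hr0 := radius_pos hy hr
      simp only
      rw [norm_orbitPoint_fst (q := (y, r)) hr0, inner_orbitPoint]
      field_simp)
    (fun σ hσ y hy r hr => by
      have hw := (speed_pos hy hr).ne'
      refine ((((isOrbit hy).hasDerivAt r hr).const_mul σ).mul (hasDerivAt_pow n r)).congr_deriv ?_
      field_simp)
  filter_upwards [h] with y hy hmem
  rw [← hy hmem]
  refine setIntegral_congr_fun (S.measurableSet_radii y) fun r hr => ?_
  have := (speed_pos hmem hr).ne'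
  simp only
  field_simp
  ring

/-! ### The weak graph in terms of Fourier coefficients -/

/-- The multipliers of the transport operator. -/
def frequency (k : ℤ) (y : ℝ × ℝ) : ℝ := 2 * Real.pi * k / S.period y

variable {S} in
theorem fourier_eq_of_coeff_eq {g m : S.H} {f μ : Phase → ℝ} (hf : S.IsRep g f) (hμ : S.IsRep m μ)
    {k : ℤ} (h : ∀ᵐ y, y ∈ S.orbitSet → S.coeff k μ y = S.frequency k y * S.coeff (-k) f y) :
    S.fourier m k =ᵐ[S.energyMeasure] fun y => S.frequency k y * S.fourier g (-k) y := by
  refine S.ae_energyMeasure_of_ae ?_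
  filter_upwards [h, ae_coeff_eq hf (-k), ae_coeff_eq hμ k] with y e1 e2 e3 hy
  have e4 := e1 hy
  rw [e2 hy, e3 hy] at e4
  refine mul_left_cancel₀ (period_pos hy).ne' ?_
  rw [e4]
  ring

/-- The pairs which satisfy the transport equation in terms of Fourier coefficients. -/
def fourierGraph : Submodule ℝ (S.H × S.H) where
  carrier := {q | ∀ k, S.fourier q.2 k =ᵐ[S.energyMeasure]
    fun y => S.frequency k y * S.fourier q.1 (-k) y}
  zero_mem' k := by
    filter_upwards [Lp.coeFn_zero ℝ 2 S.energyMeasure] with y h0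
    simp only [Prod.fst_zero, Prod.snd_zero, map_zero, lp.coeFn_zero, Pi.zero_apply, h0, mul_zero]
  add_mem' := by
    intro p q hp hq k
    filter_upwards [hp k, hq k, Lp.coeFn_add (S.fourier p.1 (-k)) (S.fourier q.1 (-k)),
      Lp.coeFn_add (S.fourier p.2 k) (S.fourier q.2 k)] with y e1 e2 e3 e4
    simp only [Prod.fst_add, Prod.snd_add, map_add, lp.coeFn_add, Pi.add_apply, e3, e4, e1, e2]
    ring
  smul_mem' := by
    intro c p hp k
    filter_upwards [hp k, Lp.coeFn_smul c (S.fourier p.1 (-k)),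
      Lp.coeFn_smul c (S.fourier p.2 k)] with y e1 e3 e4
    simp only [Prod.smul_fst, Prod.smul_snd, map_smul, lp.coeFn_smul, Pi.smul_apply, e3, e4, e1,
      smul_eq_mul]
    ring

theorem isSkewShift_fourierGraph : IsSkewShift S.fourierGraph S.fourier S.frequency where
  measurable k := measurable_const.div S.measurable_period
  odd k y := by
    simp only [frequency, Int.cast_neg]
    ring
  mem_iff g m := Iff.rfl

/-- Each test function has its own exceptional set of orbits. Monomials are only countably many, so
almost every orbit satisfies all the tested identities, and `orbitCoeff_of_tests` can be applied
orbit by orbit. -/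
theorem weakTransportGraph_le : S.weakTransportGraph ≤ S.fourierGraph := by
  rintro ⟨g, m⟩ hgm k
  obtain ⟨f, hf⟩ := S.exists_isRep g
  obtain ⟨μ, hμ⟩ := S.exists_isRep m
  refine fourier_eq_of_coeff_eq hf hμ ?_
  filter_upwards [ae_all_iff.2 fun n => ae_integral_even_of_mem_weakTransportGraph hgm hf hμ n,
    ae_all_iff.2 fun n => ae_integral_odd_of_mem_weakTransportGraph hgm hf hμ n,
    hf.ae_integrableOn, hμ.ae_integrableOn] with y e1 e2 e3 e4 hy
  have h := (isOrbit hy).orbitCoeff_of_tests (e3 hy).1 (e3 hy).2 (e4 hy).1 (e4 hy).2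
    (fun n => e1 n hy) (fun n => e2 n hy) k
  rw [coeff, coeff, frequency, period_eq hy]
  exact h

variable {S} in
theorem IsRep.integral_mul {h : S.H} {η : Phase → ℝ} (hη : S.IsRep h η) (g : S.H) :
    Integrable (fun p => (g : Lp ℝ 2 S.ν) p * η p) S.ν ∧
      ∫ p, (g : Lp ℝ 2 S.ν) p * η p ∂S.ν = ⟪g, h⟫_ℝ := by
  refine ⟨(Lp.memLp (g : Lp ℝ 2 S.ν)).integrable_mul hη.memLp, ?_⟩
  rw [Submodule.coe_inner, L2.inner_def]
  refine integral_congr_ae ?_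
  filter_upwards [hη.ae_eq] with p hp
  rw [hp, RCLike.inner_apply, conj_trivial, mul_comm]

/-- A test function ξ together with its transport lies in `fourierGraph`. The weak identity is
therefore an instance of the antisymmetry of this graph. -/
theorem fourierGraph_le : S.fourierGraph ≤ S.weakTransportGraph := by
  rintro ⟨g, m⟩ hgm ξ hξ
  obtain ⟨x, hx⟩ := hξ.exists_isRep
  obtain ⟨d, hd⟩ := hξ.exists_isRep_smoothTransport
  have hxd : (x, d) ∈ S.fourierGraph := fun k => fourier_eq_of_coeff_eq hx hd
    (Eventually.of_forall fun y hy => coeff_smoothTransport hξ hy k)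
  obtain ⟨i1, e1⟩ := hd.integral_mul g
  obtain ⟨i2, e2⟩ := hx.integral_mul m
  refine ⟨i1, i2, ?_⟩
  change ∫ p, (g : Lp ℝ 2 S.ν) p * smoothTransport S.U ξ p ∂S.ν =
    -∫ p, (m : Lp ℝ 2 S.ν) p * ξ p ∂S.ν
  rw [e1, e2, S.isSkewShift_fourierGraph.inner_comm_neg hgm hxd, neg_neg]

theorem isSkewShift_weakTransportGraph :
    IsSkewShift S.weakTransportGraph S.fourier S.frequency := by
  rw [le_antisymm S.weakTransportGraph_le S.fourierGraph_le]
  exact S.isSkewShift_fourierGraph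

end RadialSteadyState

namespace RadialSteadyState

open Set

variable (S : RadialSteadyState)

/-! ### The spectrum -/

/-- The squares of the angular frequencies of the radial motion. -/
def frequencySet : Set ℝ := {lam : ℝ | ∃ k : ℕ, ∃ E L : ℝ, (E, L) ∈ interior S.ΩEL ∧
  lam = (2 * Real.pi * k / S.T E L) ^ 2}

variable {S} in
theorem frequency_sq_mem {y : ℝ × ℝ} (hy : y ∈ S.orbitSet) (k : ℤ) :
    S.frequency k y ^ 2 ∈ S.frequencySet := by
  refine ⟨k.natAbs, y.1, y.2, by rwa [S.interior_ΩEL], ?_⟩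
  have h : ((k.natAbs : ℝ)) = |(k : ℝ)| := by
    rw [Nat.cast_natAbs, Int.cast_abs]
  rw [frequency, period_of_mem hy, h, div_pow, div_pow, mul_pow, mul_pow, mul_pow, mul_pow, sq_abs]

theorem continuousOn_frequency (k : ℤ) : ContinuousOn (S.frequency k) S.orbitSet := by
  have h : ContinuousOn (fun y : ℝ × ℝ => 2 * Real.pi * k / S.T y.1 y.2) S.orbitSet :=
    continuousOn_const.div S.continuousOn_T fun _ hy => (T_pos hy).ne'
  refine h.congr fun y hy => ?_
  rw [frequency, period_of_mem hy]

/-- A point off the closure has positive distance d from all values ω_k², hence a bounded resolvent.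
Near a point of the closure, the condition |ω_k² - lam| < ε defines for some k a nonempty open set,
which has positive measure. -/
theorem spectrumSet_negTransportSq :
    spectrumSet S.negTransportSq = closure S.frequencySet := by
  have hsh := S.isSkewShift_weakTransportGraph
  refine Subset.antisymm (fun lam hlam => ?_) fun lam hlam => ?_
  · by_contra hnot
    obtain ⟨d, hd, hball⟩ := Metric.isOpen_iff.1 isClosed_closure.isOpen_compl lam hnot
    refine hlam (hsh.inResolventSet hd fun k => S.ae_energyMeasure_of_ae
      (Eventually.of_forall fun y hy => ?_))
    by_contra! hlt
    exact hball (Metric.mem_ball.2 ((Real.dist_eq _ _).trans_lt hlt))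
      (subset_closure (frequency_sq_mem hy k))
  · refine hsh.not_inResolventSet fun ε hε => ?_
    obtain ⟨_, ⟨k, E, L, hy, rfl⟩, hdist⟩ := Metric.mem_closure_iff.1 hlam ε hε
    rw [S.interior_ΩEL] at hy
    refine ⟨k, ?_⟩
    have hc : ContinuousOn (fun y => |S.frequency k y ^ 2 - lam|) S.orbitSet :=
      (((S.continuousOn_frequency k).pow 2).sub continuousOn_const).abs
    refine (S.energyMeasure_pos (hc.isOpen_inter_preimage S.isOpen_orbitSet isOpen_Iio)
      ⟨(E, L), hy, ?_⟩ inter_subset_left).trans_le (measure_mono inter_subset_right)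
    rw [mem_preimage, mem_Iio, frequency, period_of_mem hy, ← Real.dist_eq, dist_comm]
    exact_mod_cast hdist

/-- The freedom to multiply by functions of (E, L) makes every nontrivial eigenspace infinite
dimensional, k = 0 included. -/
theorem discreteSpectrum_negTransportSq : discreteSpectrum S.negTransportSq = ∅ := by
  refine eq_empty_of_forall_notMem fun lam hlam => ?_
  obtain ⟨-, -, hne, hfin⟩ := hlam
  have hfin' : FiniteDimensional ℝ (eigenspace (negSq S.weakTransportGraph.toLinearPMap) lam) := hfin
  refine hne (S.isSkewShift_weakTransportGraph.eigenspace_eq_bot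
    -- A bounded function whose level sets lie in lines E = tan c, hence are null.
    (b := fun y : ℝ × ℝ => Real.arctan y.1) (B := Real.pi)
    (Real.measurable_arctan.comp measurable_fst) (fun y => ?_) (fun c => ?_) lam)
  · rw [abs_le]
    constructor
    · linarith [Real.neg_pi_div_two_lt_arctan y.1, Real.pi_pos]
    · linarith [Real.arctan_lt_pi_div_two y.1, Real.pi_pos]
  · refine S.ae_energyMeasure_of_ae ?_
    have h : ∀ᵐ y : ℝ × ℝ, y.1 ≠ Real.tan c :=
      Measure.quasiMeasurePreserving_fst.ae (μb := (volume : Measure ℝ))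
        (Measure.ae_ne volume (Real.tan c))
    filter_upwards [h] with y hy _ heq
    exact hy (by rw [← heq, Real.tan_arctan])

end RadialSteadyState

end VlasovPoisson

end

theorem theorem5p6 (S : VlasovPoisson.RadialSteadyState) :
    -- the weakly defined transport operator is single-valued, i.e. it has the weak graph
    S.transport.graph = S.weakTransportGraph ∧
    IsSelfAdjoint S.negTransportSq ∧
    VlasovPoisson.spectrumSet S.negTransportSq =
      closure {lam : ℝ | ∃ k : ℕ, ∃ E L : ℝ, (E, L) ∈ interior S.ΩEL ∧
        lam = (2 * Real.pi * k / S.T E L) ^ 2} ∧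
    VlasovPoisson.essentialSpectrum S.negTransportSq =
      VlasovPoisson.spectrumSet S.negTransportSq := by
  refine ⟨S.isSkewShift_weakTransportGraph.graph_eq, S.isSkewShift_weakTransportGraph.isSelfAdjoint_negSq,
    S.spectrumSet_negTransportSq, ?_⟩
  rw [VlasovPoisson.essentialSpectrum, S.discreteSpectrum_negTransportSq, Set.sdiff_empty]
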